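/- Let $\mathcal S$ be a system of $n+1$ bodies of masses $m_0,\dots,m_n>0$ in Newtonian gravitational interaction, $n_s$ of which ($n_s\le n+1$) are rigid bodies (bounded mass distributions with positive principal moments of inertia $A_j,B_j,C_j$) while the others are point masses. Let $\mathbf I_j,\mathbf J_j,\mathbf K_j$ be the direct orthonormal principal axes of the $j$-th rigid body and $\mathbf G_j$ its spin angular momentum, and consider motions defined for all times, without contact between bodies, of the Hamiltonian system $$\mathcal H=\sum_{i}\frac{\|\mathbf p_i\|^2}{2m_i}+\sum_{j}\Big(\frac{(\mathbf G_j\cdot\mathbf I_j)^2}{2A_j}+\frac{(\mathbf G_j\cdot\mathbf J_j)^2}{2B_j}+\frac{(\mathbf G_j\cdot\mathbf K_j)^2}{2C_j}\Big)-\sum_{i<i'}\iint\frac{\mathcal G\,dm_i\,dm_{i'}}{\|x-y\|},$$ that is, of $\dot{\mathbf u}_i=\nabla_{\mathbf p_i}\mathcal H$, $\dot{\mathbf p}_i=-\nabla_{\mathbf u_i}\mathcal H$ for the barycentres $\mathbf u_i$ and momenta $\mathbf p_i$ of the bodies, and $\dot{\mathbf I}_j=\nabla_{\mathbf G_j}\mathcal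 H\times\mathbf I_j$ (likewise $\mathbf J_j,\mathbf K_j$), $\dot{\mathbf G}_j=\nabla_{\mathbf I_j}\mathcal H\times\mathbf I_j+\nabla_{\mathbf J_j}\mathcal H\times\mathbf J_j+\nabla_{\mathbf K_j}\mathcal H\times\mathbf K_j+\nabla_{\mathbf G_j}\mathcal H\times\mathbf G_j$. In the frame centred on one of the bodies, say number $c$, the system is described by the vectors $\mathbf r_i=\mathbf u_i-\mathbf u_c$ and their conjugate momenta $\tilde{\mathbf r}_i$ ($i\ne c$), where $\tilde{\mathbf r}_i=\mathbf p_i-\frac{m_i}{\sum_l m_l}\sum_l\mathbf p_l$ is the momentum of body $i$ relative to the barycentre of the system, and by $\mathbf I_j,\mathbf J_j,\mathbf K_j,\mathbf G_j$ ($1\le j\le n_s$). Let $\mathbf W_0=\sum_{i\neq c}\mathbf r_i\times\tilde{\mathbf r}_i+\sum_j\mathbf G_j$ be the total angular momentum, evaluated at $t=0$. A vector function $Z(t)$ is called regular quasiperiodic with frequencies $\nu=(\nu_1,\dots,\nu_m)$ if $Z(t)=\sum_{k\in\mathbb Z^m}a_k\,e^{i\langle k,\nu\rangle t}$ with coefficients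 $a_k\in\mathbb C^3$ decreasing faster than any power of $|k|$ (equivalently, $Z(t)=F(\nu t)$ with $F$ smooth on the torus $\mathbb T^m$). A solution is called regular quasiperiodic if all the vectors $\mathbf r_i,\tilde{\mathbf r}_i,\mathbf I_j,\mathbf J_j,\mathbf K_j,\mathbf G_j$ are regular quasiperiodic with the same finitely many rationally independent frequencies. Then for every regular quasiperiodic solution with $\mathbf W_0\neq 0$, the total angular momentum is constant, and there exist a constant $\Omega\in\mathbb R$ and $3(n+n_s)-2$ rationally independent frequencies $\nu_k$ such that every $Z\in\{\mathbf r_i,\tilde{\mathbf r}_i,\mathbf I_j,\mathbf J_j,\mathbf K_j,\mathbf G_j\}$ can be written as $$Z(t)=\mathcal R_3(\Omega t)\,\tilde Z(t),$$ where $\mathcal R_3(\theta)$ is the rotation of angle $\theta$ about the oriented axis $\mathbf W_0$ and $\tilde Z$ is regular quasiperiodic with the frequencies $(\nu_k)$. -/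

import Mathlib

open MeasureTheory

noncomputable section

namespace RigidBodies

/-- Physical space, with its Euclidean norm. -/
abbrev E3 := EuclideanSpace ℝ (Fin 3)

/-- The vector product of Euclidean three-space. -/
def cross (u v : E3) : E3 :=
  WithLp.toLp 2 (crossProduct (WithLp.ofLp u) (WithLp.ofLp v))

/-- The rotation of angle `θ` about the oriented axis spanned by the unit vector `k`
(Rodrigues' formula). -/
def axisRotation (k : E3) (θ : ℝ) (v : E3) : E3 :=
  Real.cos θ • v + Real.sin θ • cross k v + ((1 - Real.cos θ) * inner ℝ k v) • k

/-- The physical data of `n + 1` gravitating bodies. The bodies in `solids` are rigid bodies; all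
the others are point masses. `density j` is the mass distribution of the rigid body `j`, written
in coordinates with origin at its barycentre and along its principal axes of inertia. -/
structure GravSystem (n : ℕ) where
  gravConst : ℝ
  gravConst_pos : 0 < gravConst
  mass : Fin (n + 1) → ℝ
  mass_pos : ∀ i, 0 < mass i
  solids : Finset (Fin (n + 1))
  density : solids → Measure E3
  density_univ : ∀ j, density j Set.univ = ENNReal.ofReal (mass j)
  density_bounded : ∀ j, ∃ R : ℝ, density j (Metric.closedBall 0 R)ᶜ = 0
  density_barycentre : ∀ j a, ∫ x, x a ∂(density j) = 0
  density_principal : ∀ j a b, a ≠ b → ∫ x, x a * x b ∂(density j) = 0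
  /-- The three principal moments of inertia are positive (the mass is not carried by a line). -/
  inertia_pos : ∀ j a, 0 < ∫ x, (‖x‖ ^ 2 - x a ^ 2) ∂(density j)

/-- The state of `n + 1` bodies, those in `s` being rigid, in an inertial frame: positions and
linear momenta of the barycentres, principal axes and spin angular momenta of the rigid bodies. -/
structure State (n : ℕ) (s : Finset (Fin (n + 1))) where
  pos : Fin (n + 1) → E3
  mom : Fin (n + 1) → E3
  axI : s → E3
  axJ : s → E3
  axK : s → E3
  spin : s → E3

namespace GravSystem

variable {n : ℕ} (S : GravSystem n)

/-- The principal moments of inertia `A`, `B`, `C` (for `a = 0, 1, 2`) of the rigid body `j`. -/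
def inertia (j : S.solids) (a : Fin 3) : ℝ :=
  ∫ x, (‖x‖ ^ 2 - x a ^ 2) ∂(S.density j)

/-- The mass distribution of body `i` in space when the system is in the state `Y`. -/
def spatialMass (Y : State n S.solids) (i : Fin (n + 1)) : Measure E3 :=
  if h : i ∈ S.solids then
    (S.density ⟨i, h⟩).map fun x =>
      Y.pos i + x 0 • Y.axI ⟨i, h⟩ + x 1 • Y.axJ ⟨i, h⟩ + x 2 • Y.axK ⟨i, h⟩
  else ENNReal.ofReal (S.mass i) • Measure.dirac (Y.pos i)

/-- Kinetic energy of the barycentres. -/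
def translationEnergy (Y : State n S.solids) : ℝ :=
  ∑ i, ‖Y.mom i‖ ^ 2 / (2 * S.mass i)

/-- Kinetic energy of rotation of the rigid bodies. -/
def rotationEnergy (Y : State n S.solids) : ℝ :=
  ∑ j, ((inner ℝ (Y.spin j) (Y.axI j)) ^ 2 / (2 * S.inertia j 0)
      + (inner ℝ (Y.spin j) (Y.axJ j)) ^ 2 / (2 * S.inertia j 1)
      + (inner ℝ (Y.spin j) (Y.axK j)) ^ 2 / (2 * S.inertia j 2))

/-- Newtonian potential energy of the mutual attractions. -/
def potentialEnergy (Y : State n S.solids) : ℝ :=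
  -∑ i, ∑ i' ∈ Finset.Ioi i,
    S.gravConst * ∫ x, ∫ y, ‖x - y‖⁻¹ ∂(S.spatialMass Y i') ∂(S.spatialMass Y i)

/-- The full Hamiltonian. -/
def hamiltonian (Y : State n S.solids) : ℝ :=
  S.translationEnergy Y + S.rotationEnergy Y + S.potentialEnergy Y

/-! Partial gradients of the Hamiltonian with respect to each of the vectors. -/

def gradPos (Y : State n S.solids) (i : Fin (n + 1)) : E3 :=
  gradient (fun v => S.hamiltonian { Y with pos := Function.update Y.pos i v }) (Y.pos i)

def gradMom (Y : State n S.solids) (i : Fin (n + 1)) : E3 :=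
  gradient (fun v => S.hamiltonian { Y with mom := Function.update Y.mom i v }) (Y.mom i)

def gradAxI (Y : State n S.solids) (j : S.solids) : E3 :=
  gradient (fun v => S.hamiltonian { Y with axI := Function.update Y.axI j v }) (Y.axI j)

def gradAxJ (Y : State n S.solids) (j : S.solids) : E3 :=
  gradient (fun v => S.hamiltonian { Y with axJ := Function.update Y.axJ j v }) (Y.axJ j)

def gradAxK (Y : State n S.solids) (j : S.solids) : E3 :=
  gradient (fun v => S.hamiltonian { Y with axK := Function.update Y.axK j v }) (Y.axK j)

def gradSpin (Y : State n S.solids) (j : S.solids) : E3 :=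
  gradient (fun v => S.hamiltonian { Y with spin := Function.update Y.spin j v }) (Y.spin j)

/-- A state is admissible if the principal axes of each rigid body form a direct orthonormal frame
and no two bodies touch. -/
structure Admissible (Y : State n S.solids) : Prop where
  norm_axI : ∀ j, ‖Y.axI j‖ = 1
  norm_axJ : ∀ j, ‖Y.axJ j‖ = 1
  orthogonal : ∀ j, inner ℝ (Y.axI j) (Y.axJ j) = 0
  direct : ∀ j, Y.axK j = cross (Y.axI j) (Y.axJ j)
  separated : ∀ i i', i ≠ i' →
    Disjoint (S.spatialMass Y i).support (S.spatialMass Y i').support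

/-- Solutions, defined for all times, of the equations of motion: the canonical equations for
positions and momenta, and the Euler-Poisson equations for principal axes and spins. -/
structure IsSolution (X : ℝ → State n S.solids) : Prop where
  admissible : ∀ t, S.Admissible (X t)
  deriv_pos : ∀ t i, HasDerivAt (fun τ => (X τ).pos i) (S.gradMom (X t) i) t
  deriv_mom : ∀ t i, HasDerivAt (fun τ => (X τ).mom i) (-S.gradPos (X t) i) t
  deriv_axI : ∀ t j,
    HasDerivAt (fun τ => (X τ).axI j) (cross (S.gradSpin (X t) j) ((X t).axI j)) t
  deriv_axJ : ∀ t j,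
    HasDerivAt (fun τ => (X τ).axJ j) (cross (S.gradSpin (X t) j) ((X t).axJ j)) t
  deriv_axK : ∀ t j,
    HasDerivAt (fun τ => (X τ).axK j) (cross (S.gradSpin (X t) j) ((X t).axK j)) t
  deriv_spin : ∀ t j,
    HasDerivAt (fun τ => (X τ).spin j)
      (cross (S.gradAxI (X t) j) ((X t).axI j) + cross (S.gradAxJ (X t) j) ((X t).axJ j)
        + cross (S.gradAxK (X t) j) ((X t).axK j)
        + cross (S.gradSpin (X t) j) ((X t).spin j)) t

/-- The position of body `i` relative to the central body `c`. -/
def relPos (c : Fin (n + 1)) (Y : State n S.solids) (i : Fin (n + 1)) : E3 :=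
  Y.pos i - Y.pos c

/-- The momentum of body `i` relative to the barycentre of the system. For `i ≠ c` these are the
momenta canonically conjugate to the `relPos c Y i` (for two bodies: the reduced mass times the
relative velocity). -/
def relMom (Y : State n S.solids) (i : Fin (n + 1)) : E3 :=
  Y.mom i - (S.mass i / ∑ l, S.mass l) • ∑ l, Y.mom l

/-- The total angular momentum, orbital part (the term `i = c` is zero) plus spins. -/
def angularMomentum (c : Fin (n + 1)) (Y : State n S.solids) : E3 :=
  ∑ i, cross (S.relPos c Y i) (S.relMom Y i) + ∑ j, Y.spin j

/-- Labels of the vectors that describe the system in the frame centred on body `c`. -/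
inductive VectorLabel (c : Fin (n + 1)) : Type
  | position (i : Fin (n + 1)) (hi : i ≠ c)
  | momentum (i : Fin (n + 1)) (hi : i ≠ c)
  | axisI (j : S.solids)
  | axisJ (j : S.solids)
  | axisK (j : S.solids)
  | spin (j : S.solids)

/-- The vectors that describe the system in the frame centred on body `c`. -/
def vector (c : Fin (n + 1)) (Y : State n S.solids) : S.VectorLabel c → E3
  | .position i _ => S.relPos c Y i
  | .momentum i _ => S.relMom Y i
  | .axisI j => Y.axI j
  | .axisJ j => Y.axJ j
  | .axisK j => Y.axK j
  | .spin j => Y.spin j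

end GravSystem

/-- `Z` is the sum of a regular quasiperiodic series `∑ₖ aₖ exp (i ⟨k, ν⟩ t)` with frequencies `ν`:
the coefficients decrease faster than any power of `|k|`, which means that `Z(t) = F(ν t)` for a
smooth function `F` on the torus of dimension `m`. -/
def IsQuasiperiodic {m : ℕ} (ν : Fin m → ℝ) (Z : ℝ → E3) : Prop :=
  ∃ a : (Fin m → ℤ) → Fin 3 → ℂ,
    (∀ (p : ℕ) (α : Fin 3), Summable fun k : Fin m → ℤ => (∑ l, |(k l : ℝ)|) ^ p * ‖a k α‖) ∧
    ∀ (t : ℝ) (α : Fin 3),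
      HasSum
        (fun k : Fin m → ℤ => a k α * Complex.exp (Complex.I * ((∑ l, k l * ν l) * t : ℝ)))
        ((Z t α : ℝ) : ℂ)

/-- A solution is regular quasiperiodic in the frame centred on body `c` if all the vectors that
describe it are sums of regular quasiperiodic series on a common finite set of rationally
independent frequencies. -/
def GravSystem.IsRegularQuasiperiodic {n : ℕ} (S : GravSystem n) (c : Fin (n + 1))
    (X : ℝ → State n S.solids) : Prop :=
  S.IsSolution X ∧
    ∃ (m : ℕ) (ω : Fin m → ℝ), LinearIndependent ℚ ω ∧
      ∀ l : S.VectorLabel c, IsQuasiperiodic ω fun t => S.vector c (X t) l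

end RigidBodies

end

/-! The proof shows that the invariant torus carrying the solution is isotropic, and then counts
dimensions in the symplectic phase space of the centred problem, which has 3(n + n_s) degrees of
freedom.

Keep only the lattice generated by the Fourier modes that actually occur
(`exists_spanning_coefficients`). The solution becomes `F (t • ν)` with `F` smooth and periodic on
ℝ^r, and the orbit is dense in the torus (`denseRange_torusOrbit`). `F` is immersed at 0
(`eq_zero_of_fderiv_torusMap`): if dF(0) v = 0, then dF v vanishes along the whole orbit by
uniqueness for the linearised equations, so ⟨k, v⟩ = 0 for every active mode k; these generate ℤ^r,
hence v = 0.

Isotropy (`IsTorusSolution.symplectic_eq_zero`): the energy is constant on a dense set, so the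
pulled-back symplectic form vanishes on the direction ν. Being closed, it then has coefficients
invariant under the dense flow, that is, constant ones. It is also the differential of a bounded
one-form, and Stokes' formula on large squares forces these constants to be zero
(`closed_of_contraction_eq_zero`).

The angular momentum W is constant on the torus and generates rotations (`symplectic_rotGen`). Hence
the tangent space stays isotropic when the infinitesimal rotations about W and about one further
axis not parallel to W are added to it. An isotropic space has at most 3(n + n_s) dimensions
(`finrank_torus_le`), which leaves two cases in `IsRegularQuasiperiodic.exists_reduction`.

If rotation about W is not tangent to the torus, then r + 2 ≤ 3(n + n_s) and Ω = 0 works. If it is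
tangent, say ∂_v F = e × F with e the unit vector along W, then only r + 1 ≤ 3(n + n_s), but one
frequency can be rotated away. Comparing coefficients, e × a_k = i⟨k, v⟩ a_k, so ⟨k, v⟩ is 0, 1 or
-1 on active modes. It is not always 0, since otherwise e × F(0) = 0 and W = 0. Thus v is an
integral form onto ℤ and the modes split as ℤk₀ plus the kernel of v. With Ω the frequency of k₀,
rotation by -Ωt multiplies the mode k by exp(-i⟨k, v⟩Ωt), and only r - 1 frequencies remain
(`exists_frequency_splitting`, `exists_rotating_frame`). Since ℝ has infinite dimension over ℚ,
missing frequencies can be added to reach the prescribed number (`exists_padding`). -/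

open MeasureTheory

noncomputable section
namespace RigidBodies

/-! ### Vector products and rotations in Euclidean three-space -/

section VectorAlgebra

lemma cross_apply_zero (u v : E3) : cross u v 0 = u 1 * v 2 - u 2 * v 1 := by
  simp [cross, crossProduct]

lemma cross_apply_one (u v : E3) : cross u v 1 = u 2 * v 0 - u 0 * v 2 := by
  simp [cross, crossProduct]

lemma cross_apply_two (u v : E3) : cross u v 2 = u 0 * v 1 - u 1 * v 0 := by
  simp [cross, crossProduct]

lemma inner_eq_coord (u v : E3) : inner ℝ u v = u 0 * v 0 + u 1 * v 1 + u 2 * v 2 := by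
  simp [PiLp.inner_apply, Fin.sum_univ_three]; ring

lemma ext_coord {u v : E3} (h0 : u 0 = v 0) (h1 : u 1 = v 1) (h2 : u 2 = v 2) : u = v := by
  ext i; fin_cases i <;> assumption

lemma cross_add_left (u v w : E3) : cross (u + v) w = cross u w + cross v w := by
  apply ext_coord <;>
    simp only [PiLp.add_apply, cross_apply_zero, cross_apply_one, cross_apply_two] <;> ring

lemma cross_smul_left (c : ℝ) (v w : E3) : cross (c • v) w = c • cross v w := by
  apply ext_coord <;>
    simp only [PiLp.smul_apply, smul_eq_mul, cross_apply_zero, cross_apply_one,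
      cross_apply_two] <;> ring

lemma cross_anticomm (u v : E3) : cross u v = -cross v u := by
  apply ext_coord <;>
    simp only [PiLp.neg_apply, cross_apply_zero, cross_apply_one, cross_apply_two] <;> ring

lemma cross_add_right (u v w : E3) : cross u (v + w) = cross u v + cross u w := by
  rw [cross_anticomm, cross_add_left, cross_anticomm v, cross_anticomm w]; abel

lemma cross_smul_right (c : ℝ) (v w : E3) : cross v (c • w) = c • cross v w := by
  rw [cross_anticomm, cross_smul_left, cross_anticomm w, smul_neg, neg_neg]

/-- The vector product as a continuous bilinear map. -/
def crossL : E3 →L[ℝ] E3 →L[ℝ] E3 :=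
  LinearMap.toContinuousBilinearMap
    (LinearMap.mk₂ ℝ cross cross_add_left cross_smul_left cross_add_right cross_smul_right)

@[simp] lemma crossL_apply (u v : E3) : crossL u v = cross u v := rfl

@[simp] lemma cross_zero_left (v : E3) : cross 0 v = 0 := by
  rw [← crossL_apply]; simp

@[simp] lemma cross_zero_right (v : E3) : cross v 0 = 0 := by
  rw [← crossL_apply, map_zero]

lemma cross_neg_left (u v : E3) : cross (-u) v = -cross u v := by
  simp [← crossL_apply]

lemma cross_neg_right (u v : E3) : cross u (-v) = -cross u v := by
  simp [← crossL_apply]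

lemma cross_sub_right (u v w : E3) : cross u (v - w) = cross u v - cross u w := by
  simp [← crossL_apply]

lemma cross_sub_left (u v w : E3) : cross (u - v) w = cross u w - cross v w := by
  simp [← crossL_apply]

lemma cross_sum_right {ι : Type*} (s : Finset ι) (u : E3) (f : ι → E3) :
    cross u (∑ i ∈ s, f i) = ∑ i ∈ s, cross u (f i) := by
  simp [← crossL_apply]

lemma cross_sum_left {ι : Type*} (s : Finset ι) (u : E3) (f : ι → E3) :
    cross (∑ i ∈ s, f i) u = ∑ i ∈ s, cross (f i) u := by
  simp [← crossL_apply]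

@[simp] lemma cross_self (v : E3) : cross v v = 0 := by
  apply ext_coord <;>
    simp only [PiLp.zero_apply, cross_apply_zero, cross_apply_one, cross_apply_two] <;> ring

lemma inner_cross_cyclic (u v w : E3) : inner ℝ u (cross v w) = inner ℝ v (cross w u) := by
  simp only [inner_eq_coord, cross_apply_zero, cross_apply_one, cross_apply_two]; ring

lemma inner_cross_left_comm (u v w : E3) : inner ℝ (cross u v) w = inner ℝ u (cross v w) := by
  simp only [inner_eq_coord, cross_apply_zero, cross_apply_one, cross_apply_two]; ring

lemma inner_cross_skew (w u v : E3) : inner ℝ (cross w u) v = -inner ℝ u (cross w v) := by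
  simp only [inner_eq_coord, cross_apply_zero, cross_apply_one, cross_apply_two]; ring

lemma cross_jacobi (w u v : E3) :
    cross w (cross u v) = cross (cross w u) v + cross u (cross w v) := by
  apply ext_coord <;>
    simp only [PiLp.add_apply, cross_apply_zero, cross_apply_one, cross_apply_two] <;> ring

lemma cross_cross_left (u v w : E3) :
    cross (cross u v) w = inner ℝ u w • v - inner ℝ v w • u := by
  apply ext_coord <;>
    simp only [PiLp.sub_apply, PiLp.smul_apply, smul_eq_mul, inner_eq_coord, cross_apply_zero,
      cross_apply_one, cross_apply_two] <;> ring

lemma cross_cross_right (u v w : E3) :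
    cross u (cross v w) = inner ℝ u w • v - inner ℝ u v • w := by
  apply ext_coord <;>
    simp only [PiLp.sub_apply, PiLp.smul_apply, smul_eq_mul, inner_eq_coord, cross_apply_zero,
      cross_apply_one, cross_apply_two] <;> ring

lemma inner_cross_cross (u v w z : E3) :
    inner ℝ (cross u v) (cross w z) = inner ℝ u w * inner ℝ v z - inner ℝ u z * inner ℝ v w := by
  simp only [inner_eq_coord, cross_apply_zero, cross_apply_one, cross_apply_two]; ring

lemma cross_cross_same (a b v : E3) :
    cross (cross a v) (cross b v) = inner ℝ v (cross a b) • v := by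
  apply ext_coord <;>
    simp only [PiLp.smul_apply, smul_eq_mul, inner_eq_coord, cross_apply_zero,
      cross_apply_one, cross_apply_two] <;> ring

/-- Rodrigues' formula in terms of iterated vector products. -/
lemma axisRotation_eq {k : E3} (hk : ‖k‖ = 1) (θ : ℝ) (v : E3) :
    axisRotation k θ v
      = v + Real.sin θ • cross k v + (1 - Real.cos θ) • cross k (cross k v) := by
  rw [axisRotation, cross_cross_right, real_inner_self_eq_norm_sq, hk]
  module

/-- On the plane orthogonal to the axis, `k × ·` is a quarter turn, and it vanishes along the axis;
hence it is a root of X³ + X. The same polynomial later gives the eigenvalues 0, ±i. -/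
lemma cross_cross_cross {k : E3} (hk : ‖k‖ = 1) (v : E3) :
    cross k (cross k (cross k v)) = -cross k v := by
  rw [cross_cross_right k k (cross k v), real_inner_self_eq_norm_sq, hk,
    show inner ℝ k (cross k v) = 0 by rw [← inner_cross_left_comm]; simp]
  simp

lemma norm_axisRotation {k : E3} (hk : ‖k‖ = 1) (θ : ℝ) (v : E3) :
    ‖axisRotation k θ v‖ = ‖v‖ := by
  have hk2 : k 0 * k 0 + k 1 * k 1 + k 2 * k 2 = 1 := by
    rw [← inner_eq_coord, real_inner_self_eq_norm_sq, hk]; norm_num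
  have h : ‖axisRotation k θ v‖ ^ 2 = ‖v‖ ^ 2 := by
    rw [axisRotation]
    have e1 : inner ℝ v (cross k v) = 0 := by rw [inner_cross_cyclic]; simp
    have e2 : inner ℝ (cross k v) k = 0 := by
      rw [real_inner_comm, ← inner_cross_left_comm]; simp
    have e3 : ‖cross k v‖ ^ 2 = ‖v‖ ^ 2 - inner ℝ k v ^ 2 := by
      rw [← real_inner_self_eq_norm_sq, inner_cross_cross, real_inner_self_eq_norm_sq,
        real_inner_self_eq_norm_sq, hk, real_inner_comm k v]; ring
    rw [norm_add_sq_real, norm_add_sq_real, inner_add_left]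
    simp only [norm_smul, inner_smul_left, inner_smul_right, mul_pow, e1, e2, e3,
      Real.norm_eq_abs, sq_abs, hk, real_inner_comm k v, RCLike.conj_to_real]
    linear_combination (‖v‖ ^ 2 - (inner ℝ k v)^2) * Real.sin_sq_add_cos_sq θ
  nlinarith [norm_nonneg v, norm_nonneg (axisRotation k θ v),
    abs_eq_abs.mpr (sq_eq_sq_iff_eq_or_eq_neg.mp h), abs_of_nonneg (norm_nonneg v),
    abs_of_nonneg (norm_nonneg (axisRotation k θ v))]

lemma axisRotation_sub (k : E3) (θ : ℝ) (u v : E3) :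
    axisRotation k θ (u - v) = axisRotation k θ u - axisRotation k θ v := by
  simp only [axisRotation, cross_sub_right, inner_sub_right]; module

lemma axisRotation_add (k : E3) (θ : ℝ) (u v : E3) :
    axisRotation k θ (u + v) = axisRotation k θ u + axisRotation k θ v := by
  simp only [axisRotation, cross_add_right, inner_add_right]; module

lemma axisRotation_smul (k : E3) (θ c : ℝ) (v : E3) :
    axisRotation k θ (c • v) = c • axisRotation k θ v := by
  simp only [axisRotation, cross_smul_right, inner_smul_right]; module

lemma axisRotation_zero (k v : E3) : axisRotation k 0 v = v := by
  simp [axisRotation]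

/-- Opposite rotations cancel. -/
lemma axisRotation_axisRotation_neg {k : E3} (hk : ‖k‖ = 1) (θ : ℝ) (v : E3) :
    axisRotation k θ (axisRotation k (-θ) v) = v := by
  rw [axisRotation_eq hk, axisRotation_eq hk]
  simp only [cross_add_right, cross_smul_right, cross_cross_cross hk, Real.sin_neg, Real.cos_neg,
    smul_add, smul_smul, cross_neg_right]
  have := Real.sin_sq_add_cos_sq θ
  match_scalars
  · ring
  · linear_combination 0 * this
  · linear_combination -this

lemma hasDerivAt_axisRotation_zero (k v : E3) :
    HasDerivAt (fun θ => axisRotation k θ v) (cross k v) 0 := by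
  have h1 : HasDerivAt (fun θ : ℝ => Real.cos θ • v) ((-Real.sin 0) • v) 0 :=
    (Real.hasDerivAt_cos 0).smul_const v
  have h2 : HasDerivAt (fun θ : ℝ => Real.sin θ • cross k v) (Real.cos 0 • cross k v) 0 :=
    (Real.hasDerivAt_sin 0).smul_const _
  have h3 : HasDerivAt (fun θ : ℝ => ((1 - Real.cos θ) * inner ℝ k v) • k)
      (((- -Real.sin 0) * inner ℝ k v) • k) 0 :=
    ((((Real.hasDerivAt_cos 0).const_sub 1).mul_const _).smul_const k)
  refine ((h1.add h2).add h3).congr_deriv ?_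
  simp

end VectorAlgebra

/-! ### Orthonormal frames and their infinitesimal variations -/

section Frames

variable {A : Fin 3 → E3} (hA : Orthonormal ℝ A)
include hA

lemma sum_inner_smul_frame (w : E3) : ∑ a, inner ℝ (A a) w • A a = w := by
  have hc : Fintype.card (Fin 3) = Module.finrank ℝ E3 := by simp
  let b := basisOfOrthonormalOfCardEqFinrank hA hc
  have hb : ⇑b = A := coe_basisOfOrthonormalOfCardEqFinrank hA hc
  have ho : Orthonormal ℝ b := by rw [hb]; exact hA
  have := (b.toOrthonormalBasis ho).sum_repr w
  simpa only [OrthonormalBasis.repr_apply_apply, Module.Basis.coe_toOrthonormalBasis, hb] using this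

lemma sum_inner_mul_inner_frame (u v : E3) :
    ∑ a, inner ℝ u (A a) * inner ℝ v (A a) = inner ℝ u v := by
  conv_rhs => rw [← sum_inner_smul_frame hA v]
  simp only [inner_sum, inner_smul_right]
  exact Finset.sum_congr rfl fun a _ => by rw [real_inner_comm (A a) v, mul_comm]

/-- Each term is the full product minus its component along `A a`, so the sum is 3 - 1 = 2 copies.
This 2 is the reason for the factors 2⁻¹ in `liouville` and `displacement`. -/
lemma sum_inner_cross_frame (u v : E3) :
    ∑ a, inner ℝ (cross u (A a)) (cross v (A a)) = 2 * inner ℝ u v := by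
  have h : ∀ a, inner ℝ (cross u (A a)) (cross v (A a))
      = inner ℝ u v - inner ℝ u (A a) * inner ℝ v (A a) := fun a => by
    rw [inner_cross_cross, real_inner_self_eq_norm_sq, hA.1 a, real_inner_comm v (A a)]; ring
  simp only [h, Finset.sum_sub_distrib, sum_inner_mul_inner_frame hA]
  simp; ring

lemma sum_cross_cross_frame (u v : E3) :
    ∑ a, cross (cross u (A a)) (cross v (A a)) = cross u v := by
  simp only [cross_cross_same]
  exact sum_inner_smul_frame hA _

/-- Recovers the rotation vector from the variation of the frame. -/
lemma sum_cross_self_cross_frame (w : E3) : ∑ a, cross (A a) (cross w (A a)) = (2 : ℝ) • w := by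
  have h : ∀ a, cross (A a) (cross w (A a)) = w - inner ℝ (A a) w • A a := fun a => by
    rw [cross_cross_right, real_inner_self_eq_norm_sq, hA.1 a]; simp
  simp only [h, Finset.sum_sub_distrib, sum_inner_smul_frame hA]
  simp only [Finset.sum_const, Finset.card_univ, Fintype.card_fin]
  module

/-- An infinitesimal variation of an orthonormal frame is an infinitesimal rotation. -/
lemma variation_frame_eq_cross {D : Fin 3 → E3}
    (hD : ∀ a b, inner ℝ (D a) (A b) + inner ℝ (A a) (D b) = 0) (b : Fin 3) :
    D b = cross ((1 / 2 : ℝ) • ∑ a, cross (A a) (D a)) (A b) := by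
  -- The skew-symmetry `hD` moves the derivative onto `A b`. After summation over `a` both terms
  -- equal `D b`, whence the factor 1/2.
  have h : ∀ a, cross (cross (A a) (D a)) (A b)
      = inner ℝ (A a) (A b) • D a + inner ℝ (A a) (D b) • A a := fun a => by
    rw [cross_cross_left, sub_eq_add_neg, ← neg_smul]
    congr 2
    linarith [hD a b]
  rw [cross_smul_left, cross_sum_left]
  simp only [h, Finset.sum_add_distrib, sum_inner_smul_frame hA]
  have h2 : ∑ a, inner ℝ (A a) (A b) • D a = D b := by
    simp [orthonormal_iff_ite.mp hA]
  rw [h2]; module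

end Frames

lemma orthonormal_of_direct {I J : E3} (hI : ‖I‖ = 1) (hJ : ‖J‖ = 1) (hIJ : inner ℝ I J = 0) :
    Orthonormal ℝ ![I, J, cross I J] := by
  have h2 : inner ℝ I (cross I J) = 0 := by rw [← inner_cross_left_comm]; simp
  have h3 : inner ℝ J (cross I J) = 0 := by rw [inner_cross_cyclic]; simp
  have h4 : ‖cross I J‖ = 1 := by
    have : ‖cross I J‖ ^ 2 = 1 := by
      rw [← real_inner_self_eq_norm_sq, inner_cross_cross, real_inner_self_eq_norm_sq,
        real_inner_self_eq_norm_sq, hI, hJ, hIJ]; norm_num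
    nlinarith [norm_nonneg (cross I J)]
  refine ⟨fun i => ?_, fun i j hij => ?_⟩
  · fin_cases i <;> simp [hI, hJ, h4]
  · fin_cases i <;> fin_cases j <;>
      first | exact absurd rfl hij | simp [hIJ, h2, h3, real_inner_comm I J,
        real_inner_comm I (cross I J), real_inner_comm J (cross I J)]

end RigidBodies
end

noncomputable section
namespace RigidBodies

/-! ### Time averages and uniqueness of coefficients -/

section BohrMean

open Filter Topology Complex

lemma integral_cexp_mul_I {l : ℝ} (hl : l ≠ 0) (T : ℝ) :
    ∫ t in (0 : ℝ)..T, cexp (I * ((l * t : ℝ) : ℂ)) = (cexp (I * ((l * T : ℝ) : ℂ)) - 1) / (I * l) := by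
  have hc : (I * l : ℂ) ≠ 0 := mul_ne_zero I_ne_zero (by exact_mod_cast hl)
  have := integral_exp_mul_complex (a := 0) (b := T) hc
  simp only [ofReal_mul, ← mul_assoc] at this ⊢
  rw [this]; simp

lemma norm_cexp_I_mul_ofReal (x : ℝ) : ‖cexp (I * (x : ℂ))‖ = 1 := by
  rw [mul_comm]; exact Complex.norm_exp_ofReal_mul_I x

/-- The time average of an oscillating exponential. -/
lemma tendsto_mean_cexp (l : ℝ) :
    Tendsto (fun T : ℝ => (T⁻¹ : ℂ) * ∫ t in (0 : ℝ)..T, cexp (I * ((l * t : ℝ) : ℂ))) atTop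
      (𝓝 (if l = 0 then 1 else 0)) := by
  split_ifs with h
  · subst h
    refine tendsto_const_nhds.congr' ?_
    filter_upwards [eventually_gt_atTop 0] with T hT
    have : (T : ℂ) ≠ 0 := by exact_mod_cast hT.ne'
    simp [this]
  · have hb : ∀ᶠ T : ℝ in atTop,
        ‖(T⁻¹ : ℂ) * ∫ t in (0 : ℝ)..T, cexp (I * ((l * t : ℝ) : ℂ))‖ ≤ T⁻¹ * (2 / |l|) := by
      filter_upwards [eventually_gt_atTop 0] with T hT
      rw [integral_cexp_mul_I h, norm_mul, norm_inv, norm_real, Real.norm_of_nonneg hT.le,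
        norm_div, norm_mul, norm_I, one_mul, norm_real, Real.norm_eq_abs]
      gcongr
      refine (norm_sub_le _ _).trans ?_
      rw [norm_cexp_I_mul_ofReal]; norm_num
    refine squeeze_zero_norm' hb ?_
    simpa using tendsto_inv_atTop_zero.mul_const (2 / |l|)

/-- The time average of an absolutely convergent series of oscillating exponentials. -/
lemma tendsto_mean_tsum {J : Type*} [Countable J] {a : J → ℂ} (ha : Summable fun j => ‖a j‖)
    (l : J → ℝ) :
    Tendsto (fun T : ℝ => (T⁻¹ : ℂ) *
      ∫ t in (0 : ℝ)..T, ∑' j, a j * cexp (I * ((l j * t : ℝ) : ℂ))) atTop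
      (𝓝 (∑' j, if l j = 0 then a j else 0)) := by
  have key : ∀ T : ℝ, (T⁻¹ : ℂ) * ∫ t in (0 : ℝ)..T, ∑' j, a j * cexp (I * ((l j * t : ℝ) : ℂ))
      = ∑' j, a j * ((T⁻¹ : ℂ) * ∫ t in (0 : ℝ)..T, cexp (I * ((l j * t : ℝ) : ℂ))) := by
    intro T
    let f : J → C(ℝ, ℂ) := fun j =>
      ⟨fun t => a j * cexp (I * ((l j * t : ℝ) : ℂ)), by fun_prop⟩
    have hs : Summable fun j =>
        ‖(f j).restrict (⟨Set.uIcc 0 T, isCompact_uIcc⟩ : TopologicalSpace.Compacts ℝ)‖ := by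
      refine Summable.of_nonneg_of_le (fun _ => norm_nonneg _) (fun j => ?_) ha
      rw [ContinuousMap.norm_le _ (norm_nonneg _)]
      intro x
      simp [f, -ofReal_mul]
    have := intervalIntegral.tsum_intervalIntegral_eq_of_summable_norm hs
    simp only [f, ContinuousMap.coe_mk] at this
    rw [← this, ← tsum_mul_left]
    refine tsum_congr fun j => ?_
    rw [intervalIntegral.integral_const_mul]; ring
  simp only [key]
  -- Averages of unimodular functions are bounded by 1, so `‖a j‖` dominates uniformly in `T`.
  refine tendsto_tsum_of_dominated_convergence ha (fun j => ?_) ?_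
  · have := (tendsto_mean_cexp (l j)).const_mul (a j)
    simpa using this
  · filter_upwards [eventually_gt_atTop 0] with T hT j
    rw [norm_mul, norm_mul, norm_inv, norm_real, Real.norm_of_nonneg hT.le]
    have : ‖∫ t in (0 : ℝ)..T, cexp (I * ((l j * t : ℝ) : ℂ))‖ ≤ 1 * |T - 0| :=
      intervalIntegral.norm_integral_le_of_norm_le_const fun t _ =>
        (norm_cexp_I_mul_ofReal _).le
    rw [one_mul, sub_zero, abs_of_pos hT] at this
    have h2 : T⁻¹ * ‖∫ t in (0 : ℝ)..T, cexp (I * ((l j * t : ℝ) : ℂ))‖ ≤ 1 := by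
      rw [inv_mul_le_iff₀ hT]; linarith
    exact mul_le_of_le_one_right (norm_nonneg _) h2

/-- Uniqueness of the coefficients of an almost periodic series. -/
lemma coeff_eq_zero_of_tsum_eq_zero {J : Type*} [Countable J] {a : J → ℂ}
    (ha : Summable fun j => ‖a j‖) {l : J → ℝ} (hl : Function.Injective l)
    (h : ∀ t : ℝ, ∑' j, a j * cexp (I * ((l j * t : ℝ) : ℂ)) = 0) (j₀ : J) : a j₀ = 0 := by
  -- Shifting all frequencies by `l j₀` makes the wanted coefficient the constant term, which the
  -- mean isolates by injectivity of `l`.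
  have hT := tendsto_mean_tsum ha fun j => l j - l j₀
  have h0 : ∀ t : ℝ, ∑' j, a j * cexp (I * (((l j - l j₀) * t : ℝ) : ℂ)) = 0 := fun t => by
    have : ∀ j, a j * cexp (I * (((l j - l j₀) * t : ℝ) : ℂ))
        = a j * cexp (I * ((l j * t : ℝ) : ℂ)) * cexp (-(I * ((l j₀ * t : ℝ) : ℂ))) := fun j => by
      rw [mul_assoc, ← Complex.exp_add]; congr 2; push_cast; ring
    simp only [this, tsum_mul_right, h t, zero_mul]
  simp only [h0, intervalIntegral.integral_zero, mul_zero] at hT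
  have hs : ∑' j, (if l j - l j₀ = 0 then a j else 0) = a j₀ := by
    rw [tsum_eq_single j₀ fun j hj => if_neg (sub_ne_zero.mpr (hl.ne hj))]
    simp
  rw [hs] at hT
  exact tendsto_nhds_unique hT tendsto_const_nhds

end BohrMean

/-! ### Density of irrational linear flows -/

section Kronecker

open Filter Topology Complex

variable {m : ℕ}

/-- The linear flow on the torus. -/
def torusOrbit (ω : Fin m → ℝ) (t : ℝ) : UnitAddTorus (Fin m) :=
  fun i => ((ω i * t / (2 * Real.pi) : ℝ) : AddCircle (1 : ℝ))

lemma torusOrbit_add (ω : Fin m → ℝ) (s t : ℝ) :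
    torusOrbit ω (s + t) = torusOrbit ω s + torusOrbit ω t := by
  funext i
  simp only [torusOrbit, Pi.add_apply, ← AddCircle.coe_add]
  congr 1; ring

lemma continuous_torusOrbit (ω : Fin m → ℝ) : Continuous (torusOrbit ω) := by
  refine continuous_pi fun i => ?_
  exact (AddCircle.continuous_mk' (1 : ℝ)).comp (by fun_prop)

lemma mFourier_torusOrbit (ω : Fin m → ℝ) (k : Fin m → ℤ) (t : ℝ) :
    UnitAddTorus.mFourier k (torusOrbit ω t) = cexp (I * (((∑ l, k l * ω l) * t : ℝ) : ℂ)) := by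
  simp only [UnitAddTorus.mFourier, ContinuousMap.coe_mk, torusOrbit, fourier_coe_apply]
  rw [← Complex.exp_sum]
  congr 1
  push_cast
  rw [Finset.sum_mul, Finset.mul_sum]
  refine Finset.sum_congr rfl fun i _ => ?_
  have : (Real.pi : ℂ) ≠ 0 := by exact_mod_cast Real.pi_ne_zero
  field_simp

lemma mFourier_add_apply (k : Fin m → ℤ) (x y : UnitAddTorus (Fin m)) :
    UnitAddTorus.mFourier k (x + y) = UnitAddTorus.mFourier k x * UnitAddTorus.mFourier k y := by
  simp only [UnitAddTorus.mFourier, ContinuousMap.coe_mk, Pi.add_apply, fourier_apply, smul_add,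
    AddCircle.toCircle_add, Circle.coe_mul, Finset.prod_mul_distrib]

lemma linearCombination_ne_zero {ω : Fin m → ℝ} (hω : LinearIndependent ℚ ω) {k : Fin m → ℤ}
    (hk : k ≠ 0) : ∑ l, (k l : ℝ) * ω l ≠ 0 := by
  intro h
  apply hk
  rw [← LinearIndependent.iff_fractionRing ℤ ℚ, Fintype.linearIndependent_iff] at hω
  funext i
  exact hω k (by simpa using h) i

lemma injective_frequency {ω : Fin m → ℝ} (hω : LinearIndependent ℚ ω) :
    Function.Injective fun k : Fin m → ℤ => ∑ l, (k l : ℝ) * ω l := by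
  intro k k' h
  by_contra hne
  refine linearCombination_ne_zero hω (sub_ne_zero.mpr hne) ?_
  have h' : ∑ l, (k l : ℝ) * ω l = ∑ l, (k' l : ℝ) * ω l := h
  simp [sub_mul, Finset.sum_sub_distrib, h']

/-- For a trigonometric polynomial only the constant mode survives averaging, by rational
independence. The point is that the mean `c` does not depend on the starting point `x`. -/
lemma exists_mean_of_mem_span {ω : Fin m → ℝ} (hω : LinearIndependent ℚ ω)
    {q : C(UnitAddTorus (Fin m), ℂ)}
    (hq : q ∈ Submodule.span ℂ (Set.range (UnitAddTorus.mFourier (d := Fin m)))) :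
    ∃ c : ℂ, ∀ x, Tendsto (fun T : ℝ => (T⁻¹ : ℂ) * ∫ t in (0 : ℝ)..T, q (x + torusOrbit ω t))
      atTop (𝓝 c) := by
  have hcont : ∀ (q : C(UnitAddTorus (Fin m), ℂ)) x,
      Continuous fun t => q (x + torusOrbit ω t) := fun q x =>
    q.continuous.comp (continuous_const.add (continuous_torusOrbit ω))
  induction hq using Submodule.span_induction with
  | mem q hq =>
    obtain ⟨k, rfl⟩ := hq
    by_cases hk : k = 0
    · subst hk
      refine ⟨1, fun x => tendsto_const_nhds.congr' ?_⟩
      filter_upwards [eventually_gt_atTop 0] with T hT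
      have : (T : ℂ) ≠ 0 := by exact_mod_cast hT.ne'
      simp [UnitAddTorus.mFourier_zero, this]
    · refine ⟨0, fun x => ?_⟩
      have := (tendsto_mean_cexp (∑ l, (k l : ℝ) * ω l)).const_mul (UnitAddTorus.mFourier k x)
      rw [if_neg (linearCombination_ne_zero hω hk), mul_zero] at this
      refine this.congr fun T => ?_
      simp only [mFourier_add_apply, mFourier_torusOrbit, intervalIntegral.integral_const_mul]
      ring
  | zero => exact ⟨0, fun x => by simp⟩
  | add p q _ _ hp hq =>
    obtain ⟨c, hc⟩ := hp
    obtain ⟨d, hd⟩ := hq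
    refine ⟨c + d, fun x => ((hc x).add (hd x)).congr fun T => ?_⟩
    simp only [ContinuousMap.add_apply]
    rw [intervalIntegral.integral_add ((hcont p x).intervalIntegrable _ _)
      ((hcont q x).intervalIntegrable _ _)]
    ring
  | smul b p _ hp =>
    obtain ⟨c, hc⟩ := hp
    refine ⟨b * c, fun x => ((hc x).const_mul b).congr fun T => ?_⟩
    simp only [ContinuousMap.smul_apply, smul_eq_mul, intervalIntegral.integral_const_mul]
    ring

/-- Kronecker's theorem: a linear flow with rationally independent frequencies is dense in the
torus. -/
lemma denseRange_torusOrbit {ω : Fin m → ℝ} (hω : LinearIndependent ℚ ω) :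
    DenseRange (torusOrbit ω) := by
  intro x₀
  set R : Set (UnitAddTorus (Fin m)) := Set.range (torusOrbit ω) with hR
  have hne : R.Nonempty := Set.range_nonempty _
  rw [Metric.mem_closure_iff_infDist_zero hne]
  by_contra hδ
  set δ := Metric.infDist x₀ R with hδd
  have hpos : 0 < δ := lt_of_le_of_ne Metric.infDist_nonneg (Ne.symm hδ)
  -- The distance to the orbit is invariant under the flow, so it equals its own time average. It is
  -- uniformly within δ/4 of a trigonometric polynomial, whose averages are one constant `c`. So `c`
  -- is within δ/4 both of 0 (at a point of the orbit) and of δ (at `x₀`), which is absurd.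
  let g : C(UnitAddTorus (Fin m), ℂ) :=
    ⟨fun x => (Metric.infDist x R : ℂ), by
      exact continuous_ofReal.comp (Metric.continuous_infDist_pt R)⟩
  have hinv : ∀ x t, Metric.infDist (x + torusOrbit ω t) R = Metric.infDist x R := by
    have hle : ∀ x t, Metric.infDist (x + torusOrbit ω t) R ≤ Metric.infDist x R := by
      intro x t
      rw [Metric.le_infDist hne]
      rintro _ ⟨s, rfl⟩
      refine (Metric.infDist_le_dist_of_mem (Set.mem_range_self (s + t))).trans ?_
      rw [torusOrbit_add, dist_add_right]
    intro x t
    refine le_antisymm (hle x t) ?_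
    have := hle (x + torusOrbit ω t) (-t)
    rwa [add_assoc, ← torusOrbit_add, add_neg_cancel,
      show torusOrbit ω 0 = 0 by funext i; simp [torusOrbit], add_zero] at this
  have hg : g ∈ (Submodule.span ℂ
      (Set.range (UnitAddTorus.mFourier (d := Fin m)))).topologicalClosure := by
    rw [UnitAddTorus.span_mFourier_closure_eq_top]; trivial
  obtain ⟨q, hq, hgq⟩ := Metric.mem_closure_iff.mp hg (δ / 4) (by positivity)
  obtain ⟨c, hc⟩ := exists_mean_of_mem_span hω hq
  have hnear : ∀ y, ‖q y - g y‖ ≤ δ / 4 := fun y => by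
    rw [← dist_eq_norm, dist_comm]
    exact (ContinuousMap.dist_apply_le_dist y).trans hgq.le
  have hcont : ∀ x, Continuous fun t => q (x + torusOrbit ω t) := fun x =>
    q.continuous.comp (continuous_const.add (continuous_torusOrbit ω))
  have hbound : ∀ x, ‖c - Metric.infDist x R‖ ≤ δ / 4 := by
    intro x
    have ht := (hc x).sub_const (Metric.infDist x R : ℂ)
    refine le_of_tendsto ht.norm ?_
    filter_upwards [eventually_gt_atTop 0] with T hT
    have hTc : (T : ℂ) ≠ 0 := by exact_mod_cast hT.ne'
    have e : (T⁻¹ : ℂ) * (∫ t in (0 : ℝ)..T, q (x + torusOrbit ω t)) - Metric.infDist x R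
        = (T⁻¹ : ℂ) * ∫ t in (0 : ℝ)..T, (q (x + torusOrbit ω t) - Metric.infDist x R) := by
      rw [intervalIntegral.integral_sub
        (Continuous.intervalIntegrable (hcont x) _ _) (by simp)]
      simp [mul_sub, hTc]
    rw [e, norm_mul, norm_inv, norm_real, Real.norm_of_nonneg hT.le, inv_mul_le_iff₀ hT]
    have := intervalIntegral.norm_integral_le_of_norm_le_const (a := 0) (b := T) (C := δ / 4)
      (f := fun t => q (x + torusOrbit ω t) - (Metric.infDist x R : ℂ)) fun t _ => by
        have := hnear (x + torusOrbit ω t)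
        rwa [show g (x + torusOrbit ω t) = (Metric.infDist x R : ℂ) by
          simp only [g, ContinuousMap.coe_mk, hinv]] at this
    rw [sub_zero, abs_of_pos hT] at this
    linarith
  have h0 := hbound (torusOrbit ω 0)
  rw [Metric.infDist_zero_of_mem (Set.mem_range_self (0 : ℝ))] at h0
  have h1 := hbound x₀
  have : ‖(δ : ℂ)‖ ≤ δ / 4 + δ / 4 := by
    calc ‖(δ : ℂ)‖ = ‖(c - ((0 : ℝ) : ℂ)) - (c - δ)‖ := by congr 1; push_cast; ring
      _ ≤ _ := (norm_sub_le _ _).trans (add_le_add h0 h1)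
  rw [norm_real, Real.norm_of_nonneg hpos.le] at this
  linarith

/-- The points of `ℝ ^ m` lying over the orbit of the origin under the linear flow. -/
def liftedOrbit (ω : Fin m → ℝ) : Set (Fin m → ℝ) :=
  {θ | ∃ (t : ℝ) (k : Fin m → ℤ), ∀ i, θ i = t * ω i + 2 * Real.pi * k i}

lemma smul_mem_liftedOrbit (ω : Fin m → ℝ) (t : ℝ) : t • ω ∈ liftedOrbit ω :=
  ⟨t, 0, fun i => by simp⟩

/-- The covering ℝ^m → torus is open, so the image of a nonempty open set meets the dense orbit. -/
lemma dense_liftedOrbit {ω : Fin m → ℝ} (hω : LinearIndependent ℚ ω) :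
    Dense (liftedOrbit ω) := by
  let π : (Fin m → ℝ) → UnitAddTorus (Fin m) :=
    fun θ i => ((θ i / (2 * Real.pi) : ℝ) : AddCircle (1 : ℝ))
  have hπ : IsOpenMap π := by
    have h : IsOpenMap fun x : ℝ => ((x / (2 * Real.pi) : ℝ) : AddCircle (1 : ℝ)) := by
      have h1 : IsOpenMap fun x : ℝ => x / (2 * Real.pi) :=
        (Homeomorph.mulRight₀ (2 * Real.pi)⁻¹ (by positivity)).isOpenMap
      exact QuotientAddGroup.isOpenMap_coe.comp h1
    exact IsOpenMap.piMap (fun _ => h) (by simp)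
  refine dense_iff_inter_open.mpr fun V hV hne => ?_
  obtain ⟨_, ⟨θ, hθ, rfl⟩, ⟨t, ht⟩⟩ :=
    (denseRange_torusOrbit hω).inter_open_nonempty _ (hπ V hV) (hne.image π)
  refine ⟨θ, hθ, t, ?_⟩
  have : ∀ i, ∃ k : ℤ, θ i = t * ω i + 2 * Real.pi * k := by
    intro i
    have hi := congrFun ht i
    simp only [torusOrbit, π] at hi
    rw [eq_comm, ← sub_eq_zero, ← AddCircle.coe_sub, AddCircle.coe_eq_zero_iff] at hi
    obtain ⟨k, hk⟩ := hi
    refine ⟨k, ?_⟩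
    have hp := Real.pi_ne_zero
    rw [zsmul_eq_mul, mul_one, ← sub_div, eq_div_iff (by positivity)] at hk
    linarith
  choose k hk using this
  exact ⟨k, hk⟩

end Kronecker

end RigidBodies
end

noncomputable section
namespace RigidBodies

/-! ### Smooth functions on the torus given by Fourier series -/

section TorusSeries

open Filter Topology Complex

variable {m : ℕ}

/-- Coefficients that decrease faster than any power of `|k|`. -/
def FastDecay (a : (Fin m → ℤ) → ℂ) : Prop :=
  ∀ p : ℕ, Summable fun k : Fin m → ℤ => (∑ l, |(k l : ℝ)|) ^ p * ‖a k‖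

/-- The function on the torus with Fourier coefficients `a`. -/
def torusSeries (a : (Fin m → ℤ) → ℂ) (θ : Fin m → ℝ) : ℂ :=
  ∑' k : Fin m → ℤ, a k * cexp (I * ((∑ l, (k l : ℝ) * θ l : ℝ) : ℂ))

lemma FastDecay.summable_norm {a : (Fin m → ℤ) → ℂ} (ha : FastDecay a) :
    Summable fun k => ‖a k‖ := by simpa using ha 0

lemma FastDecay.summable_term {a : (Fin m → ℤ) → ℂ} (ha : FastDecay a) (θ : Fin m → ℝ) :
    Summable fun k : Fin m → ℤ => a k * cexp (I * ((∑ l, (k l : ℝ) * θ l : ℝ) : ℂ)) := by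
  refine Summable.of_norm (ha.summable_norm.congr fun k => ?_)
  rw [norm_mul, norm_cexp_I_mul_ofReal, mul_one]

lemma FastDecay.add {a b : (Fin m → ℤ) → ℂ} (ha : FastDecay a) (hb : FastDecay b) :
    FastDecay fun k => a k + b k := fun p => by
  refine Summable.of_nonneg_of_le (fun k => by positivity) (fun k => ?_) ((ha p).add (hb p))
  rw [← mul_add]
  gcongr
  exact norm_add_le _ _

lemma FastDecay.const_mul {a : (Fin m → ℤ) → ℂ} (ha : FastDecay a) (c : ℂ) :
    FastDecay fun k => c * a k := fun p => by
  refine ((ha p).mul_left ‖c‖).congr fun k => ?_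
  rw [norm_mul]; ring

lemma abs_sum_mul_le (k : Fin m → ℤ) (v : Fin m → ℝ) :
    |∑ l, (k l : ℝ) * v l| ≤ (∑ l, |(k l : ℝ)|) * ‖v‖ := by
  refine (Finset.abs_sum_le_sum_abs _ _).trans ?_
  rw [Finset.sum_mul]
  refine Finset.sum_le_sum fun l _ => ?_
  rw [abs_mul]
  gcongr
  exact norm_le_pi_norm v l

/-- The Fourier coefficients of a directional derivative decrease fast. -/
lemma FastDecay.deriv {a : (Fin m → ℤ) → ℂ} (ha : FastDecay a) (v : Fin m → ℝ) :
    FastDecay fun k => I * ((∑ l, (k l : ℝ) * v l : ℝ) : ℂ) * a k := fun p => by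
  refine Summable.of_nonneg_of_le (fun k => by positivity) (fun k => ?_)
    ((ha (p + 1)).mul_left ‖v‖)
  rw [norm_mul, norm_mul, norm_I, one_mul, norm_real, Real.norm_eq_abs]
  calc _ ≤ (∑ l, |(k l : ℝ)|) ^ p * (((∑ l, |(k l : ℝ)|) * ‖v‖) * ‖a k‖) := by
        gcongr; exact abs_sum_mul_le k v
    _ = _ := by ring

lemma hasDerivAt_torusSeries_line {a : (Fin m → ℤ) → ℂ} (ha : FastDecay a) (θ v : Fin m → ℝ)
    (s : ℝ) :
    HasDerivAt (fun s : ℝ => torusSeries a (θ + s • v))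
      (torusSeries (fun k => I * ((∑ l, (k l : ℝ) * v l : ℝ) : ℂ) * a k) (θ + s • v)) s := by
  have hs : Summable fun k : Fin m → ℤ =>
      a k * cexp (I * ((∑ l, (k l : ℝ) * (θ + (0 : ℝ) • v) l : ℝ) : ℂ)) := ha.summable_term _
  unfold torusSeries
  refine hasDerivAt_tsum (u := fun k => ‖I * ((∑ l, (k l : ℝ) * v l : ℝ) : ℂ) * a k‖)
    (g := fun k s => a k * cexp (I * ((∑ l, (k l : ℝ) * (θ + s • v) l : ℝ) : ℂ)))
    (g' := fun k s => I * ((∑ l, (k l : ℝ) * v l : ℝ) : ℂ) * a k *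
      cexp (I * ((∑ l, (k l : ℝ) * (θ + s • v) l : ℝ) : ℂ)))
    (y₀ := 0) (ha.deriv v).summable_norm (fun k y => ?_) (fun k y => ?_) hs s
  · have h1 : HasDerivAt (fun s : ℝ => ∑ l, (k l : ℝ) * (θ + s • v) l)
        (∑ l, (k l : ℝ) * v l) y := by
      have : ∀ l ∈ Finset.univ, HasDerivAt (fun s : ℝ => (k l : ℝ) * (θ + s • v) l)
          ((k l : ℝ) * v l) y := fun l _ => by
        have := (((hasDerivAt_id y).mul_const (v l)).const_add (θ l)).const_mul (k l : ℝ)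
        simpa using this
      exact HasDerivAt.fun_sum this
    have h2 := (((h1.ofReal_comp).const_mul I).cexp).const_mul (a k)
    refine h2.congr_deriv ?_
    ring
  · rw [norm_mul, norm_cexp_I_mul_ofReal, mul_one]

/-- The n-th derivative of the term of mode `k` has norm at most |k|^n ‖a k‖, which is summable by
fast decay; so the series can be differentiated termwise to every order. -/
lemma contDiff_torusSeries {a : (Fin m → ℤ) → ℂ} (ha : FastDecay a) :
    ContDiff ℝ (⊤ : ℕ∞) (torusSeries a) := by
  let ℓ : (Fin m → ℤ) → (Fin m → ℝ) →L[ℝ] ℝ := fun k =>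
    ∑ l, (k l : ℝ) • ContinuousLinearMap.proj l
  have hℓ : ∀ k θ, ℓ k θ = ∑ l, (k l : ℝ) * θ l := fun k θ => by
    simp [ℓ]
  have hℓn : ∀ k, ‖ℓ k‖ ≤ ∑ l, |(k l : ℝ)| := fun k => by
    refine ContinuousLinearMap.opNorm_le_bound _ (by positivity) fun θ => ?_
    rw [hℓ, Real.norm_eq_abs]
    exact abs_sum_mul_le k θ
  let e : ℝ → ℂ := fun s => cexp (I * (s : ℂ))
  have he : ContDiff ℝ (⊤ : ℕ∞) e :=
    (contDiff_const.mul ofRealCLM.contDiff).cexp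
  have hit : ∀ n s, ‖iteratedFDeriv ℝ n e s‖ = 1 := by
    have hd : ∀ n, iteratedDeriv n e = fun s => I ^ n * e s := by
      intro n
      induction n with
      | zero => funext s; simp
      | succ n ih =>
        rw [iteratedDeriv_succ, ih]
        funext s
        have h : HasDerivAt e (e s * (I * 1)) s :=
          (((hasDerivAt_id s).ofReal_comp).const_mul I).cexp
        rw [(h.const_mul (I ^ n)).deriv]
        ring
    intro n s
    rw [norm_iteratedFDeriv_eq_norm_iteratedDeriv, hd, norm_mul, norm_pow, norm_I, one_pow,
      one_mul]
    exact norm_cexp_I_mul_ofReal s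
  have hterm : ∀ k, (fun θ : Fin m → ℝ => a k * cexp (I * ((∑ l, (k l : ℝ) * θ l : ℝ) : ℂ)))
      = fun θ => a k • (e ∘ ℓ k) θ := fun k => by
    funext θ; simp [e, hℓ]
  refine contDiff_tsum (v := fun n k => (∑ l, |(k l : ℝ)|) ^ n * ‖a k‖) (fun k => ?_)
    (fun n _ => ha n) (fun n k θ _ => ?_)
  · rw [hterm]
    exact (he.comp (ℓ k).contDiff).const_smul (a k)
  · rw [hterm]
    have hc : ContDiff ℝ n (e ∘ ℓ k) := (he.comp (ℓ k).contDiff).of_le (by exact_mod_cast le_top)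
    rw [show (fun θ => a k • (e ∘ ℓ k) θ) = a k • (e ∘ ℓ k) from rfl,
      iteratedFDeriv_const_smul_apply hc.contDiffAt, norm_smul, mul_comm]
    gcongr
    rw [(ℓ k).iteratedFDeriv_comp_right he θ (i := n) (by exact_mod_cast le_top)]
    refine (ContinuousMultilinearMap.norm_compContinuousLinearMap_le _ _).trans ?_
    rw [hit, one_mul, Finset.prod_const, Finset.card_univ, Fintype.card_fin]
    gcongr
    exact hℓn k

lemma torusSeries_eq_of_lift (a : (Fin m → ℤ) → ℂ) {ω θ : Fin m → ℝ} {t : ℝ} {k : Fin m → ℤ}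
    (h : ∀ i, θ i = t * ω i + 2 * Real.pi * k i) :
    torusSeries a θ = torusSeries a (t • ω) := by
  refine tsum_congr fun k' => ?_
  congr 1
  rw [Complex.exp_eq_exp_iff_exists_int]
  refine ⟨∑ l, k' l * k l, ?_⟩
  simp only [h, Pi.smul_apply, smul_eq_mul]
  push_cast
  simp only [mul_add, Finset.sum_add_distrib, Finset.sum_mul, Finset.mul_sum]
  congr 1
  exact Finset.sum_congr rfl fun l _ => by ring

lemma torusSeries_smul (a : (Fin m → ℤ) → ℂ) (ω : Fin m → ℝ) (t : ℝ) :
    torusSeries a (t • ω) = ∑' k : Fin m → ℤ, a k * cexp (I * (((∑ l, k l * ω l) * t : ℝ) : ℂ)) := by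
  refine tsum_congr fun k => ?_
  congr 4
  rw [Finset.sum_mul]
  exact Finset.sum_congr rfl fun l _ => by simp; ring

/-- Uniqueness of the Fourier coefficients, tested along a dense orbit. -/
lemma coeff_eq_zero_of_torusSeries {a : (Fin m → ℤ) → ℂ} (ha : FastDecay a) {ω : Fin m → ℝ}
    (hω : LinearIndependent ℚ ω) (h : ∀ t : ℝ, torusSeries a (t • ω) = 0) : a = 0 := by
  funext k
  refine coeff_eq_zero_of_tsum_eq_zero ha.summable_norm (injective_frequency hω) (fun t => ?_) k
  rw [← torusSeries_smul]
  exact h t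

lemma torusSeries_add {a b : (Fin m → ℤ) → ℂ} (ha : FastDecay a) (hb : FastDecay b)
    (θ : Fin m → ℝ) :
    torusSeries (fun k => a k + b k) θ = torusSeries a θ + torusSeries b θ := by
  rw [torusSeries, torusSeries, torusSeries, ← (ha.summable_term θ).tsum_add (hb.summable_term θ)]
  exact tsum_congr fun k => by ring

lemma torusSeries_const_mul (a : (Fin m → ℤ) → ℂ) (c : ℂ) (θ : Fin m → ℝ) :
    torusSeries (fun k => c * a k) θ = c * torusSeries a θ := by
  rw [torusSeries, torusSeries, ← tsum_mul_left]
  exact tsum_congr fun k => by ring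

end TorusSeries

/-! ### Changing the lattice of frequencies -/

section Frequencies

open Complex

/-- A series on frequencies in the group spanned by `ν`, possibly with repetitions, is
quasiperiodic. -/
lemma isQuasiperiodic_of_hasSum {J : Type*} {N : ℕ} {ν : Fin N → ℝ} (κ : J → Fin N → ℤ)
    (a : J → Fin 3 → ℂ)
    (ha : ∀ (p : ℕ) (α : Fin 3), Summable fun j => (∑ l, |(κ j l : ℝ)|) ^ p * ‖a j α‖)
    {Z : ℝ → E3}
    (hZ : ∀ (t : ℝ) (α : Fin 3), HasSum
      (fun j => a j α * cexp (I * (((∑ l, κ j l * ν l) * t : ℝ) : ℂ))) ((Z t α : ℝ) : ℂ)) :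
    IsQuasiperiodic ν Z := by
  have hn : ∀ α, Summable fun j => ‖a j α‖ := fun α => by simpa using ha 0 α
  have hfib : ∀ α k, Summable fun j : {j // κ j = k} => ‖a j α‖ := fun α k =>
    (hn α).subtype {j | κ j = k}
  -- Terms with the same mode are collected along the fibres of `κ`.
  refine ⟨fun k α => ∑' j : {j // κ j = k}, a j α, fun p α => ?_, fun t α => ?_⟩
  · have hs := ((Equiv.sigmaFiberEquiv κ).summable_iff.mpr (ha p α)).sigma
    refine Summable.of_nonneg_of_le (fun k => by positivity) (fun k => ?_) hs
    have e : ∀ j : {j // κ j = k}, ((fun j => (∑ l, |(κ j l : ℝ)|) ^ p * ‖a j α‖) ∘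
        (Equiv.sigmaFiberEquiv κ)) ⟨k, j⟩ = (∑ l, |(k l : ℝ)|) ^ p * ‖a j α‖ := by
      rintro ⟨j, rfl⟩; rfl
    simp only [e, tsum_mul_left]
    gcongr
    exact norm_tsum_le_tsum_norm (hfib α k)
  · have h := (Equiv.sigmaFiberEquiv κ).hasSum_iff.mpr (hZ t α)
    refine h.sigma fun k => ?_
    have e : ∀ j : {j // κ j = k}, ((fun j => a j α *
        cexp (I * (((∑ l, κ j l * ν l) * t : ℝ) : ℂ))) ∘ (Equiv.sigmaFiberEquiv κ)) ⟨k, j⟩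
        = a j α * cexp (I * (((∑ l, k l * ν l) * t : ℝ) : ℂ)) := by
      rintro ⟨j, rfl⟩; rfl
    simp only [e]
    exact ((hfib α k).of_norm.hasSum).mul_right _

lemma exists_bound_of_linearMap {m N : ℕ} (g : (Fin m → ℤ) →ₗ[ℤ] (Fin N → ℤ)) :
    ∃ C : ℝ, 0 ≤ C ∧ ∀ k, ∑ i, |(g k i : ℝ)| ≤ C * ∑ l, |(k l : ℝ)| := by
  refine ⟨∑ i, ∑ l, |(g (Pi.single l 1) i : ℝ)|, by positivity, fun k => ?_⟩
  rw [Finset.sum_mul]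
  refine Finset.sum_le_sum fun i _ => ?_
  have hk : g k i = ∑ l, k l * g (Pi.single l 1) i := by
    conv_lhs => rw [show k = ∑ l, k l • (Pi.single l 1 : Fin m → ℤ) by
      funext j; simp [Finset.sum_apply, Pi.single_apply]]
    simp only [map_sum, map_smul, Finset.sum_apply, Pi.smul_apply, smul_eq_mul]
  rw [hk]
  push_cast
  refine (Finset.abs_sum_le_sum_abs _ _).trans ?_
  rw [Finset.sum_mul]
  refine Finset.sum_le_sum fun l _ => ?_
  rw [abs_mul, mul_comm]
  gcongr
  exact Finset.single_le_sum (f := fun l => |(k l : ℝ)|) (fun _ _ => abs_nonneg _)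
    (Finset.mem_univ l)

lemma linearIndependent_frequency {m r : ℕ} {ω : Fin m → ℝ} (hω : LinearIndependent ℚ ω)
    {b : Fin r → Fin m → ℤ} (hb : LinearIndependent ℤ b) :
    LinearIndependent ℚ fun i => ∑ l, (b i l : ℝ) * ω l := by
  rw [← LinearIndependent.iff_fractionRing ℤ ℚ, Fintype.linearIndependent_iff]
  intro g hg
  rw [Fintype.linearIndependent_iff] at hb
  refine hb g (injective_frequency hω ?_)
  simp only [zsmul_eq_mul, Finset.mul_sum] at hg
  rw [Finset.sum_comm] at hg
  simp only [Finset.sum_apply, Pi.smul_apply, smul_eq_mul, Int.cast_sum, Int.cast_mul,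
    Finset.sum_mul, Pi.zero_apply, Int.cast_zero, zero_mul, Finset.sum_const_zero]
  simpa only [mul_assoc] using hg

/-- Any subgroup of the group of integer vectors is the injective image of some `ℤ ^ r`, with
comparable sizes. -/
lemma exists_parametrization {m : ℕ} (N : Submodule ℤ (Fin m → ℤ)) :
    ∃ (r : ℕ) (B : (Fin r → ℤ) →ₗ[ℤ] (Fin m → ℤ)) (C : ℝ), 0 ≤ C ∧ Function.Injective B ∧
      LinearMap.range B = N ∧ ∀ k, ∑ i, |(k i : ℝ)| ≤ C * ∑ l, |(B k l : ℝ)| := by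
  obtain ⟨r, snf⟩ := Submodule.smithNormalForm (Pi.basisFun ℤ (Fin m)) N
  obtain ⟨C, hC, hb⟩ := exists_bound_of_linearMap snf.bM.equivFun.toLinearMap
  have hinj : Function.Injective (N.subtype ∘ₗ snf.bN.equivFun.symm.toLinearMap) := by
    simpa using snf.bN.equivFun.symm.injective
  refine ⟨r, N.subtype ∘ₗ snf.bN.equivFun.symm.toLinearMap, C, hC, hinj, ?_, fun k => ?_⟩
  · rw [LinearMap.range_comp, LinearEquiv.range, Submodule.map_top, Submodule.range_subtype]
  · refine le_trans ?_ (hb _)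
    set y : N := snf.bN.equivFun.symm k with hy
    have hk : ∀ i, k i = snf.bN.repr y i := fun i => by
      rw [← Module.Basis.equivFun_apply, hy, LinearEquiv.apply_symm_apply]
    -- In the adapted basis of the ambient lattice `y` has coordinates `snf.a i * k i`. As nonzero
    -- integers are at least 1 in absolute value, `k` is no larger than these coordinates. This
    -- direction of the comparison is the one that transports fast decay to the new modes.
    have ha : ∀ i, snf.a i ≠ 0 := fun i h0 => by
      have h1 := snf.snf i
      rw [h0, zero_smul] at h1
      exact snf.bN.ne_zero i (Subtype.ext h1)
    have hle : ∀ i, |(k i : ℝ)| ≤ |((snf.bM.repr (y : Fin m → ℤ) (snf.f i) : ℤ) : ℝ)| := fun i => by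
      have := snf.repr_apply_embedding_eq_repr_smul (m := y) (i := i)
      have h2 : snf.bM.repr (y : Fin m → ℤ) (snf.f i) = snf.a i * k i := by
        rw [this, map_smul, hk, Finsupp.smul_apply, smul_eq_mul]
      rw [h2, Int.cast_mul, abs_mul]
      refine le_mul_of_one_le_left (abs_nonneg _) ?_
      exact_mod_cast Int.one_le_abs (ha i)
    calc ∑ i, |(k i : ℝ)| ≤ ∑ i, |((snf.bM.repr (y : Fin m → ℤ) (snf.f i) : ℤ) : ℝ)| :=
          Finset.sum_le_sum fun i _ => hle i
      _ = ∑ i ∈ Finset.univ.map snf.f, |((snf.bM.repr (y : Fin m → ℤ) i : ℤ) : ℝ)| := by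
          rw [Finset.sum_map]
      _ ≤ ∑ i, |((snf.bM.repr (y : Fin m → ℤ) i : ℤ) : ℝ)| :=
          Finset.sum_le_sum_of_subset_of_nonneg (Finset.subset_univ _) fun _ _ _ => abs_nonneg _
      _ = _ := rfl

lemma frequency_comp {m r : ℕ} (B : (Fin r → ℤ) →ₗ[ℤ] (Fin m → ℤ)) (ω : Fin m → ℝ)
    (k : Fin r → ℤ) :
    ∑ i, (k i : ℝ) * ∑ l, (B (Pi.single i 1) l : ℝ) * ω l = ∑ l, (B k l : ℝ) * ω l := by
  have hk : ∀ l, B k l = ∑ i, k i * B (Pi.single i 1) l := fun l => by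
    conv_lhs => rw [show k = ∑ i, k i • (Pi.single i 1 : Fin r → ℤ) by
      funext j; simp [Finset.sum_apply, Pi.single_apply]]
    simp only [map_sum, map_smul, Finset.sum_apply, Pi.smul_apply, smul_eq_mul]
  simp only [hk, Int.cast_sum, Int.cast_mul, Finset.sum_mul, Finset.mul_sum]
  rw [Finset.sum_comm]
  simp only [mul_assoc]

/-- Any family of quasiperiodic vectors with common independent frequencies can
be written with independent frequencies for which the active Fourier modes span all modes. -/
lemma exists_spanning_coefficients {Λ : Type*} {m : ℕ} {ω : Fin m → ℝ}
    (hω : LinearIndependent ℚ ω) {x : ℝ → Λ → E3}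
    (hx : ∀ l, IsQuasiperiodic ω fun t => x t l) :
    ∃ (r : ℕ) (ν : Fin r → ℝ) (a : Λ → Fin 3 → (Fin r → ℤ) → ℂ), LinearIndependent ℚ ν ∧
      (∀ l α, FastDecay (a l α)) ∧
      (∀ t l α, torusSeries (a l α) (t • ν) = ((x t l α : ℝ) : ℂ)) ∧
      Submodule.span ℤ {k | ∃ l α, a l α k ≠ 0} = ⊤ := by
  choose A hA hsum using hx
  -- The active modes. The subgroup they generate becomes the new ℤ^r, and its basis pairs with `ω`
  -- to give the new frequencies.
  let s : Set (Fin m → ℤ) := {k | ∃ l α, A l k α ≠ 0}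
  obtain ⟨r, B, C, hC, hB, hrange, hbound⟩ := exists_parametrization (Submodule.span ℤ s)
  have hzero : ∀ l α k, k ∉ Set.range B → A l k α = 0 := fun l α k hk => by
    by_contra h
    apply hk
    have : k ∈ LinearMap.range B := by rw [hrange]; exact Submodule.subset_span ⟨l, α, h⟩
    exact this
  refine ⟨r, fun i => ∑ l, (B (Pi.single i 1) l : ℝ) * ω l, fun l α k => A l (B k) α, ?_, ?_, ?_, ?_⟩
  · refine linearIndependent_frequency hω ?_
    have := (Pi.basisFun ℤ (Fin r)).linearIndependent.map' B (LinearMap.ker_eq_bot.mpr hB)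
    have e : (fun i => B (Pi.single i 1)) = ⇑B ∘ ⇑(Pi.basisFun ℤ (Fin r)) := by funext i; simp
    rw [e]
    exact this
  · intro l α p
    refine Summable.of_nonneg_of_le (fun k => by positivity) (fun k => ?_)
      (((hA l p α).comp_injective hB).mul_left (C ^ p))
    simp only [Function.comp]
    rw [← mul_assoc, ← mul_pow]
    gcongr
    exact hbound k
  · intro t l α
    rw [torusSeries_smul]
    simp only [frequency_comp]
    refine HasSum.tsum_eq ?_
    have := hsum l t α
    rw [← hB.hasSum_iff] at this
    · exact this
    · intro k hk
      rw [hzero l α k hk, zero_mul]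
  · rw [eq_top_iff]
    rintro k -
    have hk : B k ∈ Submodule.span ℤ s := by rw [← hrange]; exact ⟨k, rfl⟩
    -- Every active mode is the image under `B` of an active new mode. Since `B` is injective,
    -- spanning can be pulled back.
    have hmap : Submodule.span ℤ s ≤
        (Submodule.span ℤ {k | ∃ l α, A l (B k) α ≠ 0}).map B := by
      rw [Submodule.span_le]
      rintro k' ⟨l, α, h⟩
      by_cases hk' : k' ∈ Set.range B
      · obtain ⟨k, rfl⟩ := hk'
        exact ⟨k, Submodule.subset_span ⟨l, α, h⟩, rfl⟩
      · exact absurd (hzero l α k' hk') h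
    obtain ⟨k', hk', h⟩ := hmap hk
    rwa [← hB h]

/-- Rationally independent real numbers can be completed to a longer independent family. -/
lemma exists_linearIndependent_extension {r N : ℕ} (hrN : r ≤ N) {ω : Fin r → ℝ}
    (hω : LinearIndependent ℚ ω) :
    ∃ ν : Fin N → ℝ, LinearIndependent ℚ ν ∧ ∀ i, ν (Fin.castLE hrN i) = ω i := by
  induction N, hrN using Nat.le_induction with
  | base => exact ⟨ω, hω, fun i => rfl⟩
  | succ N hN ih =>
    obtain ⟨ν, hν, h⟩ := ih
    have hx : ∃ x : ℝ, x ∉ Submodule.span ℚ (Set.range ν) := by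
      by_contra! hall
      -- Otherwise ℝ would be finite-dimensional over ℚ, whereas its dimension is the continuum.
      have htop : Submodule.span ℚ (Set.range ν) = ⊤ := eq_top_iff.mpr fun x _ => hall x
      have hfin : Module.Finite ℚ ℝ :=
        ⟨⟨Finset.univ.image ν, by simpa using htop⟩⟩
      have h1 := Real.rank_rat_real
      have h2 := Module.rank_lt_aleph0 ℚ ℝ
      rw [h1] at h2
      exact absurd Cardinal.aleph0_le_continuum (not_le.mpr h2)
    obtain ⟨x, hx⟩ := hx
    refine ⟨Fin.snoc ν x, linearIndependent_finSnoc.mpr ⟨hν, hx⟩, fun i => ?_⟩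
    rw [← h i, show Fin.castLE (Nat.le_succ_of_le hN) i = (Fin.castLE hN i).castSucc from rfl,
      Fin.snoc_castSucc]

end Frequencies

end RigidBodies
end

noncomputable section
namespace RigidBodies

/-! ### Periodic functions, closed one-forms and linear equations along dense orbits -/

section TorusFunctions

open Filter Topology

variable {m : ℕ} {X : Type*}

/-- Functions on `ℝ ^ m` that are `2π`-periodic in every variable. -/
def IsTorusPeriodic (f : (Fin m → ℝ) → X) : Prop :=
  ∀ (θ : Fin m → ℝ) (k : Fin m → ℤ), f (θ + fun i => 2 * Real.pi * k i) = f θ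

lemma isTorusPeriodic_torusSeries (a : (Fin m → ℤ) → ℂ) : IsTorusPeriodic (torusSeries a) :=
  fun θ k => by
    have h := torusSeries_eq_of_lift a (ω := θ) (t := 1) (k := k)
      (θ := θ + fun i => 2 * Real.pi * k i) (fun i => by simp)
    rwa [one_smul] at h

lemma IsTorusPeriodic.exists_bound {f : (Fin m → ℝ) → ℝ} (hf : IsTorusPeriodic f)
    (hc : Continuous f) : ∃ M, ∀ θ, |f θ| ≤ M := by
  obtain ⟨M, hM⟩ := (isCompact_Icc (a := (0 : Fin m → ℝ))
    (b := fun _ => 2 * Real.pi)).exists_bound_of_continuousOn hc.continuousOn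
  refine ⟨M, fun θ => ?_⟩
  have hp : 0 < 2 * Real.pi := by positivity
  rw [← hf θ fun i => -⌊θ i / (2 * Real.pi)⌋]
  refine hM _ ⟨fun i => ?_, fun i => ?_⟩
  · have := Int.floor_le (θ i / (2 * Real.pi))
    rw [le_div_iff₀ hp] at this
    simp only [Pi.zero_apply, Pi.add_apply, Int.cast_neg]
    linarith
  · have := (Int.lt_floor_add_one (θ i / (2 * Real.pi))).le
    rw [div_le_iff₀ hp] at this
    simp only [Pi.add_apply, Int.cast_neg]
    linarith

lemma IsTorusPeriodic.fderiv_apply {E : Type*} [NormedAddCommGroup E] [NormedSpace ℝ E]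
    {f : (Fin m → ℝ) → E} (hf : IsTorusPeriodic f) (v : Fin m → ℝ) :
    IsTorusPeriodic fun θ => fderiv ℝ f θ v := fun θ k => by
  have : (fun θ => f (θ + fun i => 2 * Real.pi * k i)) = f := funext fun θ => hf θ k
  show fderiv ℝ f (θ + fun i => 2 * Real.pi * k i) v = fderiv ℝ f θ v
  conv_rhs => rw [← this, fderiv_comp_add_right]

lemma IsTorusPeriodic.eq_of_mem_liftedOrbit {f : (Fin m → ℝ) → X} (hf : IsTorusPeriodic f)
    {ω θ : Fin m → ℝ} (hθ : θ ∈ liftedOrbit ω) : ∃ t : ℝ, f θ = f (t • ω) := by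
  obtain ⟨t, k, h⟩ := hθ
  refine ⟨t, ?_⟩
  rw [← hf (t • ω) k]
  congr 1
  funext i
  simp [h i]

/-- A closed condition that holds along a dense orbit holds on the whole torus. -/
lemma IsTorusPeriodic.eq_of_eq_on_orbit [TopologicalSpace X] [T2Space X]
    {f g : (Fin m → ℝ) → X} (hf : IsTorusPeriodic f) (hg : IsTorusPeriodic g)
    (hfc : Continuous f) (hgc : Continuous g) {ω : Fin m → ℝ} (hω : LinearIndependent ℚ ω)
    (h : ∀ t : ℝ, f (t • ω) = g (t • ω)) : f = g := by
  refine Continuous.ext_on (dense_liftedOrbit hω) hfc hgc ?_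
  rintro θ ⟨t, k, hθ⟩
  have e : θ = t • ω + fun i => 2 * Real.pi * k i := by funext i; simp [hθ i]
  rw [e, hf, hg, h]

lemma fderiv_fderiv_apply {E F : Type*} [NormedAddCommGroup E] [NormedSpace ℝ E]
    [NormedAddCommGroup F] [NormedSpace ℝ F] {f : E → F} (hf : ContDiff ℝ 2 f) (x u v : E) :
    fderiv ℝ (fun y => fderiv ℝ f y u) x v = fderiv ℝ (fderiv ℝ f) x v u := by
  have hd : DifferentiableAt ℝ (fderiv ℝ f) x :=
    (hf.fderiv_right (m := 1) (by norm_num)).differentiable one_ne_zero x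
  rw [fderiv_clm_apply hd (differentiableAt_const u)]
  simp

lemma fderiv_fderiv_comm {E F : Type*} [NormedAddCommGroup E] [NormedSpace ℝ E]
    [NormedAddCommGroup F] [NormedSpace ℝ F] {f : E → F} (hf : ContDiff ℝ 2 f) (x u v : E) :
    fderiv ℝ (fun y => fderiv ℝ f y u) x v = fderiv ℝ (fun y => fderiv ℝ f y v) x u := by
  rw [fderiv_fderiv_apply hf, fderiv_fderiv_apply hf]
  exact (hf.contDiffAt.isSymmSndFDerivAt (by simp)).eq v u

/-- If the exterior derivative of a one-form on the plane is constant and the form is bounded,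
then the form is closed. -/
lemma eq_zero_of_constant_curl {E : Type*} [NormedAddCommGroup E] [NormedSpace ℝ E]
    {a b : E → ℝ} (ha : ContDiff ℝ 1 a) (hb : ContDiff ℝ 1 b) {M : ℝ}
    (haM : ∀ x, |a x| ≤ M) (hbM : ∀ x, |b x| ≤ M) (u v : E) {c : ℝ}
    (hc : ∀ x, fderiv ℝ b x u - fderiv ℝ a x v = c) : c = 0 := by
  let ℓ : ℝ × ℝ →L[ℝ] E :=
    (ContinuousLinearMap.fst ℝ ℝ ℝ).smulRight u + (ContinuousLinearMap.snd ℝ ℝ ℝ).smulRight v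
  have hbd : ∀ p, HasFDerivAt (b ∘ ℓ) ((fderiv ℝ b (ℓ p)).comp ℓ) p := fun p =>
    ((hb.differentiable one_ne_zero _).hasFDerivAt).comp p ℓ.hasFDerivAt
  have had : ∀ p, HasFDerivAt (fun p => -(a ∘ ℓ) p) (-(fderiv ℝ a (ℓ p)).comp ℓ) p := fun p =>
    (((ha.differentiable one_ne_zero _).hasFDerivAt).comp p ℓ.hasFDerivAt).neg
  have hdiv : ∀ p : ℝ × ℝ, ((fderiv ℝ b (ℓ p)).comp ℓ) (1, 0)
      + (-(fderiv ℝ a (ℓ p)).comp ℓ) (0, 1) = c := fun p => by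
    rw [← hc (ℓ p)]; simp [ℓ, sub_eq_add_neg]
  -- Stokes' formula on the square of side `N` spanned by `u` and `v`: the flux is c N², while the
  -- boundary integrals are at most 4 M N.
  have key : ∀ N : ℝ, 0 < N → |c| * N ≤ 4 * M := by
    intro N hN
    have h := integral2_divergence_prod_of_hasFDerivAt (b ∘ ℓ) (fun p => -(a ∘ ℓ) p)
      (fun p => (fderiv ℝ b (ℓ p)).comp ℓ) (fun p => -(fderiv ℝ a (ℓ p)).comp ℓ) 0 0 N N
      (hb.continuous.comp ℓ.continuous).continuousOn
      (ha.continuous.comp ℓ.continuous).neg.continuousOn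
      (fun p _ => hbd p) (fun p _ => had p) (by
        simp only [hdiv]
        exact (continuousOn_const).integrableOn_compact (isCompact_uIcc.prod isCompact_uIcc))
    simp only [hdiv, intervalIntegral.integral_const, sub_zero, smul_eq_mul] at h
    have bnd : ∀ φ : ℝ → ℝ, (∀ x, |φ x| ≤ M) → |∫ x in (0 : ℝ)..N, φ x| ≤ M * N := by
      intro φ hφ
      have := intervalIntegral.norm_integral_le_of_norm_le_const (a := 0) (b := N) (C := M)
        (f := φ) fun x _ => hφ x
      rwa [sub_zero, abs_of_pos hN] at this
    have h1 := bnd (fun x => -(a ∘ ℓ) (x, N)) fun x => by rw [abs_neg]; exact haM _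
    have h2 := bnd (fun x => -(a ∘ ℓ) (x, 0)) fun x => by rw [abs_neg]; exact haM _
    have h3 := bnd (fun y => (b ∘ ℓ) (N, y)) fun x => hbM _
    have h4 := bnd (fun y => (b ∘ ℓ) (0, y)) fun x => hbM _
    have h5 : |N * (N * c)| ≤ 4 * M * N := by
      rw [h, abs_le]
      rw [abs_le] at h1 h2 h3 h4
      constructor <;> linarith [h1.1, h1.2, h2.1, h2.2, h3.1, h3.2, h4.1, h4.2]
    rw [abs_mul, abs_mul, abs_of_pos hN] at h5
    nlinarith
  by_contra hne
  have hpos : 0 < |c| := abs_pos.mpr hne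
  have hM : 0 ≤ M := (abs_nonneg _).trans (haM 0)
  have := key ((4 * M + 1) / |c|) (by positivity)
  rw [mul_div_cancel₀ _ hpos.ne'] at this
  linarith

/-- Let `a`, `b`, `c` be the values of a one-form on the torus on the constant vector fields `u`,
`v`, `ω`. If the exterior derivative of the form vanishes on `ω` and the flow of `ω` is dense, then
the form is closed. -/
lemma closed_of_contraction_eq_zero {a b c : (Fin m → ℝ) → ℝ} (ha : ContDiff ℝ 2 a)
    (hb : ContDiff ℝ 2 b) (hc : ContDiff ℝ 2 c) (hap : IsTorusPeriodic a)
    (hbp : IsTorusPeriodic b) {ω u v : Fin m → ℝ} (hω : LinearIndependent ℚ ω)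
    (hbc : ∀ θ, fderiv ℝ b θ ω = fderiv ℝ c θ v) (hac : ∀ θ, fderiv ℝ a θ ω = fderiv ℝ c θ u)
    (θ : Fin m → ℝ) : fderiv ℝ b θ u = fderiv ℝ a θ v := by
  set g : (Fin m → ℝ) → ℝ := fun θ => fderiv ℝ b θ u - fderiv ℝ a θ v with hg
  have hdir : ∀ {f : (Fin m → ℝ) → ℝ} (_ : ContDiff ℝ 2 f) (w : Fin m → ℝ),
      ContDiff ℝ 1 fun θ => fderiv ℝ f θ w := fun hf w =>
    (hf.fderiv_right (m := 1) (by norm_num)).clm_apply contDiff_const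
  have hgd : ContDiff ℝ 1 g := (hdir hb u).sub (hdir ha v)
  have hgω : ∀ θ, fderiv ℝ g θ ω = 0 := fun θ => by
    -- Commuting derivatives, the ω-derivative of the curl is ∂_u ∂_v c - ∂_v ∂_u c = 0.
    rw [hg, fderiv_fun_sub ((hdir hb u).differentiable one_ne_zero θ)
      ((hdir ha v).differentiable one_ne_zero θ)]
    rw [sub_apply, fderiv_fderiv_comm hb, fderiv_fderiv_comm ha]
    simp only [hbc, hac]
    rw [fderiv_fderiv_comm hc, sub_self]
  have hline : ∀ t : ℝ, g (t • ω) = g 0 := by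
    have hd : ∀ t : ℝ, HasDerivAt (fun t : ℝ => g (t • ω)) 0 t := fun t => by
      have h1 : HasDerivAt (fun t : ℝ => t • ω) ω t := by
        simpa using (hasDerivAt_id t).smul_const ω
      have := ((hgd.differentiable one_ne_zero (t • ω)).hasFDerivAt).comp_hasDerivAt t h1
      rwa [hgω] at this
    intro t
    have := is_const_of_deriv_eq_zero (fun t => (hd t).differentiableAt) (fun t => (hd t).deriv)
      t 0
    simpa using this
  have hgp : IsTorusPeriodic g := fun θ k => by
    exact congrArg₂ (· - ·) ((hbp.fderiv_apply u) θ k) ((hap.fderiv_apply v) θ k)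
  -- Constant along a dense orbit, hence constant. The one-form is bounded by periodicity, so
  -- `eq_zero_of_constant_curl` kills the constant.
  have hconst : g = fun _ => g 0 :=
    hgp.eq_of_eq_on_orbit (fun _ _ => rfl) hgd.continuous continuous_const hω hline
  obtain ⟨M, hM⟩ := hap.exists_bound ha.continuous
  obtain ⟨M', hM'⟩ := hbp.exists_bound hb.continuous
  have h0 := eq_zero_of_constant_curl (ha.of_le (by norm_num)) (hb.of_le (by norm_num))
    (M := max M M') (fun x => (hM x).trans (le_max_left _ _))
    (fun x => (hM' x).trans (le_max_right _ _)) u v (c := g 0) (fun x => congrFun hconst x)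
  have := congrFun hconst θ
  rw [h0] at this
  exact sub_eq_zero.mp this

/-- A function that is constant on a dense set has zero derivative wherever it is
differentiable. -/
lemma fderiv_eq_zero_of_dense {E : Type*} [NormedAddCommGroup E] [NormedSpace ℝ E] {f : E → ℝ}
    {D : Set E} (hD : Dense D) {c : ℝ} (hf : ∀ y ∈ D, f y = c) {x : E} (hx : x ∈ D) {f' : E →L[ℝ] ℝ}
    (h : HasFDerivAt f f' x) : f' = 0 := by
  -- Derivatives relative to a dense set are unique, since they only depend on its closure. So
  -- differentiability is needed at the single point `x`.
  have hu : UniqueDiffWithinAt ℝ D x := by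
    rw [← uniqueDiffWithinAt_closure, hD.closure_eq]
    exact uniqueDiffWithinAt_univ
  refine hu.eq h.hasFDerivWithinAt ?_
  exact (hasFDerivWithinAt_const c x D).congr hf (hf x hx)

/-- Linear differential equations with continuous coefficients have unique solutions. -/
lemma eq_zero_of_linear_ode {E : Type*} [NormedAddCommGroup E] [NormedSpace ℝ E]
    {A : ℝ → E →L[ℝ] E} (hA : Continuous A) {ξ : ℝ → E}
    (hξ : ∀ t, HasDerivAt ξ (A t (ξ t)) t) (h0 : ξ 0 = 0) (t : ℝ) : ξ t = 0 := by
  have right : ∀ (A : ℝ → E →L[ℝ] E) (_ : Continuous A) (ξ : ℝ → E)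
      (_ : ∀ t, HasDerivAt ξ (A t (ξ t)) t) (_ : ξ 0 = 0) (t : ℝ), 0 ≤ t → ξ t = 0 := by
    intro A hA ξ hξ h0 t ht
    obtain ⟨K, hK⟩ := (isCompact_Icc (a := 0) (b := t)).exists_bound_of_continuousOn
      hA.continuousOn
    refine eq_zero_of_abs_deriv_le_mul_abs_self_of_eq_zero_right (K := K) (b := t)
      (f' := fun s => A s (ξ s))
      (fun s _ => (hξ s).continuousAt.continuousWithinAt)
      (fun s _ => (hξ s).hasDerivWithinAt) h0 (fun s hs => ?_) t ⟨ht, le_rfl⟩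
    exact ((A s).le_opNorm _).trans (by gcongr; exact hK s ⟨hs.1, hs.2.le⟩)
  rcases le_total 0 t with ht | ht
  · exact right A hA ξ hξ h0 t ht
  -- Negative times are handled by reversing time.
  · have := right (fun s => -A (-s)) (hA.comp continuous_neg).neg (fun s => ξ (-s))
      (fun s => by
        have := (hξ (-s)).scomp s (hasDerivAt_neg s)
        exact this.congr_deriv (by simp)) (by simpa using h0) (-t) (by linarith)
    simpa using this

end TorusFunctions

end RigidBodies
end

noncomputable section
namespace RigidBodies

/-! ### Smooth parameter dependence through the Banach algebra C(K) -/

section SmoothKernel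

open Filter Topology

variable {K : Type*} [TopologicalSpace K]

/-- A positive continuous function, as a unit of the algebra of continuous functions. -/
def unitOfPos (f : C(K, ℝ)) (hf : ∀ z, 0 < f z) : C(K, ℝ)ˣ where
  val := f
  inv := ⟨fun z => (f z)⁻¹, f.continuous.inv₀ fun z => (hf z).ne'⟩
  val_inv := by ext z; simp [(hf z).ne']
  inv_val := by ext z; simp [(hf z).ne']

lemma inverse_apply_of_pos {f : C(K, ℝ)} (hf : ∀ z, 0 < f z) (z : K) :
    Ring.inverse f z = (f z)⁻¹ := by
  have : Ring.inverse ((unitOfPos f hf : C(K, ℝ)ˣ) : C(K, ℝ)) = ↑(unitOfPos f hf)⁻¹ :=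
    Ring.inverse_unit _
  exact congrArg (fun g : C(K, ℝ) => g z) this

variable [CompactSpace K]

lemma eventually_forall_pos {f : C(K, ℝ)} (hf : ∀ z, 0 < f z) : ∀ᶠ g in 𝓝 f, ∀ z, 0 < g z := by
  have ho : IsOpen {g : C(K, ℝ) | Set.MapsTo g Set.univ (Set.Ioi 0)} :=
    ContinuousMap.isOpen_setOfPred_mapsTo isCompact_univ isOpen_Ioi
  filter_upwards [ho.mem_nhds (show f ∈ _ from fun z _ => hf z)] with g hg z
  exact hg (Set.mem_univ z)

/-- Near a positive function, the pointwise square root is a smooth map of the Banach algebra of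
continuous functions. -/
lemma exists_contDiffAt_sqrt {f : C(K, ℝ)} (hf : ∀ z, 0 < f z) :
    ∃ ψ : C(K, ℝ) → C(K, ℝ), ContDiffAt ℝ (⊤ : ℕ∞) ψ f ∧
      ∀ᶠ g in 𝓝 f, ∀ z, ψ g z = √(g z) ∧ 0 < ψ g z := by
  let s : C(K, ℝ) := ⟨fun z => √(f z), f.continuous.sqrt⟩
  have hs : ∀ z, 0 < s z := fun z => Real.sqrt_pos.mpr (hf z)
  have hsq : s * s = f := by ext z; exact Real.mul_self_sqrt (hf z).le
  have h2 : ∀ z, 0 < (s + s) z := fun z => by simpa using hs z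
  let u : C(K, ℝ)ˣ := unitOfPos (s + s) h2
  -- The derivative of squaring at `s` is multiplication by 2s, invertible because `s` is positive.
  -- The square root is then the local inverse of squaring given by the inverse function theorem.
  let e : C(K, ℝ) ≃L[ℝ] C(K, ℝ) :=
    ContinuousLinearEquiv.equivOfInverse (ContinuousLinearMap.mul ℝ C(K, ℝ) (u : C(K, ℝ)))
      (ContinuousLinearMap.mul ℝ C(K, ℝ) (↑u⁻¹ : C(K, ℝ)))
      (fun g => by simp) (fun g => by simp)
  let q : C(K, ℝ) → C(K, ℝ) := fun g => g * g
  have hq : ContDiffAt ℝ (⊤ : ℕ∞) q s := (contDiff_id.mul contDiff_id).contDiffAt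
  have hq' : HasFDerivAt q (e : C(K, ℝ) →L[ℝ] C(K, ℝ)) s := by
    have := (hasFDerivAt_id (𝕜 := ℝ) s).mul (hasFDerivAt_id (𝕜 := ℝ) s)
    refine this.congr_fderiv ?_
    ext g z
    simp [e, u, unitOfPos]
  have hn : ((⊤ : ℕ∞) : WithTop ℕ∞) ≠ 0 := by simp
  have hstr : HasStrictFDerivAt q (e : C(K, ℝ) →L[ℝ] C(K, ℝ)) s := hq.hasStrictFDerivAt' hq' hn
  have hqs : q s = f := hsq
  refine ⟨hq.localInverse hq' hn, hqs ▸ hq.to_localInverse hq' hn, ?_⟩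
  have h1 : ∀ᶠ g in 𝓝 f, q (hq.localInverse hq' hn g) = g := by
    rw [← hqs]; exact hstr.eventually_right_inverse
  have h3 : Tendsto (hq.localInverse hq' hn) (𝓝 f) (𝓝 s) := by
    rw [← hqs]; exact hstr.localInverse_tendsto
  filter_upwards [h1, h3.eventually (eventually_forall_pos hs)] with g hg hpos z
  refine ⟨?_, hpos z⟩
  have : hq.localInverse hq' hn g z * hq.localInverse hq' hn g z = g z :=
    congrArg (fun g : C(K, ℝ) => g z) hg
  rw [← this, Real.sqrt_mul_self (hpos z).le]

variable [MeasurableSpace K] [OpensMeasurableSpace K] (μ : Measure K) [IsFiniteMeasure μ]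

lemma integrable_continuousMap (f : C(K, ℝ)) : Integrable f μ :=
  (BoundedContinuousFunction.mkOfCompact f).integrable μ

/-- Integration as a continuous functional on the continuous functions on a compact space. -/
def integralFunctional : C(K, ℝ) →L[ℝ] ℝ :=
  LinearMap.mkContinuous
    { toFun := fun f => ∫ z, f z ∂μ
      map_add' := fun f g =>
        integral_add (integrable_continuousMap μ f) (integrable_continuousMap μ g)
      map_smul' := fun c f => integral_const_mul c _ } (μ.real Set.univ) fun f => by
    have := norm_integral_le_of_norm_le_const (μ := μ) (f := f) (C := ‖f‖)
      (Eventually.of_forall fun z => f.norm_coe_le_norm z)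
    rw [mul_comm]; exact this

/-- Smooth dependence of a Newtonian potential on parameters, away from contact. -/
lemma contDiffAt_integral_inv_sqrt {E : Type*} [NormedAddCommGroup E] [NormedSpace ℝ E]
    (D : Fin 3 → E →L[ℝ] C(K, ℝ)) {x₀ : E} (h : ∀ z, 0 < ∑ α, D α x₀ z ^ 2) :
    ContDiffAt ℝ (⊤ : ℕ∞) (fun x => ∫ z, (√(∑ α, D α x z ^ 2))⁻¹ ∂μ) x₀ ∧
      ∀ᶠ x in 𝓝 x₀, Integrable (fun z => (√(∑ α, D α x z ^ 2))⁻¹) μ := by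
  -- The squared distance, a polynomial map into C(K). The integral is its composite with the smooth
  -- square root, inversion in the algebra, and a continuous linear functional.
  let N : E → C(K, ℝ) := fun x => ∑ α, D α x ^ 2
  have hN : ContDiff ℝ (⊤ : ℕ∞) N := ContDiff.sum fun α _ => (D α).contDiff.pow 2
  have hNz : ∀ x z, N x z = ∑ α, D α x z ^ 2 := fun x z => by
    simp [N]
  have hpos : ∀ z, 0 < N x₀ z := fun z => by rw [hNz]; exact h z
  obtain ⟨ψ, hψ, hψe⟩ := exists_contDiffAt_sqrt hpos
  have hψ0 : ∀ z, 0 < ψ (N x₀) z := fun z => (hψe.self_of_nhds z).2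
  have hinv : ContDiffAt ℝ (⊤ : ℕ∞) (fun x => Ring.inverse (ψ (N x))) x₀ := by
    have h1 : ContDiffAt ℝ (⊤ : ℕ∞) Ring.inverse (ψ (N x₀)) :=
      contDiffAt_ringInverse ℝ (unitOfPos (ψ (N x₀)) hψ0)
    exact h1.comp x₀ (hψ.comp x₀ hN.contDiffAt)
  have heq : ∀ᶠ x in 𝓝 x₀, ∀ z, Ring.inverse (ψ (N x)) z = (√(∑ α, D α x z ^ 2))⁻¹ := by
    filter_upwards [hN.continuous.continuousAt.eventually hψe] with x hx z
    rw [inverse_apply_of_pos (fun z => (hx z).2), (hx z).1, hNz]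
  refine ⟨?_, ?_⟩
  · have := (integralFunctional μ).contDiff.contDiffAt.comp x₀ hinv
    refine this.congr_of_eventuallyEq ?_
    filter_upwards [heq] with x hx
    simp only [← hx]
    rfl
  · filter_upwards [heq] with x hx
    simp only [← hx]
    exact integrable_continuousMap μ _

end SmoothKernel

end RigidBodies
end

noncomputable section
namespace RigidBodies

/-! ### The phase space as a normed space -/

section Phase

/-- Labels of all the vectors of a state: positions, momenta, principal axes, spins. -/
abbrev Slot (n : ℕ) (s : Finset (Fin (n + 1))) : Type :=
  (Fin (n + 1) ⊕ Fin (n + 1)) ⊕ ((s × Fin 3) ⊕ s)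

/-- States as elements of a normed space. -/
abbrev Phase (n : ℕ) (s : Finset (Fin (n + 1))) : Type := Slot n s → E3

variable {n : ℕ} {s : Finset (Fin (n + 1))}

abbrev slotPos (i : Fin (n + 1)) : Slot n s := .inl (.inl i)
abbrev slotMom (i : Fin (n + 1)) : Slot n s := .inl (.inr i)
abbrev slotAx (j : s) (a : Fin 3) : Slot n s := .inr (.inl (j, a))
abbrev slotSpin (j : s) : Slot n s := .inr (.inr j)

def toState (x : Phase n s) : State n s where
  pos i := x (slotPos i)
  mom i := x (slotMom i)
  axI j := x (slotAx j 0)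
  axJ j := x (slotAx j 1)
  axK j := x (slotAx j 2)
  spin j := x (slotSpin j)

def ofState (Y : State n s) : Phase n s :=
  Sum.elim (Sum.elim Y.pos Y.mom) (Sum.elim (fun p => ![Y.axI p.1, Y.axJ p.1, Y.axK p.1] p.2) Y.spin)

/-- Vectors that move all bodies by `v` without turning them; momenta and spins are arbitrary. -/
structure IsShift (d : Phase n s) (v : E3) : Prop where
  pos : ∀ i, d (slotPos i) = v
  ax : ∀ j a, d (slotAx j a) = 0

end Phase

/-! ### Invariance and smoothness of the potential energy -/

namespace GravSystem

variable {n : ℕ} (S : GravSystem n)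

/-- The mass distribution of body `i` in its own frame. -/
def bodyMeasure (i : Fin (n + 1)) : Measure E3 :=
  if h : i ∈ S.solids then S.density ⟨i, h⟩ else ENNReal.ofReal (S.mass i) • Measure.dirac 0

instance (i : Fin (n + 1)) : IsFiniteMeasure (S.bodyMeasure i) := by
  refine ⟨?_⟩
  rw [bodyMeasure]
  split_ifs with h
  · rw [S.density_univ ⟨i, h⟩]; exact ENNReal.ofReal_lt_top
  · simp

/-- The place in space of the point `z` of body `i`, as a linear function of the state. -/
def place (i : Fin (n + 1)) (z : E3) : Phase n S.solids →L[ℝ] E3 :=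
  ContinuousLinearMap.proj (slotPos i) +
    if h : i ∈ S.solids then ∑ a, z a • ContinuousLinearMap.proj (slotAx ⟨i, h⟩ a) else 0

lemma place_apply (i : Fin (n + 1)) (z : E3) (x : Phase n S.solids) :
    S.place i z x = x (slotPos i) +
      if h : i ∈ S.solids then ∑ a, z a • x (slotAx ⟨i, h⟩ a) else 0 := by
  rw [place]
  split_ifs <;> simp

lemma continuous_place (i : Fin (n + 1)) (x : Phase n S.solids) :
    Continuous fun z => S.place i z x := by
  simp only [place_apply]
  split_ifs
  · fun_prop
  · fun_prop

lemma spatialMass_toState (x : Phase n S.solids) (i : Fin (n + 1)) :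
    S.spatialMass (toState x) i = (S.bodyMeasure i).map fun z => S.place i z x := by
  rw [spatialMass, bodyMeasure]
  split_ifs with h
  · congr 1
    funext z
    rw [place_apply, dif_pos h, Fin.sum_univ_three]
    simp only [toState]
    abel
  · rw [Measure.map_smul, Measure.map_dirac' (S.continuous_place i x).measurable, place_apply,
      dif_neg h, add_zero]
    rfl

/-- The mutual potential of two bodies, up to a constant factor. -/
def pairEnergy (i i' : Fin (n + 1)) (x : Phase n S.solids) : ℝ :=
  ∫ z, ∫ z', ‖S.place i z x - S.place i' z' x‖⁻¹ ∂(S.bodyMeasure i') ∂(S.bodyMeasure i)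

/-- The potential energy as a function on the normed space of states. -/
def potential (x : Phase n S.solids) : ℝ := S.potentialEnergy (toState x)

/-- Pulling the integrals back to the body frames fixes the measures; the state then enters only
through the kernel, and linearly inside its norm. -/
lemma potential_eq (x : Phase n S.solids) :
    S.potential x = -∑ i, ∑ i' ∈ Finset.Ioi i, S.gravConst * S.pairEnergy i i' x := by
  rw [potential, potentialEnergy]
  congr 1
  refine Finset.sum_congr rfl fun i _ => Finset.sum_congr rfl fun i' _ => ?_
  congr 1
  rw [spatialMass_toState, spatialMass_toState, pairEnergy]
  rw [integral_map (S.continuous_place i x).aemeasurable]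
  · refine integral_congr_ae (Filter.Eventually.of_forall fun z => ?_)
    simp only
    rw [integral_map (S.continuous_place i' x).aemeasurable]
    exact (by fun_prop : Measurable fun y : E3 => ‖S.place i z x - y‖⁻¹).aestronglyMeasurable
  · refine StronglyMeasurable.aestronglyMeasurable ?_
    refine StronglyMeasurable.integral_prod_right (f := fun x y : E3 => ‖x - y‖⁻¹) ?_
    exact (by fun_prop : Measurable fun p : E3 × E3 => ‖p.1 - p.2‖⁻¹).stronglyMeasurable

lemma place_shift (i : Fin (n + 1)) (z : E3) {v : E3} {d : Phase n S.solids}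
    (hd : IsShift d v) : S.place i z d = v := by
  rw [place_apply]
  split_ifs <;> simp [hd.pos, hd.ax]

lemma place_axisRotation (i : Fin (n + 1)) (z k : E3) (θ : ℝ) (x : Phase n S.solids) :
    S.place i z (fun l => axisRotation k θ (x l)) = axisRotation k θ (S.place i z x) := by
  simp only [place_apply]
  split_ifs
  · simp only [Fin.sum_univ_three, axisRotation_add, axisRotation_smul]
  · simp

/-- Besides translation invariance this contains, for `v = 0`, the independence of the potential
from momenta and spins. -/
lemma potential_add_shift (x : Phase n S.solids) {d : Phase n S.solids} {v : E3}
    (hd : IsShift d v) : S.potential (x + d) = S.potential x := by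
  simp only [potential_eq, pairEnergy, map_add, S.place_shift _ _ hd, add_sub_add_right_eq_sub]

lemma potential_axisRotation {k : E3} (hk : ‖k‖ = 1) (θ : ℝ) (x : Phase n S.solids) :
    S.potential (fun l => axisRotation k θ (x l)) = S.potential x := by
  simp only [potential_eq, pairEnergy, place_axisRotation, ← axisRotation_sub,
    norm_axisRotation hk]

lemma isCompact_support_bodyMeasure (i : Fin (n + 1)) :
    IsCompact (S.bodyMeasure i).support := by
  obtain ⟨R, hR⟩ : ∃ R : ℝ, S.bodyMeasure i (Metric.closedBall 0 R)ᶜ = 0 := by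
    rw [bodyMeasure]
    split_ifs with h
    · exact S.density_bounded ⟨i, h⟩
    · exact ⟨0, by simp⟩
  exact (isCompact_closedBall (0 : E3) R).of_isClosed_subset Measure.isClosed_support
    (Measure.support_subset_of_isClosed Metric.isClosed_closedBall hR)

/-- Links the absence of contact, stated for supports in space, with distances between points of the
bodies. -/
lemma place_mem_support {i : Fin (n + 1)} {z : E3} (hz : z ∈ (S.bodyMeasure i).support)
    (x : Phase n S.solids) : S.place i z x ∈ (S.spatialMass (toState x) i).support := by
  rw [spatialMass_toState, Measure.mem_support_iff_forall]
  intro V hV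
  refine lt_of_lt_of_le ?_
    (Measure.le_map_apply (S.continuous_place i x).aemeasurable V)
  rw [Measure.mem_support_iff_forall] at hz
  exact hz _ ((S.continuous_place i x).continuousAt hV)

/-- The supports are compact and disjoint in space, so on their product the distance is a positive
continuous function, and `contDiffAt_integral_inv_sqrt` applies. Restricting to the supports loses
no mass. -/
lemma contDiffAt_pairEnergy {i i' : Fin (n + 1)} {x : Phase n S.solids}
    (hsep : Disjoint (S.spatialMass (toState x) i).support
      (S.spatialMass (toState x) i').support) :
    ContDiffAt ℝ (⊤ : ℕ∞) (S.pairEnergy i i') x := by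
  set K := (S.bodyMeasure i).support with hK
  set K' := (S.bodyMeasure i').support with hK'
  have : CompactSpace K := isCompact_iff_compactSpace.mp (S.isCompact_support_bodyMeasure i)
  have : CompactSpace K' := isCompact_iff_compactSpace.mp (S.isCompact_support_bodyMeasure i')
  let μ : Measure K := (S.bodyMeasure i).comap Subtype.val
  let μ' : Measure K' := (S.bodyMeasure i').comap Subtype.val
  let D : Fin 3 → Phase n S.solids →L[ℝ] C(K × K', ℝ) := fun α =>
    LinearMap.toContinuousLinearMap
      { toFun := fun y => ⟨fun z => (S.place i z.1 y - S.place i' z.2 y) α, by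
          have h1 : Continuous fun z : K × K' => S.place i z.1 y :=
            (S.continuous_place i y).comp (continuous_subtype_val.comp continuous_fst)
          have h2 : Continuous fun z : K × K' => S.place i' z.2 y :=
            (S.continuous_place i' y).comp (continuous_subtype_val.comp continuous_snd)
          exact (PiLp.continuous_apply 2 _ α).comp (h1.sub h2)⟩
        map_add' := fun y y' => by ext z; simp; ring
        map_smul' := fun c y => by ext z; simp; ring }
  have hD : ∀ y (z : K × K'), √(∑ α, D α y z ^ 2) = ‖S.place i z.1 y - S.place i' z.2 y‖ := by
    intro y z
    rw [EuclideanSpace.norm_eq]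
    simp only [Real.norm_eq_abs, sq_abs]
    rfl
  have hpos : ∀ z, 0 < ∑ α, D α x z ^ 2 := by
    intro z
    have hne : S.place i z.1 x - S.place i' z.2 x ≠ 0 := sub_ne_zero.mpr fun he =>
      Set.disjoint_left.mp hsep (S.place_mem_support z.1.2 x)
        (he ▸ S.place_mem_support z.2.2 x)
    rw [← Real.sqrt_pos, hD]
    exact norm_pos_iff.mpr hne
  obtain ⟨hc, hi⟩ := contDiffAt_integral_inv_sqrt (μ.prod μ') D hpos
  refine hc.congr_of_eventuallyEq ?_
  filter_upwards [hi] with y hy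
  rw [integral_prod _ hy]
  simp only [hD, pairEnergy]
  have hsub : ∀ (j : Fin (n + 1)) (f : E3 → ℝ),
      ∫ z, f z ∂(S.bodyMeasure j) = ∫ z : (S.bodyMeasure j).support, f z
        ∂((S.bodyMeasure j).comap Subtype.val) := by
    intro j f
    rw [integral_subtype_comap Measure.isClosed_support.measurableSet,
      Measure.restrict_eq_self_of_ae_mem (s := (S.bodyMeasure j).support) Measure.support_mem_ae]
  rw [hsub i]
  simp only [hsub i']
  rfl

/-- The potential energy is a smooth function of the state away from contacts. -/
lemma contDiffAt_potential {x : Phase n S.solids}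
    (hsep : ∀ i i', i ≠ i' → Disjoint (S.spatialMass (toState x) i).support
      (S.spatialMass (toState x) i').support) :
    ContDiffAt ℝ (⊤ : ℕ∞) S.potential x := by
  have : S.potential = fun x =>
      -∑ i, ∑ i' ∈ Finset.Ioi i, S.gravConst * S.pairEnergy i i' x := funext S.potential_eq
  rw [this]
  refine ContDiffAt.neg (ContDiffAt.sum fun i _ => ContDiffAt.sum fun i' hi' => ?_)
  exact contDiffAt_const.mul (S.contDiffAt_pairEnergy (hsep i i' (Finset.mem_Ioi.mp hi').ne))

end GravSystem

end RigidBodies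
end

/-! ### Infinitesimal symmetries of the potential energy and of its gradient -/

noncomputable section
namespace RigidBodies

/-- The infinitesimal rotation `w × ·` acting on all the vectors of a state. -/
def rotGen {Λ : Type*} [Fintype Λ] (w : E3) : (Λ → E3) →L[ℝ] (Λ → E3) :=
  ContinuousLinearMap.pi fun l => (crossL w).comp (ContinuousLinearMap.proj l)

@[simp] lemma rotGen_apply {Λ : Type*} [Fintype Λ] (w : E3) (x : Λ → E3) (l : Λ) :
    rotGen w x l = cross w (x l) := rfl

lemma hasDerivAt_cross {u v : ℝ → E3} {u' v' : E3} {t : ℝ} (hu : HasDerivAt u u' t)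
    (hv : HasDerivAt v v' t) :
    HasDerivAt (fun s => cross (u s) (v s)) (cross (u t) v' + cross u' (v t)) t :=
  crossL.hasDerivAt_of_bilinear (fun _ => hu) (fun _ => hv)

/-- Partial gradients in terms of the Fréchet derivative. -/
lemma inner_gradient_update {Λ : Type*} [Fintype Λ] [DecidableEq Λ] {H : (Λ → E3) → ℝ}
    {H' : (Λ → E3) →L[ℝ] ℝ} {x : Λ → E3} (hH : HasFDerivAt H H' x) (l : Λ) (v : E3) :
    inner ℝ (gradient (fun v => H (Function.update x l v)) (x l)) v = H' (Pi.single l v) := by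
  have h1 : HasFDerivAt (fun v => H (Function.update x l v))
      (H'.comp (ContinuousLinearMap.pi (Pi.single l (ContinuousLinearMap.id ℝ E3)))) (x l) := by
    have h2 := hasFDerivAt_update x (i := l) (x l) (𝕜 := ℝ) (E := fun _ => E3)
    rw [← Function.update_eq_self l x] at hH
    exact hH.comp (x l) h2
  rw [gradient, InnerProductSpace.toDual_symm_apply, h1.fderiv]
  simp only [ContinuousLinearMap.comp_apply]
  congr 1
  funext l'
  by_cases h : l' = l
  · subst h; simp
  · simp [h]

namespace GravSystem

open Filter Topology

variable {n : ℕ} (S : GravSystem n)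

/-- States where the potential energy is smooth. -/
def IsSmoothAt (x : Phase n S.solids) : Prop := ContDiffAt ℝ 2 S.potential x

section Potential

variable {S} {x : Phase n S.solids}

lemma IsSmoothAt.differentiableAt (hx : S.IsSmoothAt x) : DifferentiableAt ℝ S.potential x :=
  ContDiffAt.differentiableAt hx (by simp)

lemma IsSmoothAt.eventually (hx : S.IsSmoothAt x) : ∀ᶠ y in 𝓝 x, S.IsSmoothAt y := by
  exact ContDiffAt.eventually hx (by simp)

lemma IsSmoothAt.add_shift (hx : S.IsSmoothAt x) {d : Phase n S.solids} {v : E3}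
    (hd : IsShift d v) : S.IsSmoothAt (x + d) := by
  have h : S.potential = fun y => S.potential (y + -d) := by
    funext y
    have := S.potential_add_shift (y + -d) hd
    rw [← this]; congr 1; abel
  rw [IsSmoothAt, h]
  have hx' : ContDiffAt ℝ 2 S.potential (x + d + -d) := by
    rw [add_neg_cancel_right]; exact hx
  exact ContDiffAt.comp (g := S.potential) (x + d) hx' (contDiffAt_id.add contDiffAt_const)

lemma fderiv_potential_add_shift {d : Phase n S.solids} {v : E3} (hd : IsShift d v) :
    fderiv ℝ S.potential (x + d) = fderiv ℝ S.potential x := by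
  have h : (fun y => S.potential (y + d)) = S.potential :=
    funext fun y => S.potential_add_shift y hd
  rw [← fderiv_comp_add_right, h]

lemma _root_.RigidBodies.IsShift.smul {d : Phase n S.solids} {v : E3} (hd : IsShift d v) (c : ℝ) :
    IsShift (c • d) (c • v) :=
  ⟨fun i => by simp [hd.pos], fun j a => by simp [hd.ax]⟩

lemma IsSmoothAt.fderiv_shift (hx : S.IsSmoothAt x) {d : Phase n S.solids} {v : E3}
    (hd : IsShift d v) : fderiv ℝ S.potential x d = 0 := by
  have h1 : HasDerivAt (fun s : ℝ => x + s • d) d 0 := by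
    simpa using ((hasDerivAt_id (0 : ℝ)).smul_const d).const_add x
  have h2 : HasFDerivAt S.potential (fderiv ℝ S.potential x) (x + (0 : ℝ) • d) := by
    simpa using hx.differentiableAt.hasFDerivAt
  have h3 := h2.comp_hasDerivAt (0 : ℝ) h1
  have h4 : (S.potential ∘ fun s : ℝ => x + s • d) = fun _ => S.potential x :=
    funext fun s => S.potential_add_shift x (hd.smul s)
  rw [h4] at h3
  exact h3.unique (hasDerivAt_const _ _)

lemma IsSmoothAt.fderiv_rotGen (hx : S.IsSmoothAt x) (w : E3) :
    fderiv ℝ S.potential x (rotGen w x) = 0 := by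
  -- Rodrigues' formula is an isometry only for a unit axis; other axes follow by scaling.
  have unit : ∀ k : E3, ‖k‖ = 1 → fderiv ℝ S.potential x (rotGen k x) = 0 := by
    intro k hk
    have h1 : HasDerivAt (fun θ : ℝ => fun l => axisRotation k θ (x l)) (rotGen k x) 0 :=
      hasDerivAt_pi.mpr fun l => hasDerivAt_axisRotation_zero k (x l)
    have h2 : HasFDerivAt S.potential (fderiv ℝ S.potential x)
        (fun l => axisRotation k 0 (x l)) := by
      simpa [axisRotation_zero] using hx.differentiableAt.hasFDerivAt
    have h3 := h2.comp_hasDerivAt (0 : ℝ) h1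
    have h4 : (S.potential ∘ fun θ : ℝ => fun l => axisRotation k θ (x l))
        = fun _ => S.potential x := funext fun θ => S.potential_axisRotation hk θ x
    rw [h4] at h3
    exact h3.unique (hasDerivAt_const _ _)
  by_cases hw : w = 0
  · have : rotGen w x = 0 := by funext l; simp [hw]
    rw [this, map_zero]
  · have h : rotGen w x = ‖w‖ • rotGen (‖w‖⁻¹ • w) x := by
      funext l
      simp only [rotGen_apply, Pi.smul_apply, cross_smul_left, smul_smul]
      rw [mul_inv_cancel₀ (norm_ne_zero_iff.mpr hw), one_smul]
    rw [h, map_smul, unit _ (by rw [norm_smul, norm_inv, norm_norm, inv_mul_cancel₀ (norm_ne_zero_iff.mpr hw)]),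
      smul_zero]

end Potential

/-- The gradient of the potential energy with respect to one of the vectors. -/
def gradPotential (x : Phase n S.solids) (l : Slot n S.solids) : E3 :=
  (InnerProductSpace.toDual ℝ E3).symm
    ((fderiv ℝ S.potential x).comp (ContinuousLinearMap.single ℝ (fun _ => E3) l))

lemma inner_gradPotential (x : Phase n S.solids) (l : Slot n S.solids) (v : E3) :
    inner ℝ (S.gradPotential x l) v = fderiv ℝ S.potential x (Pi.single l v) := by
  rw [gradPotential, InnerProductSpace.toDual_symm_apply]; rfl

section GradPotential

variable {S} {x : Phase n S.solids}

lemma fderiv_potential_eq_sum (δ : Phase n S.solids) :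
    fderiv ℝ S.potential x δ = ∑ l, inner ℝ (S.gradPotential x l) (δ l) := by
  conv_lhs => rw [show δ = ∑ l, Pi.single l (δ l) from (Finset.univ_sum_single δ).symm]
  simp only [map_sum, inner_gradPotential]

lemma IsSmoothAt.gradPotential_mom (hx : S.IsSmoothAt x) (i : Fin (n + 1)) :
    S.gradPotential x (slotMom i) = 0 := by
  refine ext_inner_right ℝ fun v => ?_
  rw [inner_gradPotential, hx.fderiv_shift (v := 0) ⟨fun i => by simp, fun j a => by simp⟩,
    inner_zero_left]

lemma IsSmoothAt.gradPotential_spin (hx : S.IsSmoothAt x) (j : S.solids) :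
    S.gradPotential x (slotSpin j) = 0 := by
  refine ext_inner_right ℝ fun v => ?_
  rw [inner_gradPotential, hx.fderiv_shift (v := 0) ⟨fun i => by simp, fun j a => by simp⟩,
    inner_zero_left]

lemma IsSmoothAt.fderiv_apply (hx : S.IsSmoothAt x) (δ : Phase n S.solids) :
    fderiv ℝ S.potential x δ = ∑ i, inner ℝ (S.gradPotential x (slotPos i)) (δ (slotPos i))
      + ∑ j, ∑ a, inner ℝ (S.gradPotential x (slotAx j a)) (δ (slotAx j a)) := by
  rw [fderiv_potential_eq_sum]
  simp [Fintype.sum_sum_type, Fintype.sum_prod_type, hx.gradPotential_mom, hx.gradPotential_spin]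

/-- Translation invariance: the internal forces add up to zero. -/
lemma IsSmoothAt.sum_gradPotential_pos (hx : S.IsSmoothAt x) :
    ∑ i, S.gradPotential x (slotPos i) = 0 := by
  refine ext_inner_right ℝ fun v => ?_
  have hd : IsShift (Sum.elim (Sum.elim (fun _ => v) 0) 0 : Phase n S.solids) v :=
    ⟨fun i => rfl, fun j a => rfl⟩
  have := hx.fderiv_shift hd
  rw [hx.fderiv_apply] at this
  simpa [sum_inner] using this

/-- The total torque of the internal forces vanishes. -/
lemma IsSmoothAt.torque_eq_zero (hx : S.IsSmoothAt x) :
    ∑ i, cross (x (slotPos i)) (S.gradPotential x (slotPos i))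
      + ∑ j, ∑ a, cross (x (slotAx j a)) (S.gradPotential x (slotAx j a)) = 0 := by
  refine ext_inner_left ℝ fun w => ?_
  have := hx.fderiv_rotGen w
  rw [hx.fderiv_apply] at this
  simp only [rotGen_apply] at this
  rw [inner_zero_right, ← this]
  simp only [inner_add_right, inner_sum]
  congr 1
  · exact Finset.sum_congr rfl fun i _ => by rw [real_inner_comm (cross w _), inner_cross_left_comm]
  · exact Finset.sum_congr rfl fun j _ => Finset.sum_congr rfl fun i _ => by
      rw [real_inner_comm (cross w _), inner_cross_left_comm]

lemma gradPotential_add_shift {d : Phase n S.solids} {v : E3} (hd : IsShift d v)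
    (l : Slot n S.solids) : S.gradPotential (x + d) l = S.gradPotential x l := by
  rw [gradPotential, gradPotential, fderiv_potential_add_shift hd]

lemma IsSmoothAt.contDiffAt_fderiv (hx : S.IsSmoothAt x) :
    ContDiffAt ℝ 1 (fderiv ℝ S.potential) x :=
  ContDiffAt.fderiv_right (hx : ContDiffAt ℝ 2 S.potential x) (by norm_num)

lemma IsSmoothAt.contDiffAt_gradPotential (hx : S.IsSmoothAt x) (l : Slot n S.solids) :
    ContDiffAt ℝ 1 (fun y => S.gradPotential y l) x := by
  have h1 : ContDiffAt ℝ 1 (fun y => (fderiv ℝ S.potential y).comp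
      (ContinuousLinearMap.single ℝ (fun _ : Slot n S.solids => E3) l)) x :=
    hx.contDiffAt_fderiv.clm_comp contDiffAt_const
  exact ((InnerProductSpace.toDual ℝ E3).symm.toContinuousLinearEquiv.contDiff.contDiffAt).comp x h1

/-- Infinitesimal equivariance of the gradient of the potential energy. -/
lemma IsSmoothAt.fderiv_gradPotential_rotGen (hx : S.IsSmoothAt x) (w : E3)
    (l : Slot n S.solids) :
    fderiv ℝ (fun y => S.gradPotential y l) x (rotGen w x) = cross w (S.gradPotential x l) := by
  have hd : DifferentiableAt ℝ (fderiv ℝ S.potential) x :=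
    hx.contDiffAt_fderiv.differentiableAt (by simp)
  have hg : DifferentiableAt ℝ (fun y => S.gradPotential y l) x :=
    (hx.contDiffAt_gradPotential l).differentiableAt (by simp)
  have hsymm : IsSymmSndFDerivAt ℝ S.potential x :=
    ContDiffAt.isSymmSndFDerivAt hx (by simp)
  refine ext_inner_right ℝ fun v => ?_
  have e1 : inner ℝ (fderiv ℝ (fun y => S.gradPotential y l) x (rotGen w x)) v
      = fderiv ℝ (fderiv ℝ S.potential) x (rotGen w x) (Pi.single l v) := by
    have h1 : (fun y => inner ℝ (S.gradPotential y l) v)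
        = fun y => fderiv ℝ S.potential y (Pi.single l v) :=
      funext fun y => S.inner_gradPotential y l v
    have h2 : fderiv ℝ (fun y => inner ℝ (S.gradPotential y l) v) x (rotGen w x)
        = fderiv ℝ (fun y => fderiv ℝ S.potential y (Pi.single l v)) x (rotGen w x) := by rw [h1]
    rw [fderiv_inner_apply ℝ hg (differentiableAt_const v),
      fderiv_clm_apply hd (differentiableAt_const _)] at h2
    simpa using h2
  -- Differentiate the identity dV(y)(w × y) = 0, valid near `x`, in the direction `Pi.single l v`.
  -- Symmetry of the second derivative then turns this into `e1`.
  have e2 : fderiv ℝ (fderiv ℝ S.potential) x (Pi.single l v) (rotGen w x)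
      + fderiv ℝ S.potential x (rotGen w (Pi.single l v)) = 0 := by
    have h1 : (fun y => fderiv ℝ S.potential y (rotGen w y)) =ᶠ[𝓝 x] fun _ => 0 := by
      filter_upwards [hx.eventually] with y hy
      exact hy.fderiv_rotGen w
    have h2 : fderiv ℝ (fun y => fderiv ℝ S.potential y (rotGen w y)) x (Pi.single l v)
        = fderiv ℝ (fun _ => (0 : ℝ)) x (Pi.single l v) := by rw [h1.fderiv_eq]
    rw [fderiv_clm_apply hd (rotGen w).differentiableAt] at h2
    simp at h2
    rw [← h2]; ring
  have e3 : rotGen w (Pi.single l v : Phase n S.solids) = Pi.single l (cross w v) := by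
    funext l'
    by_cases h : l' = l
    · subst h; simp
    · simp [h]
  rw [e1, hsymm.eq, inner_cross_skew, inner_gradPotential, ← e3]
  linarith [e2]

end GradPotential

end GravSystem

end RigidBodies
end

noncomputable section
namespace RigidBodies
namespace GravSystem

open Filter Topology

variable {n : ℕ} (S : GravSystem n)

/-! ### The differential and the partial gradients of the Hamiltonian -/

section Energy

/-- The Hamiltonian as a function on the normed space of states. -/
def energy (x : Phase n S.solids) : ℝ := S.hamiltonian (toState x)

lemma energy_eq (x : Phase n S.solids) :
    S.energy x = ∑ i, inner ℝ (x (slotMom i)) (x (slotMom i)) / (2 * S.mass i)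
      + ∑ j, ∑ a, (inner ℝ (x (slotSpin j)) (x (slotAx j a))) ^ 2 / (2 * S.inertia j a)
      + S.potential x := by
  simp only [energy, hamiltonian, translationEnergy, rotationEnergy, Fin.sum_univ_three,
    real_inner_self_eq_norm_sq, potential]
  rfl

lemma inertia_ne_zero (j : S.solids) (a : Fin 3) : S.inertia j a ≠ 0 := (S.inertia_pos j a).ne'

/-- The differential of the Hamiltonian. -/
lemma exists_hasFDerivAt_energy {x : Phase n S.solids} (hx : S.IsSmoothAt x) :
    ∃ H' : Phase n S.solids →L[ℝ] ℝ, HasFDerivAt S.energy H' x ∧ ∀ δ,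
      H' δ = ∑ i, (S.mass i)⁻¹ * inner ℝ (x (slotMom i)) (δ (slotMom i))
        + ∑ j, ∑ a, inner ℝ (x (slotSpin j)) (x (slotAx j a)) / S.inertia j a *
          (inner ℝ (x (slotSpin j)) (δ (slotAx j a)) + inner ℝ (δ (slotSpin j)) (x (slotAx j a)))
        + fderiv ℝ S.potential x δ := by
  have hp : ∀ l : Slot n S.solids, HasFDerivAt (fun y : Phase n S.solids => y l)
      (ContinuousLinearMap.proj l) x := fun l =>
    (ContinuousLinearMap.proj l : Phase n S.solids →L[ℝ] E3).hasFDerivAt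
  have h1 : ∀ i ∈ Finset.univ, HasFDerivAt
      (fun y : Phase n S.solids => inner ℝ (y (slotMom i)) (y (slotMom i)) / (2 * S.mass i)) _ x :=
    fun i _ => ((hp (slotMom i)).inner ℝ (hp (slotMom i))).mul_const (2 * S.mass i)⁻¹
  have h2 : ∀ j ∈ Finset.univ, HasFDerivAt (fun y : Phase n S.solids =>
      ∑ a, (inner ℝ (y (slotSpin j)) (y (slotAx j a))) ^ 2 / (2 * S.inertia j a)) _ x :=
    fun j _ => HasFDerivAt.fun_sum fun a _ =>
      (((hp (slotSpin j)).inner ℝ (hp (slotAx j a))).pow 2).mul_const (2 * S.inertia j a)⁻¹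
  have h := ((HasFDerivAt.fun_sum h1).add (HasFDerivAt.fun_sum h2)).add
    hx.differentiableAt.hasFDerivAt
  refine ⟨_, h.congr_of_eventuallyEq (Eventually.of_forall S.energy_eq), fun δ => ?_⟩
  simp only [add_apply, sum_apply, smul_apply, ContinuousLinearMap.comp_apply,
    ContinuousLinearMap.prod_apply, fderivInnerCLM_apply, ContinuousLinearMap.proj_apply,
    smul_eq_mul]
  congr 2
  · refine Finset.sum_congr rfl fun i _ => ?_
    rw [real_inner_comm (x (slotMom i)) (δ (slotMom i))]
    have := (S.mass_pos i).ne'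
    field_simp
    ring
  · refine Finset.sum_congr rfl fun j _ => Finset.sum_congr rfl fun a _ => ?_
    have := S.inertia_ne_zero j a
    field_simp
    ring

/-- The angular velocity of a rigid body. -/
def angVel (x : Phase n S.solids) (j : S.solids) : E3 :=
  ∑ a, (inner ℝ (x (slotSpin j)) (x (slotAx j a)) / S.inertia j a) • x (slotAx j a)

/-- Common scheme for the six partial gradients: each one is reduced to recognising the updated
state and evaluating the differential on a single slot. -/
lemma gradient_energy_eq {Y : State n S.solids} (hY : S.IsSmoothAt (ofState Y))
    (l : Slot n S.solids) {φ : E3 → ℝ}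
    (hφ : ∀ v, φ v = S.energy (Function.update (ofState Y) l v)) {g p : E3}
    (hp : p = ofState Y l)
    (hg : ∀ v, inner ℝ g v = ∑ i, (S.mass i)⁻¹ *
        inner ℝ (Y.mom i) ((Pi.single l v : Phase n S.solids) (slotMom i))
        + ∑ j, ∑ a, inner ℝ (Y.spin j) (ofState Y (slotAx j a)) / S.inertia j a *
          (inner ℝ (Y.spin j) ((Pi.single l v : Phase n S.solids) (slotAx j a))
            + inner ℝ ((Pi.single l v : Phase n S.solids) (slotSpin j)) (ofState Y (slotAx j a)))
        + inner ℝ (S.gradPotential (ofState Y) l) v) :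
    gradient φ p = g := by
  obtain ⟨H', hH', hform⟩ := S.exists_hasFDerivAt_energy hY
  refine ext_inner_right ℝ fun v => ?_
  rw [funext hφ, hp, inner_gradient_update hH', hform, hg, inner_gradPotential]
  rfl

lemma gradMom_eq {Y : State n S.solids} (hY : S.IsSmoothAt (ofState Y)) (i : Fin (n + 1)) :
    S.gradMom Y i = (S.mass i)⁻¹ • Y.mom i := by
  refine S.gradient_energy_eq hY (slotMom i) (fun v => ?_) rfl fun v => ?_
  · rw [energy]
    congr 1
    simp only [toState, ofState, State.mk.injEq]
    refine ⟨?_, ?_, ?_, ?_, ?_, ?_⟩ <;> funext l <;> simp [Function.update_apply]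
  · rw [hY.gradPotential_mom]
    simp [Pi.single_apply, inner_smul_left, apply_ite]

lemma gradPos_eq {Y : State n S.solids} (hY : S.IsSmoothAt (ofState Y)) (i : Fin (n + 1)) :
    S.gradPos Y i = S.gradPotential (ofState Y) (slotPos i) := by
  refine S.gradient_energy_eq hY (slotPos i) (fun v => ?_) rfl fun v => ?_
  · rw [energy]
    congr 1
    simp only [toState, ofState, State.mk.injEq]
    refine ⟨?_, ?_, ?_, ?_, ?_, ?_⟩ <;> funext l <;> simp [Function.update_apply]
  · simp

lemma gradSpin_eq {Y : State n S.solids} (hY : S.IsSmoothAt (ofState Y)) (j : S.solids) :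
    S.gradSpin Y j = S.angVel (ofState Y) j := by
  refine S.gradient_energy_eq hY (slotSpin j) (fun v => ?_) rfl fun v => ?_
  · rw [energy]
    congr 1
    simp only [toState, ofState, State.mk.injEq]
    refine ⟨?_, ?_, ?_, ?_, ?_, ?_⟩ <;> funext l <;> simp [Function.update_apply]
  · rw [hY.gradPotential_spin, angVel]
    rw [Finset.sum_eq_single_of_mem (s := Finset.univ (α := S.solids)) j (Finset.mem_univ j)
      fun j' _ hj => by simp [hj]]
    simp [inner_smul_left, sum_inner, real_inner_comm]
    rfl

lemma gradAx_aux {Y : State n S.solids} (j : S.solids) (a : Fin 3) (v : E3) :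
    inner ℝ (S.gradPotential (ofState Y) (slotAx j a)
        + (inner ℝ (Y.spin j) (ofState Y (slotAx j a)) / S.inertia j a) • Y.spin j) v
      = ∑ i, (S.mass i)⁻¹ *
        inner ℝ (Y.mom i) ((Pi.single (slotAx j a) v : Phase n S.solids) (slotMom i))
        + ∑ j', ∑ b, inner ℝ (Y.spin j') (ofState Y (slotAx j' b)) / S.inertia j' b *
          (inner ℝ (Y.spin j') ((Pi.single (slotAx j a) v : Phase n S.solids) (slotAx j' b))
            + inner ℝ ((Pi.single (slotAx j a) v : Phase n S.solids) (slotSpin j'))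
              (ofState Y (slotAx j' b)))
        + inner ℝ (S.gradPotential (ofState Y) (slotAx j a)) v := by
  rw [Finset.sum_eq_single_of_mem (s := Finset.univ (α := S.solids)) j (Finset.mem_univ j)
      fun j' _ hj => by simp [hj],
    Finset.sum_eq_single_of_mem (s := Finset.univ (α := Fin 3)) a (Finset.mem_univ a)
      fun b _ hb => by simp [hb]]
  simp [inner_smul_left, inner_add_left, add_comm]

lemma gradAxI_eq {Y : State n S.solids} (hY : S.IsSmoothAt (ofState Y)) (j : S.solids) :
    S.gradAxI Y j = S.gradPotential (ofState Y) (slotAx j 0)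
      + (inner ℝ (Y.spin j) (Y.axI j) / S.inertia j 0) • Y.spin j := by
  refine S.gradient_energy_eq hY (slotAx j 0) (fun v => ?_) rfl (S.gradAx_aux j 0)
  rw [energy]
  congr 1
  simp only [toState, ofState, State.mk.injEq]
  refine ⟨?_, ?_, ?_, ?_, ?_, ?_⟩ <;> funext l <;> simp [Function.update_apply]

lemma gradAxJ_eq {Y : State n S.solids} (hY : S.IsSmoothAt (ofState Y)) (j : S.solids) :
    S.gradAxJ Y j = S.gradPotential (ofState Y) (slotAx j 1)
      + (inner ℝ (Y.spin j) (Y.axJ j) / S.inertia j 1) • Y.spin j := by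
  refine S.gradient_energy_eq hY (slotAx j 1) (fun v => ?_) rfl (S.gradAx_aux j 1)
  rw [energy]
  congr 1
  simp only [toState, ofState, State.mk.injEq]
  refine ⟨?_, ?_, ?_, ?_, ?_, ?_⟩ <;> funext l <;> simp [Function.update_apply]

lemma gradAxK_eq {Y : State n S.solids} (hY : S.IsSmoothAt (ofState Y)) (j : S.solids) :
    S.gradAxK Y j = S.gradPotential (ofState Y) (slotAx j 2)
      + (inner ℝ (Y.spin j) (Y.axK j) / S.inertia j 2) • Y.spin j := by
  refine S.gradient_energy_eq hY (slotAx j 2) (fun v => ?_) rfl (S.gradAx_aux j 2)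
  rw [energy]
  congr 1
  simp only [toState, ofState, State.mk.injEq]
  refine ⟨?_, ?_, ?_, ?_, ?_, ?_⟩ <;> funext l <;> simp [Function.update_apply]

end Energy

end GravSystem
end RigidBodies
end

noncomputable section
namespace RigidBodies
namespace GravSystem

open Filter Topology

variable {n : ℕ} (S : GravSystem n) (c : Fin (n + 1))

/-! ### Equations of motion in the frame centred on a body -/

section ReducedField

/-- The vectors of a state in the frame centred on body `c`. -/
def reduced (Y : State n S.solids) : Phase n S.solids :=
  Sum.elim (Sum.elim (S.relPos c Y) (S.relMom Y))
    (Sum.elim (fun p => ![Y.axI p.1, Y.axJ p.1, Y.axK p.1] p.2) Y.spin)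

/-- The slots of body `c` are kept in the reduced state, so centring is a shift inside the same
phase space; the change of momenta is harmless because the potential ignores them. -/
lemma exists_shift_reduced (Y : State n S.solids) :
    ∃ d : Phase n S.solids, IsShift d (-Y.pos c) ∧ S.reduced c Y = ofState Y + d := by
  refine ⟨S.reduced c Y - ofState Y, ⟨fun i => ?_, fun j a => ?_⟩, by abel⟩
  · simp [reduced, ofState, relPos]
  · simp [reduced, ofState]

variable {S} in
lemma Admissible.isSmoothAt {Y : State n S.solids} (hY : S.Admissible Y) :
    S.IsSmoothAt (ofState Y) :=
  (S.contDiffAt_potential (x := ofState Y) hY.separated).of_le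
    (show ((2 : ℕ∞) : WithTop ℕ∞) ≤ _ from WithTop.coe_le_coe.mpr le_top)

variable {S} in
lemma Admissible.isSmoothAt_reduced {Y : State n S.solids} (hY : S.Admissible Y) :
    S.IsSmoothAt (S.reduced c Y) := by
  obtain ⟨d, hd, h⟩ := S.exists_shift_reduced c Y
  rw [h]
  exact hY.isSmoothAt.add_shift hd

lemma gradPotential_reduced (Y : State n S.solids) (l : Slot n S.solids) :
    S.gradPotential (S.reduced c Y) l = S.gradPotential (ofState Y) l := by
  obtain ⟨d, hd, h⟩ := S.exists_shift_reduced c Y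
  rw [h, gradPotential_add_shift hd]

/-- The vector field of the equations of motion in the frame centred on body `c`. -/
def field (x : Phase n S.solids) : Phase n S.solids :=
  Sum.elim
    (Sum.elim
      (fun i => (S.mass i)⁻¹ • x (slotMom i) - (S.mass c)⁻¹ • x (slotMom c))
      (fun i => -S.gradPotential x (slotPos i)))
    (Sum.elim
      (fun p => cross (S.angVel x p.1) (x (slotAx p.1 p.2)))
      (fun j => ∑ a, cross (S.gradPotential x (slotAx j a)) (x (slotAx j a))))

@[simp] lemma field_pos (x : Phase n S.solids) (i : Fin (n + 1)) : S.field c x (slotPos i)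
    = (S.mass i)⁻¹ • x (slotMom i) - (S.mass c)⁻¹ • x (slotMom c) := rfl

@[simp] lemma field_mom (x : Phase n S.solids) (i : Fin (n + 1)) :
    S.field c x (slotMom i) = -S.gradPotential x (slotPos i) := rfl

@[simp] lemma field_ax (x : Phase n S.solids) (j : S.solids) (a : Fin 3) :
    S.field c x (slotAx j a) = cross (S.angVel x j) (x (slotAx j a)) := rfl

@[simp] lemma field_spin (x : Phase n S.solids) (j : S.solids) : S.field c x (slotSpin j)
    = ∑ a, cross (S.gradPotential x (slotAx j a)) (x (slotAx j a)) := rfl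

lemma totalMass_pos : 0 < ∑ l, S.mass l :=
  Finset.sum_pos (fun i _ => S.mass_pos i) Finset.univ_nonempty

/-- The equations of motion in the frame centred on body `c`. -/
lemma hasDerivAt_reduced {X : ℝ → State n S.solids} (hX : S.IsSolution X) (t : ℝ) :
    HasDerivAt (fun τ => S.reduced c (X τ)) (S.field c (S.reduced c (X t))) t := by
  have hs := (hX.admissible t).isSmoothAt
  have hpos : ∀ i, HasDerivAt (fun τ => (X τ).pos i) ((S.mass i)⁻¹ • (X t).mom i) t := fun i => by
    rw [← S.gradMom_eq hs i]; exact hX.deriv_pos t i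
  have hmom : ∀ i, HasDerivAt (fun τ => (X τ).mom i)
      (-S.gradPotential (ofState (X t)) (slotPos i)) t := fun i => by
    rw [← S.gradPos_eq hs i]; exact hX.deriv_mom t i
  have hang : ∀ j, S.gradSpin (X t) j = S.angVel (S.reduced c (X t)) j := S.gradSpin_eq hs
  rw [hasDerivAt_pi]
  rintro ((i | i) | (⟨j, a⟩ | j))
  · refine ((hpos i).sub (hpos c)).congr_deriv ?_
    simp only [field_pos, reduced, Sum.elim_inl, Sum.elim_inr, relMom, smul_sub, smul_smul]
    -- The barycentric correction changes all velocities by the same vector, so it cancels in the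
    -- difference.
    have h1 : ∀ i, (S.mass i)⁻¹ * (S.mass i / ∑ l, S.mass l) = (∑ l, S.mass l)⁻¹ := fun i => by
      have := (S.mass_pos i).ne'
      have := (S.totalMass_pos).ne'
      field_simp
    rw [h1, h1]
    abel
  · have hsum : HasDerivAt (fun τ => ∑ l, (X τ).mom l) 0 t := by
      have := HasDerivAt.fun_sum (u := Finset.univ) fun i _ => hmom i
      rwa [Finset.sum_neg_distrib, hs.sum_gradPotential_pos, neg_zero] at this
    refine ((hmom i).sub (hsum.const_smul (S.mass i / ∑ l, S.mass l))).congr_deriv ?_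
    rw [smul_zero, sub_zero, field_mom, gradPotential_reduced]
  · rw [field_ax, ← hang]
    fin_cases a
    · exact hX.deriv_axI t j
    · exact hX.deriv_axJ t j
    · exact hX.deriv_axK t j
  · refine (hX.deriv_spin t j).congr_deriv ?_
    rw [field_spin, S.gradAxI_eq hs, S.gradAxJ_eq hs, S.gradAxK_eq hs, S.gradSpin_eq hs]
    simp only [gradPotential_reduced, Fin.sum_univ_three, angVel, cross_add_left, cross_smul_left]
    -- The terms of the axis gradients proportional to the spin cancel the product of angular
    -- velocity and spin; only the torque of the potential remains.
    rw [cross_anticomm _ ((X t).spin j), cross_anticomm _ ((X t).spin j),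
      cross_anticomm _ ((X t).spin j)]
    simp only [reduced, ofState, Sum.elim_inl, Sum.elim_inr, Matrix.cons_val_zero,
      Matrix.cons_val_one, Matrix.cons_val]
    module

variable {S} {x : Phase n S.solids}

lemma contDiff_angVel (j : S.solids) : ContDiff ℝ 1 fun x => S.angVel x j := by
  have hp : ∀ l : Slot n S.solids, ContDiff ℝ 1 fun y : Phase n S.solids => y l :=
    fun l => by fun_prop
  exact ContDiff.sum fun a _ => (((hp _).inner ℝ (hp _)).div_const _).smul (hp _)

lemma contDiffAt_cross {E : Type*} [NormedAddCommGroup E] [NormedSpace ℝ E] {u v : E → E3} {x : E}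
    (hu : ContDiffAt ℝ 1 u x) (hv : ContDiffAt ℝ 1 v x) :
    ContDiffAt ℝ 1 (fun y => cross (u y) (v y)) x :=
  ContDiffAt.comp (g := fun p : E3 × E3 => crossL p.1 p.2) x
    crossL.isBoundedBilinearMap.contDiff.contDiffAt (hu.prodMk hv)

lemma IsSmoothAt.contDiffAt_field (hx : S.IsSmoothAt x) : ContDiffAt ℝ 1 (S.field c) x := by
  have hp : ∀ l : Slot n S.solids, ContDiffAt ℝ 1 (fun y : Phase n S.solids => y l) x :=
    fun l => by fun_prop
  rw [contDiffAt_pi]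
  rintro ((i | i) | (⟨j, a⟩ | j))
  · exact ((hp _).const_smul _).sub ((hp _).const_smul _)
  · exact (hx.contDiffAt_gradPotential _).neg
  · exact contDiffAt_cross (contDiff_angVel j).contDiffAt (hp _)
  · exact ContDiffAt.sum (s := Finset.univ) fun a _ =>
      contDiffAt_cross (hx.contDiffAt_gradPotential (slotAx j a)) (hp (slotAx j a))

/-- Infinitesimal equivariance of the equations of motion under rotations. -/
lemma IsSmoothAt.fderiv_field_rotGen (hx : S.IsSmoothAt x) (w : E3) :
    fderiv ℝ (S.field c) x (rotGen w x) = rotGen w (S.field c x) := by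
  have hline : HasDerivAt (fun s : ℝ => x + s • rotGen w x) (rotGen w x) 0 := by
    simpa using ((hasDerivAt_id (0 : ℝ)).smul_const (rotGen w x)).const_add x
  have hline0 : x + (0 : ℝ) • rotGen w x = x := by simp
  have hp : ∀ l, HasDerivAt (fun s : ℝ => (x + s • rotGen w x) l) (cross w (x l)) 0 :=
    fun l => hasDerivAt_pi.mp hline l
  have hg : ∀ l, HasDerivAt (fun s : ℝ => S.gradPotential (x + s • rotGen w x) l)
      (cross w (S.gradPotential x l)) 0 := fun l => by
    have h1 : HasFDerivAt (fun y => S.gradPotential y l)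
        (fderiv ℝ (fun y => S.gradPotential y l) x) (x + (0 : ℝ) • rotGen w x) := by
      rw [hline0]
      exact ((hx.contDiffAt_gradPotential l).differentiableAt (by simp)).hasFDerivAt
    have := h1.comp_hasDerivAt (0 : ℝ) hline
    rwa [hx.fderiv_gradPotential_rotGen] at this
  have hang : ∀ j, HasDerivAt (fun s : ℝ => S.angVel (x + s • rotGen w x) j)
      (cross w (S.angVel x j)) 0 := fun j => by
    have h1 : ∀ a ∈ Finset.univ, HasDerivAt (fun s : ℝ =>
        (inner ℝ ((x + s • rotGen w x) (slotSpin j)) ((x + s • rotGen w x) (slotAx j a)) /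
          S.inertia j a) • (x + s • rotGen w x) (slotAx j a))
        (cross w ((inner ℝ (x (slotSpin j)) (x (slotAx j a)) / S.inertia j a) •
          x (slotAx j a))) 0 := fun a _ => by
      have h2 := (((hp (slotSpin j)).inner ℝ (hp (slotAx j a))).div_const (S.inertia j a)).smul
        (hp (slotAx j a))
      refine h2.congr_deriv ?_
      simp only [hline0]
      rw [inner_cross_skew, add_neg_cancel, zero_div, zero_smul, add_zero, cross_smul_right]
    have := HasDerivAt.fun_sum h1
    rw [← cross_sum_right] at this
    exact this
  -- Each component of the field is built by vector products from equivariant vectors, and Jacobi's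
  -- identity makes `w × ·` a derivation of that product.
  have key : HasDerivAt (fun s : ℝ => S.field c (x + s • rotGen w x))
      (rotGen w (S.field c x)) 0 := by
    rw [hasDerivAt_pi]
    rintro ((i | i) | (⟨j, a⟩ | j))
    · refine (((hp (slotMom i)).const_smul (S.mass i)⁻¹).sub
        ((hp (slotMom c)).const_smul (S.mass c)⁻¹)).congr_deriv ?_
      rw [rotGen_apply, field_pos, cross_sub_right, cross_smul_right, cross_smul_right]
    · refine (hg (slotPos i)).neg.congr_deriv ?_
      rw [rotGen_apply, field_mom, cross_neg_right]
    · refine (hasDerivAt_cross (hang j) (hp (slotAx j a))).congr_deriv ?_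
      rw [rotGen_apply, field_ax, hline0, cross_jacobi w, add_comm]
    · refine (HasDerivAt.fun_sum (u := Finset.univ) fun a _ =>
        hasDerivAt_cross (hg (slotAx j a)) (hp (slotAx j a))).congr_deriv ?_
      rw [rotGen_apply, field_spin, hline0, cross_sum_right]
      exact Finset.sum_congr rfl fun a _ => by rw [cross_jacobi w, add_comm]
  have h1 : HasFDerivAt (S.field c) (fderiv ℝ (S.field c) x) (x + (0 : ℝ) • rotGen w x) := by
    rw [hline0]
    exact ((hx.contDiffAt_field c).differentiableAt (by simp)).hasFDerivAt
  exact HasDerivAt.unique (f := S.field c ∘ fun s : ℝ => x + s • rotGen w x)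
    (h1.comp_hasDerivAt (0 : ℝ) hline) key

end ReducedField

/-! ### Symplectic form, angular momentum and Hamiltonian character of the equations -/

section Symplectic

/-- The orbital and rotational constraints satisfied by reduced states. -/
structure IsConstrained (x : Phase n S.solids) : Prop where
  pos : x (slotPos c) = 0
  mom : ∑ i, x (slotMom i) = 0
  frame : ∀ j, Orthonormal ℝ fun a => x (slotAx j a)

/-- `δ` is a variation of the constrained state `x` that turns the rigid body `j` by the
infinitesimal rotation vector `a j`. -/
structure IsVariation (x δ : Phase n S.solids) (a : S.solids → E3) : Prop where
  pos : δ (slotPos c) = 0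
  mom : ∑ i, δ (slotMom i) = 0
  ax : ∀ j b, δ (slotAx j b) = cross (a j) (x (slotAx j b))

variable {S}

lemma Admissible.isConstrained_reduced {Y : State n S.solids} (hY : S.Admissible Y) :
    S.IsConstrained c (S.reduced c Y) where
  pos := by simp [reduced, relPos]
  mom := by
    simp only [reduced, Sum.elim_inl, Sum.elim_inr, relMom, Finset.sum_sub_distrib,
      ← Finset.sum_smul, ← Finset.sum_div]
    rw [div_self (S.totalMass_pos).ne', one_smul, sub_self]
  frame j := by
    have := orthonormal_of_direct (hY.norm_axI j) (hY.norm_axJ j) (hY.orthogonal j)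
    rw [← hY.direct j] at this
    exact this

lemma isVariation_rotGen {x : Phase n S.solids} (hx : S.IsConstrained c x) (w : E3) :
    S.IsVariation c x (rotGen w x) fun _ => w where
  pos := by rw [rotGen_apply, hx.pos, cross_zero_right]
  mom := by simp only [rotGen_apply, ← cross_sum_right, hx.mom, cross_zero_right]
  ax j b := rfl

lemma isVariation_field {x : Phase n S.solids} (hs : S.IsSmoothAt x) :
    S.IsVariation c x (S.field c x) (S.angVel x) where
  pos := by simp
  mom := by simp only [field_mom, Finset.sum_neg_distrib, hs.sum_gradPotential_pos, neg_zero]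
  ax j b := rfl

lemma IsVariation.add {x δ δ' : Phase n S.solids} {a a' : S.solids → E3}
    (h : S.IsVariation c x δ a) (h' : S.IsVariation c x δ' a') :
    S.IsVariation c x (δ + δ') (a + a') where
  pos := by simp [h.pos, h'.pos]
  mom := by simp [Finset.sum_add_distrib, h.mom, h'.mom]
  ax j b := by simp [h.ax, h'.ax, cross_add_left]

/-- The canonical one-form. -/
def liouville (x δ : Phase n S.solids) : ℝ :=
  ∑ i, inner ℝ (x (slotMom i)) (δ (slotPos i))
    + ∑ j, ∑ a, 2⁻¹ * inner ℝ (cross (x (slotSpin j)) (x (slotAx j a))) (δ (slotAx j a))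

/-- The derivative of the canonical one-form in the direction `ξ`. -/
def dLiouville (x ξ δ : Phase n S.solids) : ℝ :=
  ∑ i, inner ℝ (ξ (slotMom i)) (δ (slotPos i))
    + ∑ j, ∑ a, 2⁻¹ * inner ℝ (cross (x (slotSpin j)) (ξ (slotAx j a))
        + cross (ξ (slotSpin j)) (x (slotAx j a))) (δ (slotAx j a))

/-- The symplectic form. -/
def symplectic (x ξ δ : Phase n S.solids) : ℝ := dLiouville x ξ δ - dLiouville x δ ξ

lemma symplectic_self (x ξ : Phase n S.solids) : symplectic x ξ ξ = 0 := sub_self _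

lemma symplectic_antisymm (x ξ δ : Phase n S.solids) : symplectic x ξ δ = -symplectic x δ ξ :=
  (neg_sub _ _).symm

lemma symplectic_add_left (x ξ ξ' δ : Phase n S.solids) :
    symplectic x (ξ + ξ') δ = symplectic x ξ δ + symplectic x ξ' δ := by
  simp only [symplectic, dLiouville, Pi.add_apply, inner_add_left, inner_add_right, cross_add_left,
    cross_add_right, mul_add, Finset.sum_add_distrib]
  ring

variable {c}

/-- The symplectic form on variations of constrained states. -/
lemma symplectic_eq {x ξ δ : Phase n S.solids} {a b : S.solids → E3} (hx : S.IsConstrained c x)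
    (hξ : S.IsVariation c x ξ a) (hδ : S.IsVariation c x δ b) :
    symplectic x ξ δ
      = ∑ i, (inner ℝ (ξ (slotMom i)) (δ (slotPos i)) - inner ℝ (δ (slotMom i)) (ξ (slotPos i)))
        + ∑ j, (inner ℝ (ξ (slotSpin j)) (b j) - inner ℝ (δ (slotSpin j)) (a j)
          + inner ℝ (x (slotSpin j)) (cross (a j) (b j))) := by
  -- The factor 2⁻¹ undoes the 2 of `sum_inner_cross_frame`. The remaining half of G · (a × b) is
  -- antisymmetric in a and b, so the difference defining the symplectic form doubles it.
  have e1 : ∀ (ξ δ : Phase n S.solids) (a b : S.solids → E3) (_ : S.IsVariation c x ξ a)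
      (_ : S.IsVariation c x δ b) (j : S.solids),
      ∑ α, 2⁻¹ * inner ℝ (cross (x (slotSpin j)) (ξ (slotAx j α))
        + cross (ξ (slotSpin j)) (x (slotAx j α))) (δ (slotAx j α))
      = 2⁻¹ * inner ℝ (x (slotSpin j)) (cross (a j) (b j)) + inner ℝ (ξ (slotSpin j)) (b j) := by
    intro ξ δ a b hξ hδ j
    rw [← Finset.mul_sum]
    simp only [hξ.ax, hδ.ax, inner_add_left, Finset.sum_add_distrib,
      sum_inner_cross_frame (hx.frame j)]
    simp only [inner_cross_left_comm (x (slotSpin j)), ← inner_sum,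
      sum_cross_cross_frame (hx.frame j)]
    ring
  simp only [symplectic, dLiouville, e1 ξ δ a b hξ hδ, e1 δ ξ b a hδ hξ]
  simp only [Finset.sum_sub_distrib, Finset.sum_add_distrib, cross_anticomm (b _) (a _),
    inner_neg_right, mul_neg, Finset.sum_neg_distrib, ← Finset.mul_sum]
  ring

/-- The total angular momentum of a reduced state. -/
def angMom (x : Phase n S.solids) : E3 :=
  ∑ i, cross (x (slotPos i)) (x (slotMom i)) + ∑ j, x (slotSpin j)

/-- The differential of the angular momentum. -/
def dAngMom (x δ : Phase n S.solids) : E3 :=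
  ∑ i, (cross (x (slotPos i)) (δ (slotMom i)) + cross (δ (slotPos i)) (x (slotMom i)))
    + ∑ j, δ (slotSpin j)

lemma hasDerivAt_angMom {x : ℝ → Phase n S.solids} {x' : Phase n S.solids} {t : ℝ}
    (h : HasDerivAt x x' t) : HasDerivAt (fun s => angMom (x s)) (dAngMom (x t) x') t := by
  have hp := hasDerivAt_pi.mp h
  exact (HasDerivAt.fun_sum fun i _ => hasDerivAt_cross (hp (slotPos i)) (hp (slotMom i))).add
    (HasDerivAt.fun_sum fun j _ => hp (slotSpin j))

lemma dAngMom_rotGen (x : Phase n S.solids) (w : E3) : dAngMom x (rotGen w x) = cross w (angMom x) := by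
  simp only [dAngMom, angMom, rotGen_apply, cross_add_right, cross_sum_right, cross_jacobi w]
  congr 1
  exact Finset.sum_congr rfl fun i _ => add_comm _ _

/-- Rotations are generated by the angular momentum. -/
lemma symplectic_rotGen {x δ : Phase n S.solids} {b : S.solids → E3} (hx : S.IsConstrained c x)
    (hδ : S.IsVariation c x δ b) (w : E3) :
    symplectic x (rotGen w x) δ = -inner ℝ w (dAngMom x δ) := by
  rw [symplectic_eq hx (isVariation_rotGen c hx w) hδ, dAngMom, inner_add_right, inner_sum,
    inner_sum, neg_add, ← Finset.sum_neg_distrib, ← Finset.sum_neg_distrib]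
  congr 1
  · refine Finset.sum_congr rfl fun i _ => ?_
    simp only [rotGen_apply, inner_add_right]
    rw [real_inner_comm (cross w (x (slotPos i))), inner_cross_left_comm, inner_cross_left_comm,
      cross_anticomm (δ (slotPos i)), inner_neg_right]
    ring
  · refine Finset.sum_congr rfl fun j _ => ?_
    rw [rotGen_apply, inner_cross_skew, real_inner_comm w (δ (slotSpin j))]
    ring

/-- The motion of the centre contributes a multiple of p_c × Σ p_i, which vanishes for barycentric
momenta; the rest is the total internal torque. -/
lemma dAngMom_field {x : Phase n S.solids} (hx : S.IsConstrained c x) (hs : S.IsSmoothAt x) :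
    dAngMom x (S.field c x) = 0 := by
  have ht := hs.torque_eq_zero
  have h1 : ∀ i, cross (x (slotPos i)) (S.field c x (slotMom i))
      + cross (S.field c x (slotPos i)) (x (slotMom i))
      = -cross (x (slotPos i)) (S.gradPotential x (slotPos i))
        - (S.mass c)⁻¹ • cross (x (slotMom c)) (x (slotMom i)) := fun i => by
    rw [field_mom, field_pos, cross_neg_right, cross_sub_left, cross_smul_left, cross_smul_left,
      cross_self, smul_zero, zero_sub, sub_eq_add_neg]
  have h2 : ∀ j, S.field c x (slotSpin j)
      = -∑ a, cross (x (slotAx j a)) (S.gradPotential x (slotAx j a)) := fun j => by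
    rw [field_spin, ← Finset.sum_neg_distrib]
    exact Finset.sum_congr rfl fun a _ => cross_anticomm _ _
  simp only [dAngMom, h1, h2, Finset.sum_sub_distrib, ← Finset.smul_sum, ← cross_sum_right, hx.mom,
    cross_zero_right, smul_zero, sub_zero, Finset.sum_neg_distrib]
  rw [← neg_add, ht, neg_zero]

/-- The equations of motion are Hamiltonian. -/
lemma fderiv_energy_eq {x δ : Phase n S.solids} {b : S.solids → E3} (hx : S.IsConstrained c x)
    (hs : S.IsSmoothAt x) (hδ : S.IsVariation c x δ b) :
    fderiv ℝ S.energy x δ = -symplectic x (S.field c x) δ := by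
  obtain ⟨H', hH', hform⟩ := S.exists_hasFDerivAt_energy hs
  rw [hH'.fderiv, hform, hs.fderiv_apply, symplectic_eq hx (isVariation_field c hs) hδ]
  have h1 : ∑ i, (inner ℝ (S.field c x (slotMom i)) (δ (slotPos i))
      - inner ℝ (δ (slotMom i)) (S.field c x (slotPos i)))
      = -∑ i, inner ℝ (S.gradPotential x (slotPos i)) (δ (slotPos i))
        - ∑ i, (S.mass i)⁻¹ * inner ℝ (x (slotMom i)) (δ (slotMom i)) := by
    -- The velocity of the centre pairs with Σ δp_i, which is zero for variations that respect the
    -- constraints.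
    have h2 : ∑ i, (S.mass c)⁻¹ * inner ℝ (δ (slotMom i)) (x (slotMom c)) = 0 := by
      rw [← Finset.mul_sum, ← sum_inner, hδ.mom, inner_zero_left, mul_zero]
    simp only [field_mom, field_pos, inner_neg_left, inner_sub_right, Finset.sum_sub_distrib,
      Finset.sum_neg_distrib, inner_smul_right, h2, sub_zero]
    congr 1
    exact Finset.sum_congr rfl fun i _ => by rw [real_inner_comm]
  have h3 : ∀ j, inner ℝ (S.field c x (slotSpin j)) (b j)
        - inner ℝ (δ (slotSpin j)) (S.angVel x j)
        + inner ℝ (x (slotSpin j)) (cross (S.angVel x j) (b j))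
      = -∑ a, inner ℝ (S.gradPotential x (slotAx j a)) (δ (slotAx j a))
        - ∑ a, inner ℝ (x (slotSpin j)) (x (slotAx j a)) / S.inertia j a *
          (inner ℝ (x (slotSpin j)) (δ (slotAx j a))
            + inner ℝ (δ (slotSpin j)) (x (slotAx j a))) := fun j => by
    have h4 : ∀ a, inner ℝ (cross (S.gradPotential x (slotAx j a)) (x (slotAx j a))) (b j)
        = -inner ℝ (S.gradPotential x (slotAx j a)) (δ (slotAx j a)) := fun a => by
      rw [hδ.ax, inner_cross_left_comm, cross_anticomm (b j), inner_neg_right, neg_neg]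
    simp only [field_spin, sum_inner, h4, Finset.sum_neg_distrib, angVel, inner_sum,
      cross_sum_left, cross_smul_left, inner_smul_right, mul_add, Finset.sum_add_distrib]
    simp only [hδ.ax, cross_anticomm (b j), inner_neg_right, mul_neg, Finset.sum_neg_distrib]
    ring
  rw [h1, Finset.sum_congr rfl fun j _ => h3 j]
  simp only [Finset.sum_sub_distrib, Finset.sum_neg_distrib]
  ring

end Symplectic

end GravSystem
end RigidBodies
end

noncomputable section
namespace RigidBodies

/-! ### Dimension of isotropic subspaces, abstractly -/

section Isotropic

open Module

/-- Isotropic families of vectors in a symplectic vector space `M × M` have at most half the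
dimension. -/
lemma finrank_le_of_isotropic {V M W : Type*} [AddCommGroup V] [Module ℝ V] [FiniteDimensional ℝ V]
    [NormedAddCommGroup M] [InnerProductSpace ℝ M] [FiniteDimensional ℝ M]
    [AddCommGroup W] [Module ℝ W] [FiniteDimensional ℝ W]
    (f g : V →ₗ[ℝ] M) (χ : V →ₗ[ℝ] W) (h : ∀ u u', inner ℝ (g u) (f u') = inner ℝ (g u') (f u))
    (hinj : ∀ u, f u = 0 → g u = 0 → χ u = 0 → u = 0) :
    finrank ℝ V ≤ finrank ℝ M + finrank ℝ W := by
  -- Isotropy sends the kernel of `f` through `g` into the orthogonal complement of the range of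
  -- `f`; rank-nullity then gives the bound. The map `χ` pays for whatever `f` and `g` together fail
  -- to detect.
  have hker : ∀ u : LinearMap.ker f, g u ∈ (LinearMap.range f)ᗮ := by
    intro u
    rw [Submodule.mem_orthogonal']
    rintro _ ⟨u', rfl⟩
    rw [h, show f u = 0 from u.2, inner_zero_right]
  let G : LinearMap.ker f →ₗ[ℝ] (LinearMap.range f)ᗮ × W :=
    ((g ∘ₗ (LinearMap.ker f).subtype).codRestrict _ hker).prod (χ ∘ₗ (LinearMap.ker f).subtype)
  have hG : Function.Injective G := by
    rw [← LinearMap.ker_eq_bot, LinearMap.ker_eq_bot']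
    intro u hu
    have h1 : g u = 0 := congrArg Subtype.val (congrArg Prod.fst hu)
    have h2 : χ u = 0 := congrArg Prod.snd hu
    exact Subtype.ext (hinj u u.2 h1 h2)
  have h1 := LinearMap.finrank_le_finrank_of_injective hG
  have h2 := f.finrank_range_add_finrank_ker
  have h3 := (LinearMap.range f).finrank_add_finrank_orthogonal
  rw [finrank_prod] at h1
  omega

end Isotropic

namespace GravSystem

variable {n : ℕ} {S : GravSystem n} {c : Fin (n + 1)}

/-! ### Canonical coordinates and the bound on isotropic families of variations -/

section Dimension

open Module

/-- The index set of the degrees of freedom of the reduced system, three for each index. -/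
abbrev Freedom (S : GravSystem n) (c : Fin (n + 1)) : Type := {i // i ≠ c} ⊕ S.solids

lemma finrank_freedom :
    finrank ℝ (PiLp 2 fun _ : S.Freedom c => E3) = 3 * (n + S.solids.card) := by
  rw [(WithLp.linearEquiv 2 ℝ (S.Freedom c → E3)).finrank_eq, finrank_pi_fintype]
  simp [Fintype.card_subtype_compl]
  ring

/-- Displacements of a variation, in canonical coordinates. -/
def displacement (x : Phase n S.solids) :
    Phase n S.solids →ₗ[ℝ] PiLp 2 fun _ : S.Freedom c => E3 where
  toFun δ := WithLp.toLp 2 (Sum.elim (fun i => δ (slotPos i.1))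
    fun j => (2⁻¹ : ℝ) • ∑ a, cross (x (slotAx j a)) (δ (slotAx j a)))
  map_add' δ δ' := by
    ext l : 1
    rcases l with i | j
    · simp
    · simp [cross_add_right, Finset.sum_add_distrib]
  map_smul' r δ := by
    ext l : 1
    rcases l with i | j
    · simp
    · simp only [Pi.smul_apply, cross_smul_right, ← Finset.smul_sum]
      simp [smul_comm r]

/-- Momenta of a variation, in canonical coordinates. -/
def impulse (x : Phase n S.solids) :
    Phase n S.solids →ₗ[ℝ] PiLp 2 fun _ : S.Freedom c => E3 where
  toFun δ := WithLp.toLp 2 (Sum.elim (fun i => δ (slotMom i.1))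
    -- The added half of G × b splits the term G · (a × b) evenly between the two momenta, so that
    -- the symplectic form becomes the canonical one.
    fun j => δ (slotSpin j) + (2⁻¹ : ℝ) • cross (x (slotSpin j))
      ((2⁻¹ : ℝ) • ∑ a, cross (x (slotAx j a)) (δ (slotAx j a))))
  map_add' δ δ' := by
    ext l : 1
    rcases l with i | j
    · simp
    · simp only [Pi.add_apply, cross_add_right, Finset.sum_add_distrib, smul_add, Sum.elim_inr,
        PiLp.add_apply]
      abel
  map_smul' r δ := by
    ext l : 1
    rcases l with i | j
    · simp
    · simp only [Pi.smul_apply, cross_smul_right, ← Finset.smul_sum, Sum.elim_inr,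
        PiLp.smul_apply, RingHom.id_apply, smul_add]
      module

lemma IsVariation.rotation_eq {x δ : Phase n S.solids} {b : S.solids → E3}
    (hx : S.IsConstrained c x) (hδ : S.IsVariation c x δ b) (j : S.solids) :
    (2⁻¹ : ℝ) • ∑ a, cross (x (slotAx j a)) (δ (slotAx j a)) = b j := by
  simp only [hδ.ax]
  rw [sum_cross_self_cross_frame (hx.frame j), smul_smul]
  norm_num

lemma symplectic_eq_canonical {x ξ δ : Phase n S.solids} {a b : S.solids → E3}
    (hx : S.IsConstrained c x) (hξ : S.IsVariation c x ξ a) (hδ : S.IsVariation c x δ b) :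
    symplectic x ξ δ = inner ℝ (impulse (c := c) x ξ) (displacement x δ)
      - inner ℝ (impulse (c := c) x δ) (displacement x ξ) := by
  have hin : ∀ u v : PiLp 2 fun _ : S.Freedom c => E3,
      inner ℝ u v = ∑ l, inner ℝ (u l) (v l) := fun u v => PiLp.inner_apply u v
  rw [symplectic_eq hx hξ hδ]
  simp only [hin, impulse, displacement, LinearMap.coe_mk, AddHom.coe_mk,
    Fintype.sum_sum_type, Sum.elim_inl, Sum.elim_inr, hξ.rotation_eq hx, hδ.rotation_eq hx]
  have h1 : ∀ (φ : Fin (n + 1) → ℝ), φ c = 0 → ∑ i, φ i = ∑ i : {i // i ≠ c}, φ i := by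
    intro φ h0
    rw [← Finset.sum_erase Finset.univ h0]
    exact Finset.sum_subtype _ (fun i => by simp) φ
  rw [h1 (fun i => inner ℝ (ξ (slotMom i)) (δ (slotPos i))
    - inner ℝ (δ (slotMom i)) (ξ (slotPos i))) (by rw [hξ.pos, hδ.pos]; simp)]
  simp only [inner_add_left, inner_smul_left, Finset.sum_add_distrib, Finset.sum_sub_distrib,
    RCLike.conj_to_real]
  have h2 : ∀ j, inner ℝ (x (slotSpin j)) (cross (a j) (b j))
      = 2⁻¹ * inner ℝ (cross (x (slotSpin j)) (a j)) (b j)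
        - 2⁻¹ * inner ℝ (cross (x (slotSpin j)) (b j)) (a j) := fun j => by
    rw [inner_cross_left_comm, inner_cross_left_comm, cross_anticomm (b j), inner_neg_right]; ring
  simp only [h2, Finset.sum_sub_distrib]
  ring

/-- Displacements and impulses are coordinates on the constrained variations: the slots of body `c`
follow from the constraints, and the axes from the rotation vectors. -/
lemma IsVariation.eq_zero {x δ : Phase n S.solids} {b : S.solids → E3}
    (hx : S.IsConstrained c x) (hδ : S.IsVariation c x δ b) (h1 : displacement (c := c) x δ = 0)
    (h2 : impulse (c := c) x δ = 0) : δ = 0 := by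
  have hb : ∀ j, b j = 0 := fun j => by
    have := congrArg (fun v : PiLp 2 fun _ : S.Freedom c => E3 => v (.inr j)) h1
    rw [← hδ.rotation_eq hx j]
    simpa [displacement] using this
  have hp : ∀ i, i ≠ c → δ (slotPos i) = 0 := fun i hi => by
    have := congrArg (fun v : PiLp 2 fun _ : S.Freedom c => E3 => v (.inl ⟨i, hi⟩)) h1
    simpa [displacement] using this
  have hm : ∀ i, i ≠ c → δ (slotMom i) = 0 := fun i hi => by
    have := congrArg (fun v : PiLp 2 fun _ : S.Freedom c => E3 => v (.inl ⟨i, hi⟩)) h2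
    simpa [impulse] using this
  funext l
  rcases l with (i | i) | (⟨j, a⟩ | j)
  · by_cases hi : i = c
    · subst hi; exact hδ.pos
    · exact hp i hi
  · by_cases hi : i = c
    · subst hi
      have := hδ.mom
      rwa [Finset.sum_eq_single_of_mem i (Finset.mem_univ i) fun i' _ h => hm i' h] at this
    · exact hm i hi
  · rw [hδ.ax j a, hb j, cross_zero_left]; rfl
  · have := congrArg (fun v : PiLp 2 fun _ : S.Freedom c => E3 => v (.inr j)) h2
    simp only [impulse, LinearMap.coe_mk, AddHom.coe_mk, Sum.elim_inr, hδ.rotation_eq hx, hb j,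
      cross_zero_right, smul_zero, add_zero] at this
    exact this

/-- Isotropic families of variations have at most as many dimensions as there are degrees of
freedom. -/
lemma finrank_le_of_symplectic_eq_zero {V W : Type*} [AddCommGroup V] [Module ℝ V]
    [FiniteDimensional ℝ V] [AddCommGroup W] [Module ℝ W] [FiniteDimensional ℝ W]
    {x : Phase n S.solids} (hx : S.IsConstrained c x) (L : V →ₗ[ℝ] Phase n S.solids)
    (hL : ∀ u, ∃ b, S.IsVariation c x (L u) b) (h : ∀ u u', symplectic x (L u) (L u') = 0)
    (χ : V →ₗ[ℝ] W) (hinj : ∀ u, L u = 0 → χ u = 0 → u = 0) :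
    finrank ℝ V ≤ 3 * (n + S.solids.card) + finrank ℝ W := by
  rw [← finrank_freedom (S := S) (c := c)]
  refine finrank_le_of_isotropic (displacement (c := c) x ∘ₗ L) (impulse (c := c) x ∘ₗ L) χ
    (fun u u' => ?_) fun u h1 h2 h3 => ?_
  · obtain ⟨b, hb⟩ := hL u
    obtain ⟨b', hb'⟩ := hL u'
    have := h u u'
    rw [symplectic_eq_canonical hx hb hb'] at this
    exact sub_eq_zero.mp this
  · obtain ⟨b, hb⟩ := hL u
    exact hinj u (hb.eq_zero hx h1 h2) h3

end Dimension

end GravSystem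
end RigidBodies
end

noncomputable section
namespace RigidBodies
namespace GravSystem

open Filter Topology

variable {n : ℕ} {S : GravSystem n} {c : Fin (n + 1)} {m : ℕ}

/-! ### Invariant tori: isotropy and linearised flow -/

section TorusSolution

lemma continuous_cross {E : Type*} [TopologicalSpace E] {u v : E → E3} (hu : Continuous u)
    (hv : Continuous v) : Continuous fun y => cross (u y) (v y) :=
  crossL.continuous₂.comp (hu.prodMk hv)

lemma contDiff_cross {E : Type*} [NormedAddCommGroup E] [NormedSpace ℝ E] {u v : E → E3}
    {k : WithTop ℕ∞} (hu : ContDiff ℝ k u) (hv : ContDiff ℝ k v) :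
    ContDiff ℝ k fun y => cross (u y) (v y) :=
  ContDiff.comp (g := fun p : E3 × E3 => crossL p.1 p.2) crossL.isBoundedBilinearMap.contDiff
    (hu.prodMk hv)

lemma hasDerivAt_smul_frequency (ω : Fin m → ℝ) (t : ℝ) :
    HasDerivAt (fun t : ℝ => t • ω) ω t := by
  simpa using (hasDerivAt_id t).smul_const ω

/-- A solution that winds densely on a torus, on which it extends smoothly. -/
structure IsTorusSolution (ω : Fin m → ℝ) (F : (Fin m → ℝ) → Phase n S.solids)
    (X : ℝ → State n S.solids) : Prop where
  indep : LinearIndependent ℚ ω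
  smooth : ContDiff ℝ (⊤ : ℕ∞) F
  periodic : IsTorusPeriodic F
  orbit : ∀ t : ℝ, F (t • ω) = S.reduced c (X t)
  solution : S.IsSolution X

namespace IsTorusSolution

variable {ω : Fin m → ℝ} {F : (Fin m → ℝ) → Phase n S.solids} {X : ℝ → State n S.solids}
  (h : IsTorusSolution (c := c) ω F X)
include h

lemma smooth_of_nat (k : ℕ) : ContDiff ℝ k F :=
  h.smooth.of_le (show (((k : ℕ∞) : WithTop ℕ∞)) ≤ _ from WithTop.coe_le_coe.mpr le_top)

lemma hasFDerivAt (θ : Fin m → ℝ) : HasFDerivAt F (fderiv ℝ F θ) θ :=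
  (h.smooth.differentiable (by simp) θ).hasFDerivAt

lemma contDiff_dir (k : ℕ) (v : Fin m → ℝ) : ContDiff ℝ k fun θ => fderiv ℝ F θ v :=
  ((h.smooth_of_nat (k + 1)).fderiv_right (m := k) (by norm_cast)).clm_apply contDiff_const

lemma hasDerivAt_line (θ v : Fin m → ℝ) :
    HasDerivAt (fun s : ℝ => F (θ + s • v)) (fderiv ℝ F θ v) 0 := by
  have h1 : HasDerivAt (fun s : ℝ => θ + s • v) v 0 := by
    simpa using ((hasDerivAt_id (0 : ℝ)).smul_const v).const_add θ
  have h2 : HasFDerivAt F (fderiv ℝ F θ) (θ + (0 : ℝ) • v) := by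
    simpa using h.hasFDerivAt θ
  exact h2.comp_hasDerivAt (0 : ℝ) h1

/-- Closed conditions on reduced states extend from the orbit to the torus. -/
lemma eq_on_torus {Y : Type*} [TopologicalSpace Y] [T2Space Y] {f : (Fin m → ℝ) → Y} {y : Y}
    (hf : Continuous f) (hp : IsTorusPeriodic f) (ho : ∀ t : ℝ, f (t • ω) = y) (θ : Fin m → ℝ) :
    f θ = y :=
  congrFun (hp.eq_of_eq_on_orbit (fun _ _ => rfl) hf continuous_const h.indep ho) θ

lemma isSmoothAt (t : ℝ) : S.IsSmoothAt (F (t • ω)) := by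
  rw [h.orbit]; exact (h.solution.admissible t).isSmoothAt_reduced c

lemma periodic_comp {Y : Type*} (f : Phase n S.solids → Y) : IsTorusPeriodic fun θ => f (F θ) :=
  fun θ k => congrArg f (h.periodic θ k)

lemma isConstrained (θ : Fin m → ℝ) : S.IsConstrained c (F θ) := by
  have hcont := h.smooth.continuous
  have hl : ∀ l, Continuous fun θ => F θ l := fun l => (continuous_apply l).comp hcont
  have ho : ∀ t : ℝ, S.IsConstrained c (F (t • ω)) := fun t => by
    rw [h.orbit]; exact (h.solution.admissible t).isConstrained_reduced c
  refine ⟨?_, ?_, fun j => ?_⟩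
  · exact h.eq_on_torus (hl (slotPos c)) (h.periodic_comp fun x => x (slotPos c))
      (fun t => (ho t).pos) θ
  · exact h.eq_on_torus (continuous_finsetSum _ fun i _ => hl (slotMom i))
      (h.periodic_comp fun x => ∑ i, x (slotMom i)) (fun t => (ho t).mom) θ
  · rw [orthonormal_iff_ite]
    intro a b
    exact h.eq_on_torus ((hl (slotAx j a)).inner (hl (slotAx j b)))
      (h.periodic_comp fun x => inner ℝ (x (slotAx j a)) (x (slotAx j b)))
      (fun t => orthonormal_iff_ite.mp ((ho t).frame j) a b) θ

/-- The constraints hold on the whole torus, so they can be differentiated in any direction; for the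
frames this gives a rotation vector by `variation_frame_eq_cross`. -/
lemma exists_isVariation (θ v : Fin m → ℝ) :
    ∃ b, S.IsVariation c (F θ) (fderiv ℝ F θ v) b := by
  have hl := hasDerivAt_pi.mp (h.hasDerivAt_line θ v)
  have h0 : θ + (0 : ℝ) • v = θ := by simp
  refine ⟨fun j => (1 / 2 : ℝ) • ∑ a, cross (F θ (slotAx j a)) (fderiv ℝ F θ v (slotAx j a)),
    ?_, ?_, fun j b => ?_⟩
  · refine (hl (slotPos c)).unique ?_
    simp only [(h.isConstrained _).pos]
    exact hasDerivAt_const _ _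
  · refine (HasDerivAt.fun_sum fun i _ => hl (slotMom i)).unique ?_
    simp only [(h.isConstrained _).mom]
    exact hasDerivAt_const _ _
  · refine variation_frame_eq_cross ((h.isConstrained θ).frame j)
      (D := fun a => fderiv ℝ F θ v (slotAx j a)) (fun a b => ?_) b
    have h1 := (hl (slotAx j a)).inner ℝ (hl (slotAx j b))
    have h2 : ∀ s : ℝ, inner ℝ (F (θ + s • v) (slotAx j a)) (F (θ + s • v) (slotAx j b))
        = if a = b then (1 : ℝ) else 0 := fun s =>
      orthonormal_iff_ite.mp ((h.isConstrained _).frame j) a b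
    simp only [h2, h0] at h1
    rw [add_comm]
    exact h1.unique (hasDerivAt_const _ _)

lemma hasDerivAt_orbit (t : ℝ) :
    HasDerivAt (fun t : ℝ => F (t • ω)) (S.field c (F (t • ω))) t := by
  simp only [h.orbit]
  exact S.hasDerivAt_reduced c h.solution t

lemma fderiv_orbit (t : ℝ) : fderiv ℝ F (t • ω) ω = S.field c (F (t • ω)) :=
  ((h.hasFDerivAt (t • ω)).comp_hasDerivAt t (hasDerivAt_smul_frequency ω t)).unique
    (h.hasDerivAt_orbit t)

lemma energy_orbit (t : ℝ) : S.energy (F (t • ω)) = S.energy (F 0) := by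
  have hd : ∀ t : ℝ, HasDerivAt (fun t : ℝ => S.energy (F (t • ω))) 0 t := fun t => by
    obtain ⟨H', hH', -⟩ := S.exists_hasFDerivAt_energy (h.isSmoothAt t)
    have h1 := hH'.comp_hasDerivAt t (h.hasDerivAt_orbit t)
    rw [← hH'.fderiv, fderiv_energy_eq (h.isConstrained _) (h.isSmoothAt t)
      (isVariation_field c (h.isSmoothAt t)), symplectic_self, neg_zero] at h1
    exact h1
  have := is_const_of_deriv_eq_zero (fun t => (hd t).differentiableAt) (fun t => (hd t).deriv) t 0
  simpa using this

/-- The energy is constant on the dense lifted orbit, but the closure of the orbit may contain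
contacts. So its differential is taken only at points of the orbit, where `fderiv_eq_zero_of_dense`
suffices. -/
lemma symplectic_field_orbit (t : ℝ) (v : Fin m → ℝ) :
    symplectic (F (t • ω)) (fderiv ℝ F (t • ω) ω) (fderiv ℝ F (t • ω) v) = 0 := by
  obtain ⟨H', hH', -⟩ := S.exists_hasFDerivAt_energy (h.isSmoothAt t)
  have h1 := hH'.comp (t • ω) (h.hasFDerivAt (t • ω))
  have h2 := fderiv_eq_zero_of_dense (dense_liftedOrbit h.indep) (c := S.energy (F 0))
    (fun θ hθ => by
      obtain ⟨s, hs⟩ := (h.periodic_comp S.energy).eq_of_mem_liftedOrbit hθ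
      rw [Function.comp, hs, h.energy_orbit]) (smul_mem_liftedOrbit ω t) h1
  have h3 : H' (fderiv ℝ F (t • ω) v) = 0 := congrArg (fun L => L v) h2
  obtain ⟨b, hb⟩ := h.exists_isVariation (t • ω) v
  rw [← hH'.fderiv, fderiv_energy_eq (h.isConstrained _) (h.isSmoothAt t) hb] at h3
  rw [h.fderiv_orbit]
  linarith

/-- The symplectic form does not involve the potential, so the relation passes to the closure even
where the potential is singular. -/
lemma symplectic_flow (θ v : Fin m → ℝ) :
    symplectic (F θ) (fderiv ℝ F θ ω) (fderiv ℝ F θ v) = 0 := by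
  have hF : ∀ l, Continuous fun θ => F θ l := fun l => (continuous_apply l).comp h.smooth.continuous
  have hD : ∀ v l, Continuous fun θ => fderiv ℝ F θ v l := fun v l =>
    (continuous_apply l).comp (h.contDiff_dir 0 v).continuous
  refine h.eq_on_torus (f := fun θ => symplectic (F θ) (fderiv ℝ F θ ω) (fderiv ℝ F θ v)) ?_ ?_
    (fun t => h.symplectic_field_orbit t v) θ
  · have : ∀ u v, Continuous fun θ => dLiouville (F θ) (fderiv ℝ F θ u) (fderiv ℝ F θ v) :=
      fun u v => by
        refine (continuous_finsetSum _ fun i _ => (hD u _).inner (hD v _)).add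
          (continuous_finsetSum _ fun j _ => continuous_finsetSum _ fun a _ =>
            continuous_const.mul (((continuous_cross (hF _) (hD u _)).add
              (continuous_cross (hD u _) (hF _))).inner (hD v _)))
    exact (this ω v).sub (this v ω)
  · intro θ k
    have h1 := h.periodic θ k
    have h2 := h.periodic.fderiv_apply ω θ k
    have h3 := h.periodic.fderiv_apply v θ k
    simp only at h2 h3 ⊢
    rw [h1, h2, h3]

lemma contDiff_liouville (v : Fin m → ℝ) :
    ContDiff ℝ 2 fun θ => liouville (F θ) (fderiv ℝ F θ v) := by
  have hF : ∀ l, ContDiff ℝ 2 fun θ => F θ l := fun l => contDiff_pi.mp (h.smooth_of_nat 2) l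
  have hD : ∀ l, ContDiff ℝ 2 fun θ => fderiv ℝ F θ v l := fun l =>
    contDiff_pi.mp (h.contDiff_dir 2 v) l
  exact (ContDiff.sum fun i _ => (hF _).inner ℝ (hD _)).add
    (ContDiff.sum fun j _ => ContDiff.sum fun a _ =>
      contDiff_const.mul ((contDiff_cross (hF _) (hF _)).inner ℝ (hD _)))

lemma periodic_liouville (v : Fin m → ℝ) :
    IsTorusPeriodic fun θ => liouville (F θ) (fderiv ℝ F θ v) := fun θ k => by
  have h1 := h.periodic θ k
  have h3 := h.periodic.fderiv_apply v θ k
  simp only at h3 ⊢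
  rw [h1, h3]

lemma fderiv_liouville (θ u v : Fin m → ℝ) :
    fderiv ℝ (fun θ => liouville (F θ) (fderiv ℝ F θ v)) θ u
      = dLiouville (F θ) (fderiv ℝ F θ u) (fderiv ℝ F θ v)
        + liouville (F θ) (fderiv ℝ (fun θ => fderiv ℝ F θ v) θ u) := by
  have h0 : θ + (0 : ℝ) • u = θ := by simp
  have hline : HasDerivAt (fun s : ℝ => θ + s • u) u 0 := by
    simpa using ((hasDerivAt_id (0 : ℝ)).smul_const u).const_add θ
  have hF := hasDerivAt_pi.mp (h.hasDerivAt_line θ u)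
  have hD : HasDerivAt (fun s : ℝ => fderiv ℝ F (θ + s • u) v)
      (fderiv ℝ (fun θ => fderiv ℝ F θ v) θ u) 0 := by
    have h2 : HasFDerivAt (fun θ => fderiv ℝ F θ v) (fderiv ℝ (fun θ => fderiv ℝ F θ v) θ)
        (θ + (0 : ℝ) • u) := by
      rw [h0]
      exact ((h.contDiff_dir 1 v).differentiable (by simp) θ).hasFDerivAt
    exact h2.comp_hasDerivAt (0 : ℝ) hline
  have hD := hasDerivAt_pi.mp hD
  have h1 : HasFDerivAt (fun θ => liouville (F θ) (fderiv ℝ F θ v))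
      (fderiv ℝ (fun θ => liouville (F θ) (fderiv ℝ F θ v)) θ) (θ + (0 : ℝ) • u) := by
    rw [h0]
    exact ((h.contDiff_liouville v).differentiable (by simp) θ).hasFDerivAt
  refine (h1.comp_hasDerivAt (0 : ℝ) hline).unique ?_
  have h2 := (HasDerivAt.fun_sum (u := Finset.univ) fun i _ =>
    (hF (slotMom i)).inner ℝ (hD (slotPos i))).add
    (HasDerivAt.fun_sum (u := Finset.univ) fun j _ => HasDerivAt.fun_sum (u := Finset.univ) fun a _ =>
      ((hasDerivAt_cross (hF (slotSpin j)) (hF (slotAx j a))).inner ℝ (hD (slotAx j a))).const_mul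
        (2⁻¹ : ℝ))
  refine h2.congr_deriv ?_
  simp only [h0, dLiouville, liouville, Finset.sum_add_distrib, mul_add]
  ring

/-- The torus is isotropic. -/
lemma symplectic_eq_zero (θ u v : Fin m → ℝ) :
    symplectic (F θ) (fderiv ℝ F θ u) (fderiv ℝ F θ v) = 0 := by
  -- Cartan's formula for the differential of the pulled-back one-form: on constant, hence
  -- commuting, vector fields the mixed second derivatives of `F` cancel.
  have key : ∀ θ u v, symplectic (F θ) (fderiv ℝ F θ u) (fderiv ℝ F θ v)
      = fderiv ℝ (fun θ => liouville (F θ) (fderiv ℝ F θ v)) θ u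
        - fderiv ℝ (fun θ => liouville (F θ) (fderiv ℝ F θ u)) θ v := fun θ u v => by
    rw [h.fderiv_liouville, h.fderiv_liouville, fderiv_fderiv_comm (h.smooth_of_nat 2) θ v u,
      symplectic]
    ring
  have hω : ∀ v θ, fderiv ℝ (fun θ => liouville (F θ) (fderiv ℝ F θ v)) θ ω
      = fderiv ℝ (fun θ => liouville (F θ) (fderiv ℝ F θ ω)) θ v := fun v θ => by
    rw [← sub_eq_zero, ← key]
    exact h.symplectic_flow θ v
  rw [key, sub_eq_zero]
  exact closed_of_contraction_eq_zero (h.contDiff_liouville u) (h.contDiff_liouville v)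
    (h.contDiff_liouville ω) (h.periodic_liouville u) (h.periodic_liouville v) h.indep (hω v)
    (hω u) θ

/-- The angular momentum is constant on the torus. -/
lemma angMom_eq (θ : Fin m → ℝ) : angMom (F θ) = angMom (F 0) := by
  have hF : ∀ l, Continuous fun θ => F θ l := fun l => (continuous_apply l).comp h.smooth.continuous
  refine h.eq_on_torus (f := fun θ => angMom (F θ)) ?_ (h.periodic_comp angMom) (fun t => ?_) θ
  · exact (continuous_finsetSum _ fun i _ => continuous_cross (hF _) (hF _)).add
      (continuous_finsetSum _ fun j _ => hF _)
  · have hd : ∀ t : ℝ, HasDerivAt (fun t : ℝ => angMom (F (t • ω))) 0 t := fun t => by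
      have := hasDerivAt_angMom (h.hasDerivAt_orbit t)
      rwa [dAngMom_field (h.isConstrained _) (h.isSmoothAt t)] at this
    have := is_const_of_deriv_eq_zero (fun t => (hd t).differentiableAt) (fun t => (hd t).deriv)
      t 0
    simpa using this

lemma dAngMom_eq_zero (θ v : Fin m → ℝ) : dAngMom (F θ) (fderiv ℝ F θ v) = 0 := by
  have h1 := hasDerivAt_angMom (h.hasDerivAt_line θ v)
  simp only [h.angMom_eq (θ + _), zero_smul, add_zero] at h1
  exact h1.unique (hasDerivAt_const _ _)

/-- The equation of motion is extended from the orbit to a neighbourhood in the torus, so that it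
can be differentiated transversally. -/
lemma eventually_fderiv_eq_field (t : ℝ) :
    (fun θ => fderiv ℝ F θ ω) =ᶠ[𝓝 (t • ω)] fun θ => S.field c (F θ) := by
  have hev : ∀ᶠ θ in 𝓝 (t • ω), S.IsSmoothAt (F θ) :=
    h.smooth.continuous.continuousAt.eventually (h.isSmoothAt t).eventually
  obtain ⟨U, hU, hUo, hmem⟩ := eventually_nhds_iff.mp hev
  have heq : Set.EqOn (fun θ => fderiv ℝ F θ ω) (fun θ => S.field c (F θ))
      (U ∩ liftedOrbit ω) := by
    rintro θ ⟨-, hθ⟩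
    have hp : IsTorusPeriodic fun θ => (fderiv ℝ F θ ω, S.field c (F θ)) := fun θ k =>
      Prod.ext (h.periodic.fderiv_apply ω θ k) (congrArg (S.field c) (h.periodic θ k))
    obtain ⟨s, hs⟩ := hp.eq_of_mem_liftedOrbit hθ
    have h1 := congrArg Prod.fst hs
    have h2 := congrArg Prod.snd hs
    simp only at h1 h2 ⊢
    rw [h1, h2, h.fderiv_orbit]
  have hall := heq.of_subset_closure (t := U) (h.contDiff_dir 0 ω).continuous.continuousOn
    (fun θ hθ => (((hU θ hθ).contDiffAt_field c).continuousAt.comp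
      h.smooth.continuous.continuousAt).continuousWithinAt) Set.inter_subset_left
    ((dense_liftedOrbit h.indep).open_subset_closure_inter hUo)
  filter_upwards [hUo.mem_nhds hmem] with θ hθ
  exact hall hθ

/-- Infinitesimal symmetries that vanish at one point of the orbit vanish along the orbit. -/
lemma fderiv_add_rotGen_eq_zero {v : Fin m → ℝ} {w : E3}
    (h0 : fderiv ℝ F 0 v + rotGen w (F 0) = 0) (t : ℝ) :
    fderiv ℝ F (t • ω) v + rotGen w (F (t • ω)) = 0 := by
  -- Both dF v and `w × F` solve the linearised equations along the orbit: the former because second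
  -- derivatives commute, the latter by equivariance of the field.
  refine eq_zero_of_linear_ode (A := fun t => fderiv ℝ (S.field c) (F (t • ω)))
    (ξ := fun t : ℝ => fderiv ℝ F (t • ω) v + rotGen w (F (t • ω))) ?_ (fun t => ?_)
    (by simpa using h0) t
  · rw [continuous_iff_continuousAt]
    intro t
    have h1 : ContinuousAt (fderiv ℝ (S.field c)) (F (t • ω)) :=
      ((((h.isSmoothAt t).contDiffAt_field c)).fderiv_right (m := 0) (by simp)).continuousAt
    exact ContinuousAt.comp (f := fun t : ℝ => F (t • ω)) h1
      (h.hasDerivAt_orbit t).continuousAt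
  · have hfd : HasFDerivAt (S.field c) (fderiv ℝ (S.field c) (F (t • ω))) (F (t • ω)) :=
      (((h.isSmoothAt t).contDiffAt_field c).differentiableAt (by simp)).hasFDerivAt
    have h1 : HasDerivAt (fun t : ℝ => fderiv ℝ F (t • ω) v)
        (fderiv ℝ (fun θ => fderiv ℝ F θ v) (t • ω) ω) t := by
      have hd : HasFDerivAt (fun θ => fderiv ℝ F θ v) _ (t • ω) :=
        ((h.contDiff_dir 1 v).differentiable (by simp) (t • ω)).hasFDerivAt
      exact hd.comp_hasDerivAt t (hasDerivAt_smul_frequency ω t)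
    have h2 : fderiv ℝ (fun θ => fderiv ℝ F θ v) (t • ω) ω
        = fderiv ℝ (S.field c) (F (t • ω)) (fderiv ℝ F (t • ω) v) := by
      rw [fderiv_fderiv_comm (h.smooth_of_nat 2), (h.eventually_fderiv_eq_field t).fderiv_eq]
      have := hfd.comp (t • ω) (h.hasFDerivAt (t • ω))
      exact congrArg (fun L => L v) this.fderiv
    have h3 : HasDerivAt (fun t : ℝ => rotGen w (F (t • ω)))
        (rotGen w (S.field c (F (t • ω)))) t :=
      (rotGen w).hasFDerivAt.comp_hasDerivAt t (h.hasDerivAt_orbit t)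
    refine (h1.add h3).congr_deriv ?_
    rw [map_add, h2, (h.isSmoothAt t).fderiv_field_rotGen]

end IsTorusSolution

end TorusSolution

end GravSystem
end RigidBodies
end

noncomputable section
namespace RigidBodies

/-! ### Operations on quasiperiodic functions -/

section Quasiperiodic

open Complex

lemma isQuasiperiodic_zero {m : ℕ} (ω : Fin m → ℝ) : IsQuasiperiodic ω fun _ => 0 :=
  ⟨0, fun p α => by simp, fun t α => by simp⟩

lemma IsQuasiperiodic.add {m : ℕ} {ω : Fin m → ℝ} {Z Z' : ℝ → E3} (h : IsQuasiperiodic ω Z)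
    (h' : IsQuasiperiodic ω Z') : IsQuasiperiodic ω fun t => Z t + Z' t := by
  obtain ⟨a, ha, hs⟩ := h
  obtain ⟨a', ha', hs'⟩ := h'
  refine ⟨fun k α => a k α + a' k α, fun p α => ?_, fun t α => ?_⟩
  · exact FastDecay.add (fun p => ha p α) (fun p => ha' p α) p
  · simpa [add_mul] using (hs t α).add (hs' t α)

lemma IsQuasiperiodic.neg {m : ℕ} {ω : Fin m → ℝ} {Z : ℝ → E3} (h : IsQuasiperiodic ω Z) :
    IsQuasiperiodic ω fun t => -Z t := by
  obtain ⟨a, ha, hs⟩ := h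
  refine ⟨fun k α => -a k α, fun p α => by simpa using ha p α, fun t α => ?_⟩
  simpa [neg_mul] using (hs t α).neg

lemma IsQuasiperiodic.sum {m : ℕ} {ω : Fin m → ℝ} {ι : Type*} (s : Finset ι) {Z : ι → ℝ → E3}
    (h : ∀ i ∈ s, IsQuasiperiodic ω (Z i)) : IsQuasiperiodic ω fun t => ∑ i ∈ s, Z i t := by
  classical
  induction s using Finset.induction_on with
  | empty => simpa using isQuasiperiodic_zero ω
  | insert i s hi ih =>
    simp only [Finset.sum_insert hi]
    exact (h i (Finset.mem_insert_self i s)).add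
      (ih fun i' hi' => h i' (Finset.mem_insert_of_mem hi'))

/-- A family of quasiperiodic series can be written on any larger number of frequencies. -/
lemma exists_padding {r N : ℕ} (hrN : r ≤ N) {ω : Fin r → ℝ} (hω : LinearIndependent ℚ ω) :
    ∃ ν : Fin N → ℝ, LinearIndependent ℚ ν ∧
      ∀ {J : Type} (κ : J → Fin r → ℤ) (a : J → Fin 3 → ℂ) (Z : ℝ → E3),
        (∀ (p : ℕ) (α : Fin 3), Summable fun j => (∑ l, |(κ j l : ℝ)|) ^ p * ‖a j α‖) →
        (∀ (t : ℝ) (α : Fin 3), HasSum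
          (fun j => a j α * cexp (I * (((∑ l, κ j l * ω l) * t : ℝ) : ℂ))) ((Z t α : ℝ) : ℂ)) →
        IsQuasiperiodic ν Z := by
  obtain ⟨ν, hν, hext⟩ := exists_linearIndependent_extension hrN hω
  refine ⟨ν, hν, fun {J} κ a Z ha hZ => ?_⟩
  have hinj : Function.Injective (Fin.castLE hrN) := Fin.castLE_injective hrN
  -- Modes are extended by zero on the added frequencies, which changes neither sizes nor phases.
  let κ' : J → Fin N → ℤ := fun j => Function.extend (Fin.castLE hrN) (κ j) 0
  have hκ : ∀ j l, κ' j (Fin.castLE hrN l) = κ j l := fun j l => hinj.extend_apply _ _ _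
  have hκ0 : ∀ j i, i ∉ Set.range (Fin.castLE hrN) → κ' j i = 0 := fun j i hi =>
    Function.extend_apply' _ _ _ hi
  have h1 : ∀ j, ∑ i, |(κ' j i : ℝ)| = ∑ l, |(κ j l : ℝ)| := fun j =>
    (Fintype.sum_of_injective _ hinj _ _ (fun i hi => by simp [hκ0 j i hi])
      fun l => by rw [hκ]).symm
  have h2 : ∀ j, ∑ i, (κ' j i : ℝ) * ν i = ∑ l, (κ j l : ℝ) * ω l := fun j =>
    (Fintype.sum_of_injective _ hinj _ _ (fun i hi => by simp [hκ0 j i hi])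
      fun l => by rw [hκ, hext]).symm
  refine isQuasiperiodic_of_hasSum κ' a (fun p α => ?_) fun t α => ?_
  · simpa only [h1] using ha p α
  · simpa only [h2] using hZ t α

end Quasiperiodic

/-! ### Rotations acting on Fourier modes -/

section ComplexRotation

open Complex

/-- A real vector, as a complex vector. -/
def complexify (k : E3) : Fin 3 → ℂ := fun i => (k i : ℂ)

lemma hasSum_cross {J : Type*} {b : J → Fin 3 → ℂ} {u : E3} (k : E3)
    (h : ∀ α, HasSum (fun j => b j α) ((u α : ℝ) : ℂ)) (α : Fin 3) :
    HasSum (fun j => crossProduct (complexify k) (b j) α) ((cross k u α : ℝ) : ℂ) := by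
  have key : ∀ p q : Fin 3, HasSum (fun j => (k p : ℂ) * b j q - (k q : ℂ) * b j p)
      (((k p * u q - k q * u p : ℝ)) : ℂ) := fun p q => by
    push_cast
    exact ((h q).mul_left _).sub ((h p).mul_left _)
  fin_cases α
  · simpa [crossProduct, complexify, cross_apply_zero] using key 1 2
  · simpa [crossProduct, complexify, cross_apply_one] using key 2 0
  · simpa [crossProduct, complexify, cross_apply_two] using key 0 1

/-- Eigenvalues of an infinitesimal rotation about a unit axis. -/
lemma eigenvalue_cases {k : E3} (hk : ‖k‖ = 1) {b : Fin 3 → ℂ} (hb : b ≠ 0) {μ : ℝ}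
    (h : crossProduct (complexify k) b = (I * μ) • b) : μ = 0 ∨ μ = 1 ∨ μ = -1 := by
  have hkk : dotProduct (complexify k) (complexify k) = 1 := by
    have h1 : k 0 * k 0 + k 1 * k 1 + k 2 * k 2 = 1 := by
      rw [← inner_eq_coord, real_inner_self_eq_norm_sq, hk]; norm_num
    simp only [dotProduct, Fin.sum_univ_three, complexify]
    have := congrArg (fun r : ℝ => (r : ℂ)) h1
    simpa using this
  -- X³ = -X applied to the eigenvalue iμ gives μ³ = μ.
  have h3 : crossProduct (complexify k) (crossProduct (complexify k)
      (crossProduct (complexify k) b)) = -crossProduct (complexify k) b := by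
    rw [cross_cross_eq_smul_sub_smul' (complexify k) (complexify k) b, hkk]
    simp
  rw [h, map_smul, h, map_smul, map_smul, h] at h3
  obtain ⟨α, hα⟩ := Function.ne_iff.mp hb
  have h4 := congrFun h3 α
  simp only [Pi.smul_apply, Pi.neg_apply, smul_eq_mul] at h4
  have h5 : (μ : ℂ) * (μ - 1) * (μ + 1) = 0 := by
    have h6 : (I * ((μ : ℂ) * (μ - 1) * (μ + 1))) * b α = 0 := by
      have hI : I ^ 3 = -I := by rw [pow_succ, I_sq]; ring
      linear_combination -h4 + (μ : ℂ) ^ 3 * b α * hI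
    exact ((mul_eq_zero.mp ((mul_eq_zero.mp h6).resolve_right hα)).resolve_left I_ne_zero)
  have h7 : μ * (μ - 1) * (μ + 1) = 0 := by exact_mod_cast h5
  rcases mul_eq_zero.mp h7 with h8 | h8
  · rcases mul_eq_zero.mp h8 with h9 | h9
    · exact Or.inl h9
    · exact Or.inr (Or.inl (by linarith))
  · exact Or.inr (Or.inr (by linarith))

/-- A rotation acts on the modes of an eigenvector by a phase. -/
lemma hasSum_axisRotation {J : Type*} {k : E3} (hk : ‖k‖ = 1) {b : J → Fin 3 → ℂ} {μ : J → ℝ}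
    (hμ : ∀ j, crossProduct (complexify k) (b j) = (I * μ j) • b j) {u : E3}
    (h : ∀ α, HasSum (fun j => b j α) ((u α : ℝ) : ℂ)) (φ : ℝ) (α : Fin 3) :
    HasSum (fun j => cexp (I * ((μ j * φ : ℝ) : ℂ)) * b j α)
      ((axisRotation k φ u α : ℝ) : ℂ) := by
  have h1 := hasSum_cross k h
  have h2 := hasSum_cross k h1
  have e : ((axisRotation k φ u α : ℝ) : ℂ) = ((u α : ℝ) : ℂ)
      + (Real.sin φ : ℂ) * ((cross k u α : ℝ) : ℂ)
      + (1 - (Real.cos φ : ℂ)) * ((cross k (cross k u) α : ℝ) : ℂ) := by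
    rw [axisRotation_eq hk]; simp
  rw [e]
  convert ((h α).add ((h1 α).mul_left _)).add ((h2 α).mul_left _) using 1
  funext j
  by_cases hb : b j = 0
  · simp [hb]
  have hE : cexp (I * ((μ j * φ : ℝ) : ℂ)) = Real.cos (μ j * φ) + Real.sin (μ j * φ) * I := by
    rw [mul_comm, exp_mul_I, ← ofReal_cos, ← ofReal_sin]
  rw [hE, hμ j, map_smul, hμ j]
  simp only [Pi.smul_apply, smul_eq_mul]
  -- Rodrigues' formula acts on the mode by 1 + iμ sin φ - μ²(1 - cos φ), which equals exp(iμφ)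
  -- because μ is 0, 1 or -1.
  rcases eigenvalue_cases hk hb (hμ j) with h0 | h0 | h0 <;> rw [h0]
  · simp
  · simp only [one_mul, ofReal_one, mul_one]
    linear_combination (Real.cos φ - 1 : ℂ) * b j α * I_mul_I
  · simp only [neg_mul, one_mul, Real.cos_neg, Real.sin_neg, ofReal_neg, ofReal_one]
    linear_combination (Real.cos φ - 1 : ℂ) * b j α * I_mul_I

end ComplexRotation

end RigidBodies
end

noncomputable section
namespace RigidBodies

/-! ### Real torus maps and relations between their coefficients -/

section TorusMap

open Complex

variable {Λ : Type*} {r : ℕ}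

/-- The vector function on the torus with the given Fourier coefficients. -/
def torusMap (a : Λ → Fin 3 → (Fin r → ℤ) → ℂ) (θ : Fin r → ℝ) : Λ → E3 :=
  fun l => WithLp.toLp 2 fun α => (torusSeries (a l α) θ).re

lemma torusMap_apply (a : Λ → Fin 3 → (Fin r → ℤ) → ℂ) (θ : Fin r → ℝ) (l : Λ) (α : Fin 3) :
    torusMap a θ l α = (torusSeries (a l α) θ).re := rfl

variable {a : Λ → Fin 3 → (Fin r → ℤ) → ℂ}

lemma contDiff_torusMap [Fintype Λ] (ha : ∀ l α, FastDecay (a l α)) :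
    ContDiff ℝ (⊤ : ℕ∞) (torusMap a) := by
  rw [contDiff_pi]
  intro l
  rw [contDiff_euclidean]
  intro α
  exact reCLM.contDiff.comp (contDiff_torusSeries (ha l α))

lemma isTorusPeriodic_torusMap (a : Λ → Fin 3 → (Fin r → ℤ) → ℂ) : IsTorusPeriodic (torusMap a) :=
  fun θ k => by
    funext l
    simp only [torusMap, fun α => isTorusPeriodic_torusSeries (a l α) θ k]

/-- A series that is real along a dense orbit is real. -/
lemma ofReal_re_torusSeries {b : (Fin r → ℤ) → ℂ} (hb : FastDecay b) {ν : Fin r → ℝ}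
    (hν : LinearIndependent ℚ ν) (h : ∀ t : ℝ, ∃ y : ℝ, torusSeries b (t • ν) = y)
    (θ : Fin r → ℝ) : (((torusSeries b θ).re : ℝ) : ℂ) = torusSeries b θ := by
  have hc := (contDiff_torusSeries hb).continuous
  have hp := isTorusPeriodic_torusSeries b
  refine congrFun (IsTorusPeriodic.eq_of_eq_on_orbit
    (f := fun θ => (((torusSeries b θ).re : ℝ) : ℂ)) (fun θ k => ?_) hp
    (continuous_ofReal.comp (continuous_re.comp hc)) hc hν fun t => ?_) θ
  · simp only [hp θ k]
  · obtain ⟨y, hy⟩ := h t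
    simp [hy]

/-- Fourier series of a directional derivative. -/
lemma ofReal_fderiv_torusMap [Fintype Λ] (ha : ∀ l α, FastDecay (a l α))
    (hre : ∀ l α θ, ((torusMap a θ l α : ℝ) : ℂ) = torusSeries (a l α) θ) (θ v : Fin r → ℝ)
    (l : Λ) (α : Fin 3) :
    ((fderiv ℝ (torusMap a) θ v l α : ℝ) : ℂ)
      = torusSeries (fun k => I * ((∑ i, (k i : ℝ) * v i : ℝ) : ℂ) * a l α k) θ := by
  have h1 : HasDerivAt (fun s : ℝ => θ + s • v) v 0 := by
    simpa using ((hasDerivAt_id (0 : ℝ)).smul_const v).const_add θ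
  have h2 : HasFDerivAt (torusMap a) (fderiv ℝ (torusMap a) θ) (θ + (0 : ℝ) • v) := by
    simpa using ((contDiff_torusMap ha).differentiable (by simp) θ).hasFDerivAt
  have h3 := hasDerivAt_pi.mp (h2.comp_hasDerivAt (0 : ℝ) h1) l
  have h4 : HasDerivAt (fun s : ℝ => torusMap a (θ + s • v) l α)
      (fderiv ℝ (torusMap a) θ v l α) 0 :=
    (EuclideanSpace.proj (𝕜 := ℝ) α).hasFDerivAt.comp_hasDerivAt (0 : ℝ) h3
  have h5 := h4.ofReal_comp
  simp only [hre] at h5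
  have h6 := hasDerivAt_torusSeries_line (ha l α) θ v 0
  rw [zero_smul, add_zero] at h6
  exact h5.unique h6

/-- A linear differential relation along a dense orbit gives a relation of coefficients. -/
lemma coeff_relation [Fintype Λ] (ha : ∀ l α, FastDecay (a l α))
    (hre : ∀ l α θ, ((torusMap a θ l α : ℝ) : ℂ) = torusSeries (a l α) θ) {ν : Fin r → ℝ}
    (hν : LinearIndependent ℚ ν) {v : Fin r → ℝ} {w : E3}
    (h : ∀ t : ℝ, fderiv ℝ (torusMap a) (t • ν) v + rotGen w (torusMap a (t • ν)) = 0)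
    (l : Λ) (k : Fin r → ℤ) :
    (I * ((∑ i, (k i : ℝ) * v i : ℝ) : ℂ)) • (fun α => a l α k)
      + crossProduct (complexify w) (fun α => a l α k) = 0 := by
  have hcomp : ∀ (t : ℝ) (α : Fin 3),
      torusSeries (fun k => I * ((∑ i, (k i : ℝ) * v i : ℝ) : ℂ) * a l α k) (t • ν)
        + ((cross w (torusMap a (t • ν) l) α : ℝ) : ℂ) = 0 := fun t α => by
    rw [← ofReal_fderiv_torusMap ha hre, ← ofReal_add]
    have := congrArg (fun x : Λ → E3 => ((x l α : ℝ) : ℂ)) (h t)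
    simpa using this
  have key : ∀ α p q : Fin 3, (∀ u : E3, cross w u α = w p * u q - w q * u p) →
      I * ((∑ i, (k i : ℝ) * v i : ℝ) : ℂ) * a l α k
        + ((w p : ℂ) * a l q k + -(w q : ℂ) * a l p k) = 0 := fun α p q hpq => by
    have hd1 := (ha l α).deriv v
    have hd2 := (ha l q).const_mul (w p : ℂ)
    have hd3 := (ha l p).const_mul (-(w q : ℂ))
    refine congrFun (coeff_eq_zero_of_torusSeries (hd1.add (hd2.add hd3)) hν fun t => ?_) k
    rw [torusSeries_add hd1 (hd2.add hd3), torusSeries_add hd2 hd3, torusSeries_const_mul,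
      torusSeries_const_mul, ← hcomp t α, hpq, ← hre, ← hre]
    push_cast
    ring
  funext α
  fin_cases α
  · simpa [crossProduct, complexify, sub_eq_add_neg] using key 0 1 2 fun u => cross_apply_zero _ _
  · simpa [crossProduct, complexify, sub_eq_add_neg] using key 1 2 0 fun u => cross_apply_one _ _
  · simpa [crossProduct, complexify, sub_eq_add_neg] using key 2 0 1 fun u => cross_apply_two _ _

end TorusMap

/-! ### Dimension bound for invariant tori -/

namespace GravSystem

variable {n : ℕ} {S : GravSystem n} {c : Fin (n + 1)}

/-- A nonzero rotation vector cannot fix a whole frame, so there are no rigid bodies; all positions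
and momenta are then parallel to `w`, and their vector products vanish. -/
lemma IsConstrained.angMom_eq_zero {x : Phase n S.solids} (hx : S.IsConstrained c x) {w : E3}
    (hw : w ≠ 0) (h : rotGen w x = 0) : angMom x = 0 := by
  have hl : ∀ l, cross w (x l) = 0 := fun l => congrFun h l
  have hs : IsEmpty S.solids := by
    refine ⟨fun j => hw ?_⟩
    have := sum_inner_cross_frame (hx.frame j) w w
    simpa [hl] using this
  have hp : ∀ u, cross w u = 0 → u = (‖w‖ ^ 2)⁻¹ • inner ℝ w u • w := fun u hu => by
    have := cross_cross_right w w u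
    rw [hu, cross_zero_right, real_inner_self_eq_norm_sq, eq_comm, sub_eq_zero] at this
    rw [this, inv_smul_smul₀ (by positivity)]
  rw [angMom, Finset.univ_eq_empty (α := S.solids), Finset.sum_empty, add_zero]
  refine Finset.sum_eq_zero fun i _ => ?_
  rw [hp _ (hl (slotPos i)), cross_smul_left, cross_smul_left, hl, smul_zero, smul_zero]

lemma exists_cross_ne_zero {w : E3} (hw : w ≠ 0) : ∃ e, cross e w ≠ 0 := by
  by_contra! h
  have := sum_inner_cross_frame (EuclideanSpace.basisFun (Fin 3) ℝ).orthonormal w w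
  simp only [cross_anticomm w, h] at this
  simp at this
  exact hw this

namespace IsTorusSolution

variable {m : ℕ} {ω : Fin m → ℝ} {F : (Fin m → ℝ) → Phase n S.solids}
  {X : ℝ → State n S.solids} (h : IsTorusSolution (c := c) ω F X)
include h

/-- The tangent space of an invariant torus, together with rotations about the angular momentum
and about one further axis, is isotropic. -/
lemma finrank_torus_le (himm : ∀ v, fderiv ℝ F 0 v = 0 → v = 0) (hW : angMom (F 0) ≠ 0)
    {W : Type*} [AddCommGroup W] [Module ℝ W] [FiniteDimensional ℝ W]
    (χ : (Fin m → ℝ) × ℝ →ₗ[ℝ] W)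
    (hχ : ∀ (v : Fin m → ℝ) (κ : ℝ), fderiv ℝ F 0 v + rotGen (κ • angMom (F 0)) (F 0) = 0 →
      χ (v, κ) = 0 → κ = 0) :
    m + 2 ≤ 3 * (n + S.solids.card) + Module.finrank ℝ W := by
  obtain ⟨e, he⟩ := exists_cross_ne_zero hW
  have hx := h.isConstrained 0
  set x := F 0 with hxdef
  let L : (Fin m → ℝ) × ℝ × ℝ →ₗ[ℝ] Phase n S.solids :=
    { toFun := fun u => fderiv ℝ F 0 u.1 + rotGen (u.2.1 • angMom x + u.2.2 • e) x
      map_add' := fun u u' => by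
        funext l
        simp only [Prod.fst_add, Prod.snd_add, map_add, Pi.add_apply, rotGen_apply,
          cross_add_left, cross_smul_left, add_smul]
        abel
      map_smul' := fun t u => by
        funext l
        simp only [Prod.smul_fst, Prod.smul_snd, map_smul, Pi.add_apply, Pi.smul_apply,
          rotGen_apply, cross_add_left, cross_smul_left, smul_eq_mul, mul_smul, smul_add,
          RingHom.id_apply] }
  have hLdef : ∀ u, L u = fderiv ℝ F 0 u.1 + rotGen (u.2.1 • angMom x + u.2.2 • e) x :=
    fun _ => rfl
  have hvar : ∀ u, ∃ b, S.IsVariation c x (L u) b := fun u => by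
    obtain ⟨b, hb⟩ := h.exists_isVariation 0 u.1
    exact ⟨_, hb.add c (isVariation_rotGen c hx _)⟩
  have hd : ∀ v, dAngMom x (fderiv ℝ F 0 v) = 0 := h.dAngMom_eq_zero 0
  have hdadd : ∀ δ δ' : Phase n S.solids, dAngMom x (δ + δ') = dAngMom x δ + dAngMom x δ' :=
    fun δ δ' => by
      simp only [dAngMom, Pi.add_apply, cross_add_left, cross_add_right, Finset.sum_add_distrib]
      abel
  have hdL : ∀ u, dAngMom x (L u) = u.2.2 • cross e (angMom x) := fun u => by
    rw [hLdef, hdadd, hd, dAngMom_rotGen, cross_add_left, cross_smul_left, cross_smul_left,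
      cross_self, smul_zero, zero_add, zero_add]
  -- Pairing with a rotation amounts to the product with `dAngMom`. On the family this differential
  -- is zero or parallel to e × W, which is orthogonal to both axes W and e.
  have hiso : ∀ u u', symplectic x (L u) (L u') = 0 := fun u u' => by
    obtain ⟨b, hb⟩ := h.exists_isVariation 0 u.1
    obtain ⟨b', hb'⟩ := hvar u'
    have h1 : symplectic x (rotGen (u.2.1 • angMom x + u.2.2 • e) x) (L u') = 0 := by
      have hz : inner ℝ (angMom x) (cross e (angMom x)) = 0 ∧
          inner ℝ e (cross e (angMom x)) = 0 := by
        constructor <;> simp only [inner_eq_coord, cross_apply_zero, cross_apply_one,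
          cross_apply_two] <;> ring
      rw [symplectic_rotGen hx hb', hdL, inner_add_left, inner_smul_left, inner_smul_left,
        inner_smul_right, inner_smul_right, hz.1, hz.2]
      simp
    have h2 : symplectic x (fderiv ℝ F 0 u.1) (L u') = 0 := by
      rw [symplectic_antisymm, hLdef u', symplectic_add_left, symplectic_rotGen hx hb, hd,
        h.symplectic_eq_zero 0, inner_zero_right]
      simp
    rw [hLdef u, symplectic_add_left, h1, h2, add_zero]
  have hfin := finrank_le_of_symplectic_eq_zero hx L hvar hiso
    (χ ∘ₗ (LinearMap.fst ℝ _ _).prod (LinearMap.fst ℝ ℝ ℝ ∘ₗ LinearMap.snd ℝ _ _))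
    -- In the kernel, the differential of the angular momentum kills the coefficient of `e`, the
    -- hypothesis on `χ` kills that of W, and immersion kills the tangent vector.
    fun u hu hu' => by
      have h1 := hdL u
      rw [hu] at h1
      have h2 : u.2.2 = 0 := by
        have : dAngMom x (0 : Phase n S.solids) = 0 := by simp [dAngMom, cross_zero_left, cross_zero_right]
        rw [this] at h1
        exact (smul_eq_zero.mp h1.symm).resolve_right he
      rw [hLdef, h2, zero_smul, add_zero] at hu
      have h3 : u.2.1 = 0 := hχ u.1 u.2.1 hu hu'
      have h4 : u.1 = 0 := himm u.1 (by
        funext l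
        simpa [h3, cross_zero_left] using congrFun hu l)
      exact Prod.ext h4 (Prod.ext h3 h2)
  simpa [Module.finrank_prod] using hfin

end IsTorusSolution
end GravSystem
end RigidBodies
end

noncomputable section
namespace RigidBodies

/-! ### Splitting off one frequency -/

section Lattice

open Complex in
lemma FastDecay.hasSum_smul {m : ℕ} {a : (Fin m → ℤ) → ℂ} (ha : FastDecay a) (ω : Fin m → ℝ)
    (t : ℝ) :
    HasSum (fun k : Fin m → ℤ => a k * cexp (I * (((∑ l, k l * ω l) * t : ℝ) : ℂ)))
      (torusSeries a (t • ω)) := by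
  rw [torusSeries_smul]
  refine Summable.hasSum (.of_norm (ha.summable_norm.congr fun k => ?_))
  rw [norm_mul, norm_cexp_I_mul_ofReal, mul_one]

/-- A linear form that takes the values `0`, `1`, `-1`, not all zero, on generators of the group of
modes separates one independent frequency from the others. -/
lemma exists_frequency_splitting {r : ℕ} {ν : Fin r → ℝ} (hν : LinearIndependent ℚ ν)
    {v : Fin r → ℝ} {T : Set (Fin r → ℤ)} (hT : Submodule.span ℤ T = ⊤)
    (hv : ∀ k ∈ T, ∑ i, (k i : ℝ) * v i = 0 ∨ ∑ i, (k i : ℝ) * v i = 1 ∨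
      ∑ i, (k i : ℝ) * v i = -1)
    (hv0 : ∃ k ∈ T, ∑ i, (k i : ℝ) * v i ≠ 0) :
    ∃ (r' : ℕ) (ω : Fin r' → ℝ) (Ω C : ℝ) (κ : (Fin r → ℤ) → Fin r' → ℤ), r' + 1 ≤ r ∧
      LinearIndependent ℚ ω ∧ 0 ≤ C ∧ (∀ k, ∑ i, |(κ k i : ℝ)| ≤ C * ∑ l, |(k l : ℝ)|) ∧
      ∀ k, ∑ l, (k l : ℝ) * ν l = (∑ l, (k l : ℝ) * v l) * Ω + ∑ i, (κ k i : ℝ) * ω i := by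
  -- Integer values on generators give integer values on the standard basis vectors.
  have hz : ∀ i, ∃ z : ℤ, v i = z := fun i => by
    have hk : ∀ k ∈ Submodule.span ℤ T, ∃ z : ℤ, ∑ i, (k i : ℝ) * v i = z := fun k hk => by
      induction hk using Submodule.span_induction with
      | mem k hk =>
        rcases hv k hk with h | h | h
        · exact ⟨0, by simpa using h⟩
        · exact ⟨1, by simpa using h⟩
        · exact ⟨-1, by simpa using h⟩
      | zero => exact ⟨0, by simp⟩
      | add k k' _ _ h h' =>
        obtain ⟨z, hz⟩ := h
        obtain ⟨z', hz'⟩ := h'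
        exact ⟨z + z', by simp [add_mul, Finset.sum_add_distrib, hz, hz']⟩
      | smul d k _ h =>
        obtain ⟨z, hz⟩ := h
        exact ⟨d * z, by simp [mul_assoc, ← Finset.mul_sum, hz]⟩
    obtain ⟨z, hz⟩ := hk (Pi.single i 1) (hT ▸ Submodule.mem_top)
    exact ⟨z, by simpa [Pi.single_apply] using hz⟩
  choose z hz using hz
  let μ : (Fin r → ℤ) →ₗ[ℤ] ℤ := ∑ i, z i • LinearMap.proj i
  have hμ : ∀ k, ∑ i, (k i : ℝ) * v i = (μ k : ℝ) := fun k => by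
    simp [μ, hz, mul_comm]
  -- A generator with value ±1, up to sign. Hence the form is onto ℤ, the lattice is its kernel plus
  -- ℤ k₀, and Ω will be the frequency of `k₀`.
  obtain ⟨k₀, hk₀⟩ : ∃ k₀, μ k₀ = 1 := by
    obtain ⟨k, hk, hne⟩ := hv0
    have h1 := hv k hk
    rw [hμ] at h1 hne
    rcases h1 with h | h | h
    · exact absurd h hne
    · exact ⟨k, by exact_mod_cast h⟩
    · refine ⟨-k, ?_⟩
      have : μ k = -1 := by exact_mod_cast h
      rw [map_neg, this, neg_neg]
  obtain ⟨r', B, -, -, hB, hrange, -⟩ := exists_parametrization (LinearMap.ker μ)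
  have hμB : ∀ k, μ (B k) = 0 := fun k => by
    have : B k ∈ LinearMap.ker μ := hrange ▸ LinearMap.mem_range_self B k
    exact this
  have hmem : ∀ k, (LinearMap.id - μ.smulRight k₀ : (Fin r → ℤ) →ₗ[ℤ] _) k
      ∈ LinearMap.range B := fun k => by
    rw [hrange, LinearMap.mem_ker]
    show μ (k - μ k • k₀) = 0
    rw [map_sub, map_smul, hk₀, smul_eq_mul, mul_one, sub_self]
  let g : (Fin r → ℤ) →ₗ[ℤ] (Fin r' → ℤ) :=
    (LinearEquiv.ofInjective B hB).symm.toLinearMap ∘ₗ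
      LinearMap.codRestrict (LinearMap.range B) (LinearMap.id - μ.smulRight k₀) hmem
  have hg : ∀ k, B (g k) = k - μ k • k₀ := fun k =>
    congrArg Subtype.val ((LinearEquiv.ofInjective B hB).apply_symm_apply ⟨_, hmem k⟩)
  obtain ⟨C, hC, hbound⟩ := exists_bound_of_linearMap g
  refine ⟨r', fun i => ∑ l, (B (Pi.single i 1) l : ℝ) * ν l, ∑ l, (k₀ l : ℝ) * ν l, C, g, ?_,
    ?_, hC, hbound, fun k => ?_⟩
  · have hinj : Function.Injective (B.coprod (LinearMap.toSpanSingleton ℤ (Fin r → ℤ) k₀)) := by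
      rw [injective_iff_map_eq_zero]
      rintro ⟨k, d⟩ h
      simp only [LinearMap.coprod_apply, LinearMap.toSpanSingleton_apply] at h
      have h1 := congrArg μ h
      rw [map_add, hμB, map_smul, hk₀, map_zero] at h1
      have h2 : d = 0 := by simpa using h1
      rw [h2, zero_smul, add_zero] at h
      exact Prod.ext (hB (h.trans (map_zero B).symm)) h2
    simpa using LinearMap.finrank_le_finrank_of_injective hinj
  · refine linearIndependent_frequency hν (b := fun i => B (Pi.single i 1)) ?_
    have := (Pi.basisFun ℤ (Fin r')).linearIndependent.map' B (LinearMap.ker_eq_bot.mpr hB)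
    simpa [Function.comp_def] using this
  · rw [frequency_comp, hg, hμ]
    simp only [Pi.sub_apply, Pi.smul_apply, smul_eq_mul, Int.cast_sub, Int.cast_mul, sub_mul,
      Finset.sum_sub_distrib, mul_assoc, ← Finset.mul_sum]
    ring

end Lattice

/-! ### From quasiperiodic solutions to tori, and the final dichotomy -/

namespace GravSystem

open Complex

variable {n : ℕ} {S : GravSystem n} {c : Fin (n + 1)} {X : ℝ → State n S.solids}

variable (S c) in
/-- The slot of the phase space that holds a vector of the description centred on body `c`. -/
def slotOf : S.VectorLabel c → Slot n S.solids
  | .position i _ => slotPos i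
  | .momentum i _ => slotMom i
  | .axisI j => slotAx j 0
  | .axisJ j => slotAx j 1
  | .axisK j => slotAx j 2
  | .spin j => slotSpin j

lemma vector_eq_reduced (Y : State n S.solids) (l : S.VectorLabel c) :
    S.vector c Y l = S.reduced c Y (slotOf S c l) := by
  cases l <;> rfl

/-- The two slots of body `c`, absent from the description of the system, are zero and minus the sum
of the other momenta. -/
lemma isQuasiperiodic_reduced (hX : S.IsSolution X) {m : ℕ} {ω : Fin m → ℝ}
    (h : ∀ l : S.VectorLabel c, IsQuasiperiodic ω fun t => S.vector c (X t) l)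
    (l : Slot n S.solids) : IsQuasiperiodic ω fun t => S.reduced c (X t) l := by
  have hc : ∀ t, S.IsConstrained c (S.reduced c (X t)) := fun t =>
    (hX.admissible t).isConstrained_reduced c
  have hmom : ∀ i, i ≠ c → IsQuasiperiodic ω fun t => S.reduced c (X t) (slotMom i) :=
    fun i hi => h (.momentum i hi)
  rcases l with (i | i) | (⟨j, a⟩ | j)
  · by_cases hi : i = c
    · subst hi
      convert isQuasiperiodic_zero ω using 2 with t
      exact (hc t).pos
    · exact h (.position i hi)
  · by_cases hi : i = c
    · subst hi
      convert (IsQuasiperiodic.sum (Finset.univ.erase i)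
        fun i' hi' => hmom i' (Finset.ne_of_mem_erase hi')).neg using 2 with t
      have := (hc t).mom
      rw [← Finset.add_sum_erase _ _ (Finset.mem_univ i)] at this
      exact eq_neg_of_add_eq_zero_left this
    · exact hmom i hi
  · fin_cases a
    · exact h (.axisI j)
    · exact h (.axisJ j)
    · exact h (.axisK j)
  · exact h (.spin j)

/-- Regular quasiperiodic solutions wind densely on a smooth invariant torus, with frequencies that
are all active. -/
lemma IsRegularQuasiperiodic.exists_torusSolution (hX : S.IsRegularQuasiperiodic c X) :
    ∃ (r : ℕ) (ν : Fin r → ℝ) (a : Slot n S.solids → Fin 3 → (Fin r → ℤ) → ℂ),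
      (∀ l α, FastDecay (a l α)) ∧
      (∀ l α θ, ((torusMap a θ l α : ℝ) : ℂ) = torusSeries (a l α) θ) ∧
      Submodule.span ℤ {k | ∃ l α, a l α k ≠ 0} = ⊤ ∧
      IsTorusSolution (c := c) ν (torusMap a) X := by
  obtain ⟨hsol, m, ω, hω, hq⟩ := hX
  obtain ⟨r, ν, a, hν, ha, hval, hspan⟩ := exists_spanning_coefficients hω
    (x := fun t => S.reduced c (X t)) fun l => isQuasiperiodic_reduced hsol hq l
  refine ⟨r, ν, a, ha, fun l α θ => ?_, hspan, hν, contDiff_torusMap ha, isTorusPeriodic_torusMap a,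
    fun t => ?_, hsol⟩
  · exact ofReal_re_torusSeries (ha l α) hν (fun t => ⟨_, hval t l α⟩) θ
  · funext l
    ext α
    rw [torusMap_apply, hval, ofReal_re]

section Modes

variable {r : ℕ} {ν : Fin r → ℝ} {a : Slot n S.solids → Fin 3 → (Fin r → ℤ) → ℂ}
  (ha : ∀ l α, FastDecay (a l α))
  (hre : ∀ l α θ, ((torusMap a θ l α : ℝ) : ℂ) = torusSeries (a l α) θ)
  (hsol : IsTorusSolution (c := c) ν (torusMap a) X)
include ha hre hsol

/-- The torus is immersed as soon as all frequencies are active. -/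
lemma eq_zero_of_fderiv_torusMap (hspan : Submodule.span ℤ {k | ∃ l α, a l α k ≠ 0} = ⊤)
    (v : Fin r → ℝ) (hv : fderiv ℝ (torusMap a) 0 v = 0) : v = 0 := by
  have h0 : fderiv ℝ (torusMap a) 0 v + rotGen 0 (torusMap a 0) = 0 := by
    rw [hv, zero_add]
    funext l
    exact cross_zero_left _
  have hrel := coeff_relation ha hre hsol.indep (hsol.fderiv_add_rotGen_eq_zero h0)
  have hk : ∀ k ∈ Submodule.span ℤ {k | ∃ l α, a l α k ≠ 0}, ∑ i, (k i : ℝ) * v i = 0 :=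
    fun k hk => by
      induction hk using Submodule.span_induction with
      | mem k hk =>
        obtain ⟨l, α, hne⟩ := hk
        have h1 := congrFun (hrel l k) α
        have h2 : complexify 0 = 0 := by funext i; simp [complexify]
        rw [h2, map_zero, LinearMap.zero_apply, add_zero, Pi.smul_apply, smul_eq_mul] at h1
        have h3 := (mul_eq_zero.mp ((mul_eq_zero.mp h1).resolve_right hne)).resolve_left I_ne_zero
        exact_mod_cast h3
      | zero => simp
      | add k k' _ _ h h' => simp [add_mul, Finset.sum_add_distrib, h, h']
      | smul d k _ h => simp [mul_assoc, ← Finset.mul_sum, h]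
  funext i
  simpa [Pi.single_apply] using hk (Pi.single i 1) (hspan ▸ Submodule.mem_top)

/-- Rotation out of the modes when rotations about the angular momentum move the torus along
itself. -/
lemma exists_rotating_frame (hspan : Submodule.span ℤ {k | ∃ l α, a l α k ≠ 0} = ⊤)
    (hW : angMom (torusMap a 0) ≠ 0) {e : E3} (he : ‖e‖ = 1) {v : Fin r → ℝ}
    (hv : fderiv ℝ (torusMap a) 0 v = rotGen e (torusMap a 0)) {N : ℕ} (hN : r ≤ N + 1) :
    ∃ (Ω : ℝ) (ω : Fin N → ℝ), LinearIndependent ℚ ω ∧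
      ∀ l, IsQuasiperiodic ω fun t => axisRotation e (-(Ω * t)) (torusMap a (t • ν) l) := by
  have h0 : fderiv ℝ (torusMap a) 0 v + rotGen (-e) (torusMap a 0) = 0 := by
    rw [hv]
    funext l
    simp [cross_neg_left]
  have hrel : ∀ l k, crossProduct (complexify e) (fun α => a l α k)
      = (I * ((∑ i, (k i : ℝ) * v i : ℝ) : ℂ)) • fun α => a l α k := fun l k => by
    have h1 := coeff_relation ha hre hsol.indep (hsol.fderiv_add_rotGen_eq_zero h0) l k
    have h2 : complexify (-e) = -complexify e := by funext i; simp [complexify]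
    rw [h2, map_neg, LinearMap.neg_apply, ← sub_eq_add_neg, sub_eq_zero] at h1
    exact h1.symm
  -- By `hrel` active modes are eigenvectors, so `v` takes only the values 0, ±1 on them. If all
  -- were 0, the derivative of the torus map along `v` would vanish, hence e × F(0) = 0,
  -- contradicting `hW`.
  obtain ⟨r', ω, Ω, C, κ, hr', hω, hC, hκ, hsplit⟩ := exists_frequency_splitting hsol.indep hspan
    (v := v) (fun k hk => by
      obtain ⟨l, α, hne⟩ := hk
      exact eigenvalue_cases he (fun h => hne (congrFun h α)) (hrel l k)) (by
      by_contra! hall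
      refine hW ((hsol.isConstrained 0).angMom_eq_zero (w := e) (fun h => by simp [h] at he) ?_)
      rw [← hv]
      funext l
      ext α
      have h1 := ofReal_fderiv_torusMap ha hre 0 v l α
      have h2 : (fun k : Fin r → ℤ => I * ((∑ i, (k i : ℝ) * v i : ℝ) : ℂ) * a l α k)
          = fun _ => 0 := by
        funext k
        by_cases hk : a l α k = 0
        · rw [hk, mul_zero]
        · rw [hall k ⟨l, α, hk⟩, ofReal_zero, mul_zero, zero_mul]
      rw [h2] at h1
      simpa [torusSeries] using h1)
  obtain ⟨ω', hω', hpad⟩ := exists_padding (show r' ≤ N by omega) hω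
  refine ⟨Ω, ω', hω', fun l => hpad κ (fun k α => a l α k) _ (fun p α => ?_) fun t α => ?_⟩
  · refine Summable.of_nonneg_of_le (fun k => by positivity) (fun k => ?_)
      ((ha l α p).mul_left (C ^ p))
    rw [← mul_assoc, ← mul_pow]
    gcongr
    exact hκ k
  · have h1 : ∀ β, HasSum (fun k : Fin r → ℤ =>
        a l β k * cexp (I * (((∑ i, (k i : ℝ) * ν i) * t : ℝ) : ℂ)))
        ((torusMap a (t • ν) l β : ℝ) : ℂ) := fun β => by
      rw [hre]
      exact (ha l β).hasSum_smul ν t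
    have h2 := hasSum_axisRotation he (J := Fin r → ℤ)
      (b := fun k β => a l β k * cexp (I * (((∑ i, (k i : ℝ) * ν i) * t : ℝ) : ℂ)))
      (μ := fun k => ∑ i, (k i : ℝ) * v i) (fun k => ?_) h1 (-(Ω * t)) α
    · convert h2 using 1
      funext k
      -- The phase produced by the rotation cancels exactly the Ω-part of the frequency of the mode.
      rw [mul_left_comm, ← Complex.exp_add, hsplit k]
      congr 2
      push_cast
      ring
    · have : (fun β => a l β k * cexp (I * (((∑ i, (k i : ℝ) * ν i) * t : ℝ) : ℂ)))
          = cexp (I * (((∑ i, (k i : ℝ) * ν i) * t : ℝ) : ℂ)) • fun β => a l β k := by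
        funext β
        simp [mul_comm]
      rw [this, map_smul, hrel, smul_comm]

end Modes

lemma IsRegularQuasiperiodic.exists_reduction (hX : S.IsRegularQuasiperiodic c X)
    (hW : S.angularMomentum c (X 0) ≠ 0) :
    (∀ t, S.angularMomentum c (X t) = S.angularMomentum c (X 0)) ∧
    ∃ (Ω : ℝ) (ω : Fin (3 * (n + S.solids.card) - 2) → ℝ), LinearIndependent ℚ ω ∧
      ∀ l : Slot n S.solids, IsQuasiperiodic ω fun t => axisRotation
        (‖S.angularMomentum c (X 0)‖⁻¹ • S.angularMomentum c (X 0)) (-(Ω * t))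
        (S.reduced c (X t) l) := by
  obtain ⟨r, ν, a, ha, hre, hspan, hsol⟩ := hX.exists_torusSolution
  have hang : ∀ t : ℝ, angMom (torusMap a (t • ν)) = S.angularMomentum c (X t) := fun t => by
    rw [hsol.orbit t]; rfl
  have h00 : angMom (torusMap a 0) = S.angularMomentum c (X 0) := by
    simpa using hang 0
  refine ⟨fun t => by rw [← hang, hsol.angMom_eq, h00], ?_⟩
  have hW' : angMom (torusMap a 0) ≠ 0 := h00 ▸ hW
  have himm := eq_zero_of_fderiv_torusMap ha hre hsol hspan
  rw [← h00]
  set W := angMom (torusMap a 0) with hWdef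
  have hnorm : ‖W‖ ≠ 0 := norm_ne_zero_iff.mpr hW'
  have he : ‖‖W‖⁻¹ • W‖ = 1 := by
    rw [norm_smul, norm_inv, norm_norm, inv_mul_cancel₀ hnorm]
  simp only [← hsol.orbit]
  by_cases hex : ∃ v, fderiv ℝ (torusMap a) 0 v = rotGen (‖W‖⁻¹ • W) (torusMap a 0)
  · obtain ⟨v, hv⟩ := hex
    -- Rotation about W already lies in the tangent space, so its coefficient is recorded by `χ`,
    -- which costs one dimension; the rotating frame recovers it.
    have hdim := hsol.finrank_torus_le himm hW' (LinearMap.snd ℝ _ ℝ) fun v κ _ h => h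
    rw [Module.finrank_self] at hdim
    exact exists_rotating_frame ha hre hsol hspan hW' he hv (by omega)
  -- No correction is needed: a tangent nonzero multiple of the rotation about W could be rescaled
  -- to the excluded vector.
  · have hdim := hsol.finrank_torus_le himm hW' (0 : (Fin r → ℝ) × ℝ →ₗ[ℝ] PUnit) fun v κ h _ => by
      by_contra hκ
      refine hex ⟨-(κ⁻¹ * ‖W‖⁻¹) • v, ?_⟩
      rw [map_smul, eq_neg_of_add_eq_zero_left h]
      funext l
      simp only [Pi.smul_apply, Pi.neg_apply, rotGen_apply, cross_smul_left]
      rw [smul_neg, neg_smul, neg_neg, smul_smul, mul_right_comm, inv_mul_cancel₀ hκ, one_mul]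
    rw [Module.finrank_zero_of_subsingleton] at hdim
    obtain ⟨ω, hω, hpad⟩ := exists_padding
      -- The subtraction is not truncated: `hdim` already forces the product to be at least 2.
      (show r ≤ 3 * (n + S.solids.card) - 2 by omega) hsol.indep
    refine ⟨0, ω, hω, fun l => hpad id (fun k α => a l α k) _ (fun p α => ha l α p) fun t α => ?_⟩
    rw [zero_mul, neg_zero, axisRotation_zero, hre]
    exact (ha l α).hasSum_smul ν t

end GravSystem

end RigidBodies

end

theorem proposition3 {n : ℕ} (S : RigidBodies.GravSystem n) (c : Fin (n + 1))
    (X : ℝ → RigidBodies.State n S.solids) (hX : S.IsRegularQuasiperiodic c X)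
    (W₀ : RigidBodies.E3) (hW₀ : W₀ = S.angularMomentum c (X 0)) (hne : W₀ ≠ 0) :
    (∀ t, S.angularMomentum c (X t) = W₀) ∧
    ∃ (Ω : ℝ) (ν : Fin (3 * (n + S.solids.card) - 2) → ℝ),
      LinearIndependent ℚ ν ∧
      ∀ l : S.VectorLabel c, ∃ Ztilde : ℝ → RigidBodies.E3,
        RigidBodies.IsQuasiperiodic ν Ztilde ∧
        ∀ t, S.vector c (X t) l =
          RigidBodies.axisRotation (‖W₀‖⁻¹ • W₀) (Ω * t) (Ztilde t) := by
  subst hW₀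
  obtain ⟨hconst, Ω, ν, hν, hq⟩ := hX.exists_reduction hne
  refine ⟨hconst, Ω, ν, hν, fun l => ⟨_, hq (RigidBodies.GravSystem.slotOf S c l), fun t => ?_⟩⟩
  rw [RigidBodies.axisRotation_axisRotation_neg, ← RigidBodies.GravSystem.vector_eq_reduced]
  rw [norm_smul, norm_inv, norm_norm, inv_mul_cancel₀ (norm_ne_zero_iff.mpr hne)]
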